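/- Let $P$ be a funnel polygon, that is, a closed region bounded by a simple polygon with vertices $v_1,\dots,v_n$ in boundary order ($n\ge 3$, clockwise or counterclockwise) such that for some $1<t<n$ the interior angles at $v_1$, $v_t$ and $v_n$ are less than $\pi$ and the interior angles at all other vertices are greater than $\pi$. So $P$ consists of the convex edge $v_nv_1$ and the two reflex chains $v_1,\dots,v_t$ and $v_t,\dots,v_n$. Two points $x,y\in P$ see each other if the segment $xy$ is contained in $P$. A hidden set in $P$ is a set of points of $P$ no two of which see each other, and $hs(P)$ is the largest cardinality of a hidden set in $P$. A convex cover of $P$ is a set of convex polygons whose union is $P$, and $cc(P)$ is the smallest cardinality of a convex cover of $P$. Theorem. There is an algorithm that, given the number $n$ and the list of coordinates of $v_1,\dots,v_n$ for any funnel polygon $P$, computes in $O(n)$ steps of a real RAM a hidden set $H$ in $P$ and a convex cover $C$ of $P$ with $|H|=|C|$. The real RAM performs additions, subtractions, multiplications, divisions and comparisons of real numbers, integer index arithmetic and comparisons, and indirect memory accesses in one step each. Consequently $|H|=hs(P)$ and $|C|=cc(P)$, so both are optimal, and $cc(P)=hs(P)$, i.e. every funnel polygon is a homestead polygon. -/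

import Mathlib

open Set Topology

noncomputable section

/-! ## Polygons in the plane

The plane is `ℝ × ℝ`; only its affine structure and its topology are used. -/

/-- Twice the signed area of the triangle `a b c`: positive iff `a, b, c` is a left turn. -/
def orient (a b c : ℝ × ℝ) : ℝ :=
  (b.1 - a.1) * (c.2 - a.2) - (b.2 - a.2) * (c.1 - a.1)

/-- The `i`-th edge of the closed polygonal chain `v 0, v 1, …, v (n - 1), v 0`
(`finRotate n` is the cyclic successor on `Fin n`). -/
def polyEdge {n : ℕ} (v : Fin n → ℝ × ℝ) (i : Fin n) : Set (ℝ × ℝ) :=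
  segment ℝ (v i) (v (finRotate n i))

/-- The closed polygonal chain itself, i.e. the boundary of the polygon. -/
def polyBoundary {n : ℕ} (v : Fin n → ℝ × ℝ) : Set (ℝ × ℝ) :=
  ⋃ i, polyEdge v i

/-- `v 0, …, v (n - 1)` are, in boundary order, the vertices of a simple polygon: they are
distinct, consecutive edges meet in their common vertex only, other edges are disjoint. -/
structure IsSimplePolygon {n : ℕ} (v : Fin n → ℝ × ℝ) : Prop where
  three_le : 3 ≤ n
  injective : Function.Injective v
  consecutive : ∀ i, polyEdge v i ∩ polyEdge v (finRotate n i) = {v (finRotate n i)}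
  nonconsecutive : ∀ i j, i ≠ j → j ≠ finRotate n i → i ≠ finRotate n j →
    Disjoint (polyEdge v i) (polyEdge v j)

/-- The closed region bounded by the chain: the chain together with the bounded connected
components of its complement. -/
def polyRegion {n : ℕ} (v : Fin n → ℝ × ℝ) : Set (ℝ × ℝ) :=
  polyBoundary v ∪
    {x | x ∈ (polyBoundary v)ᶜ ∧
      Bornology.IsBounded (connectedComponentIn (polyBoundary v)ᶜ x)}

/-- The triangle spanned by the vertex `v i` and its two neighbours. -/
def cornerTriangle {n : ℕ} (v : Fin n → ℝ × ℝ) (i : Fin n) : Set (ℝ × ℝ) :=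
  convexHull ℝ {v ((finRotate n).symm i), v i, v (finRotate n i)}

/-- The interior angle at `v i` is less than `π`: there is a turn at `v i`, and near `v i` the
wedge between the two edges at `v i` lies in the polygon. -/
def IsConvexVertex {n : ℕ} (v : Fin n → ℝ × ℝ) (i : Fin n) : Prop :=
  orient (v ((finRotate n).symm i)) (v i) (v (finRotate n i)) ≠ 0 ∧
    ∃ U ∈ 𝓝 (v i), U ∩ cornerTriangle v i ⊆ polyRegion v

/-- The interior angle at `v i` is greater than `π`: there is a turn at `v i`, and near `v i` the
open wedge between the two edges at `v i` lies outside the polygon. -/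
def IsReflexVertex {n : ℕ} (v : Fin n → ℝ × ℝ) (i : Fin n) : Prop :=
  orient (v ((finRotate n).symm i)) (v i) (v (finRotate n i)) ≠ 0 ∧
    ∃ U ∈ 𝓝 (v i), Disjoint (U ∩ interior (cornerTriangle v i)) (polyRegion v)

/-- A funnel polygon: a simple polygon that consists of a convex edge from the last vertex to the
first one (both end points are convex vertices) and of two chains, from the first vertex to an
apex `v t` and from `v t` to the last vertex, all of whose inner vertices are strictly reflex.
The vertices may be listed clockwise or counterclockwise. -/
def IsFunnel {n : ℕ} (v : Fin n → ℝ × ℝ) : Prop :=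
  IsSimplePolygon v ∧
    ∃ a t b : Fin n, a.val = 0 ∧ b.val = n - 1 ∧ a < t ∧ t < b ∧
      IsConvexVertex v a ∧ IsConvexVertex v t ∧ IsConvexVertex v b ∧
      ∀ i, i ≠ a → i ≠ t → i ≠ b → IsReflexVertex v i

/-! ## Hidden sets and convex covers -/

/-- `x` and `y` see each other in `P`. -/
def Sees (P : Set (ℝ × ℝ)) (x y : ℝ × ℝ) : Prop :=
  segment ℝ x y ⊆ P

/-- A set of points of `P` no two of which see each other. -/
def IsHiddenSet (P H : Set (ℝ × ℝ)) : Prop :=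
  H ⊆ P ∧ H.Pairwise fun x y => ¬ Sees P x y

/-- `w 0, …, w (m - 1)` are the vertices of a (nondegenerate) convex polygon in boundary order,
clockwise or counterclockwise. -/
def IsConvexVertexList {m : ℕ} (w : Fin m → ℝ × ℝ) : Prop :=
  3 ≤ m ∧
    ((∀ i j k, i < j → j < k → 0 < orient (w i) (w j) (w k)) ∨
      (∀ i j k, i < j → j < k → orient (w i) (w j) (w k) < 0))

/-- A convex polygon, as a closed region. -/
def IsConvexPolygon (Q : Set (ℝ × ℝ)) : Prop :=
  ∃ (m : ℕ) (w : Fin m → ℝ × ℝ), IsConvexVertexList w ∧ Q = convexHull ℝ (range w)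

/-- A set of convex polygons whose union is `P`. -/
def IsConvexCover (P : Set (ℝ × ℝ)) (C : Set (Set (ℝ × ℝ))) : Prop :=
  (∀ Q ∈ C, IsConvexPolygon Q) ∧ ⋃₀ C = P

/-- `hs(P)`, the largest cardinality of a hidden set in `P`. -/
def hiddenSetNumber (P : Set (ℝ × ℝ)) : ℕ∞ :=
  ⨆ (H : Set (ℝ × ℝ)) (_ : IsHiddenSet P H), H.encard

/-- `cc(P)`, the smallest cardinality of a convex cover of `P`. -/
def convexCoverNumber (P : Set (ℝ × ℝ)) : ℕ∞ :=
  ⨅ (C : Set (Set (ℝ × ℝ))) (_ : IsConvexCover P C), C.encard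

/-- A homestead polygon: `cc(P) = hs(P)`. -/
def IsHomestead (P : Set (ℝ × ℝ)) : Prop :=
  convexCoverNumber P = hiddenSetNumber P

/-! ## The real RAM

A random access machine with integer registers and an integer memory, real registers and a real
memory. Memory cells are addressed indirectly, through integer registers. Every elementary
instruction and every test costs one step. There is no rounding of reals to integers. -/

namespace RealRAM

/-- A configuration: integer registers, integer memory, real registers, real memory. -/
structure State where
  ireg : ℕ → ℕ
  imem : ℕ → ℕ
  rreg : ℕ → ℝ
  rmem : ℕ → ℝ

/-- Elementary instructions. The arguments are fixed register numbers or constants; the first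
register is the target, except in the two `Store` instructions. -/
inductive Instr where
  | natConst (a k : ℕ)
  | natAdd (a b c : ℕ)
  | natSub (a b c : ℕ)
  | natLoad (a b : ℕ)
  | natStore (a b : ℕ)
  | realConst (a : ℕ) (q : ℚ)
  | realAdd (a b c : ℕ)
  | realSub (a b c : ℕ)
  | realMul (a b c : ℕ)
  | realDiv (a b c : ℕ)
  | realLoad (a b : ℕ)
  | realStore (a b : ℕ)

open Classical in
/-- The effect of an instruction; `none` means that the machine is stuck, which happens upon a
division by zero. Integer subtraction is truncated. -/
def Instr.run : Instr → State → Option State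
  | .natConst a k, s => some { s with ireg := Function.update s.ireg a k }
  | .natAdd a b c, s => some { s with ireg := Function.update s.ireg a (s.ireg b + s.ireg c) }
  | .natSub a b c, s => some { s with ireg := Function.update s.ireg a (s.ireg b - s.ireg c) }
  | .natLoad a b, s => some { s with ireg := Function.update s.ireg a (s.imem (s.ireg b)) }
  | .natStore a b, s => some { s with imem := Function.update s.imem (s.ireg a) (s.ireg b) }
  | .realConst a q, s => some { s with rreg := Function.update s.rreg a (q : ℝ) }
  | .realAdd a b c, s => some { s with rreg := Function.update s.rreg a (s.rreg b + s.rreg c) }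
  | .realSub a b c, s => some { s with rreg := Function.update s.rreg a (s.rreg b - s.rreg c) }
  | .realMul a b c, s => some { s with rreg := Function.update s.rreg a (s.rreg b * s.rreg c) }
  | .realDiv a b c, s =>
      if s.rreg c = 0 then none
      else some { s with rreg := Function.update s.rreg a (s.rreg b / s.rreg c) }
  | .realLoad a b, s => some { s with rreg := Function.update s.rreg a (s.rmem (s.ireg b)) }
  | .realStore a b, s => some { s with rmem := Function.update s.rmem (s.ireg a) (s.rreg b) }

/-- Tests: comparisons of two integer registers or of two real registers. -/
inductive Test where
  | natLe (a b : ℕ)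
  | realLe (a b : ℕ)

/-- The test succeeds in the given configuration. -/
def Test.Holds : Test → State → Prop
  | .natLe a b, s => s.ireg a ≤ s.ireg b
  | .realLe a b, s => s.rreg a ≤ s.rreg b

/-- Programs, with structured control flow. -/
inductive Program where
  | instr (i : Instr)
  | seq (p q : Program)
  | ite (b : Test) (p q : Program)
  | while (b : Test) (p : Program)

/-- `Exec p s k s'`: started in `s`, the program `p` halts in `s'` after exactly `k` steps. -/
inductive Exec : Program → State → ℕ → State → Prop where
  | instr {i : Instr} {s s' : State} : i.run s = some s' → Exec (.instr i) s 1 s'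
  | seq {p q : Program} {s₁ s₂ s₃ : State} {k l : ℕ} :
      Exec p s₁ k s₂ → Exec q s₂ l s₃ → Exec (.seq p q) s₁ (k + l) s₃
  | iteTrue {b : Test} {p q : Program} {s s' : State} {k : ℕ} :
      b.Holds s → Exec p s k s' → Exec (.ite b p q) s (k + 1) s'
  | iteFalse {b : Test} {p q : Program} {s s' : State} {k : ℕ} :
      ¬ b.Holds s → Exec q s k s' → Exec (.ite b p q) s (k + 1) s'
  | whileTrue {b : Test} {p : Program} {s₁ s₂ s₃ : State} {k l : ℕ} :
      b.Holds s₁ → Exec p s₁ k s₂ → Exec (.while b p) s₂ l s₃ →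
        Exec (.while b p) s₁ (k + l + 1) s₃
  | whileFalse {b : Test} {p : Program} {s : State} :
      ¬ b.Holds s → Exec (.while b p) s 1 s

/-- The initial configuration on a list of `n` points: integer register `0` holds `n`, the real
memory cells `2 * i` and `2 * i + 1` hold the coordinates of the `i`-th point, and all other
registers and cells hold `0`. -/
def inputState {n : ℕ} (v : Fin n → ℝ × ℝ) : State where
  ireg a := if a = 0 then n else 0
  imem _ := 0
  rreg _ := 0
  rmem a :=
    if h : a / 2 < n then (if a % 2 = 0 then (v ⟨a / 2, h⟩).1 else (v ⟨a / 2, h⟩).2) else 0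

/-- The point whose coordinates are in the real memory cells `a` and `a + 1`. -/
def State.pointAt (s : State) (a : ℕ) : ℝ × ℝ :=
  (s.rmem a, s.rmem (a + 1))

/-- The configuration stores the finite set of points `H` as a list without repetitions: integer
register `0` holds its length, integer register `1` the address of its first point. -/
def State.StoresPoints (s : State) (H : Set (ℝ × ℝ)) : Prop :=
  H = {x | ∃ i < s.ireg 0, x = s.pointAt (s.ireg 1 + 2 * i)} ∧ H.encard = s.ireg 0

/-- The vertices of the `j`-th stored convex polygon. Integer register `3` holds the address of a
table of offsets in the integer memory, and integer register `4` the address in the real memory of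
a list of points; polygon `j` consists of the points of that list with numbers from the `j`-th
offset (included) up to the `(j + 1)`-st offset (excluded). -/
def State.piece (s : State) (j : ℕ) :
    Fin (s.imem (s.ireg 3 + j + 1) - s.imem (s.ireg 3 + j)) → ℝ × ℝ :=
  fun i => s.pointAt (s.ireg 4 + 2 * (s.imem (s.ireg 3 + j) + i))

/-- The configuration stores the finite set `C` of convex polygons as a list without repetitions,
each polygon by its vertices in boundary order; integer register `2` holds the length of the
list. -/
def State.StoresPolygons (s : State) (C : Set (Set (ℝ × ℝ))) : Prop :=
  (∀ j < s.ireg 2, IsConvexVertexList (s.piece j)) ∧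
    C = {Q | ∃ j < s.ireg 2, Q = convexHull ℝ (range (s.piece j))} ∧ C.encard = s.ireg 2

end RealRAM

end

/-! Duality: a convex piece contains at most one point of a hidden set, so a hidden set and a convex
cover of equal size prove each other optimal (`IsHiddenSet.encard_le`). The algorithm therefore has
to find one hidden point for each convex piece.

Shape of a funnel. Measure height from the base edge. Both chains rise strictly to the apex, and the
slopes of the edges against the height increase along the whole vertex sequence. Hence a point of
the polygon is characterized by nonnegative height and by being in front of at least one edge line
of each chain (`FunnelChart.region`, `IsFunnelLoop.region_eq`). The base and the lines of one edge
of each chain bound a triangle inside the region.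

Greedy matching. Start with the lowest edge of each chain. If the upper end of one current edge is
behind the line of the other, only the chain of that line advances; otherwise both advance. Both
chains finish at the same step, and the triangles of the current pairs cover the region
(`FunnelChart.Trace.cover`). Each step also yields a point on one of its two edges: on the advancing
chain if there is only one, else on the chain chosen by the next step. A point of an open edge sees
nothing behind the line of this edge (`FunnelChart.not_sees`). The later of two points is behind the
edge of the earlier one: on the same chain since the edges differ, on different chains since a step
in between advanced the earlier chain alone (`FunnelChart.Trace.A_neg_of_sa`).

From local to global. The angle hypotheses only speak of neighbourhoods of the vertices. A linear
functional is never maximal at a reflex vertex, so the reflex vertices lie in the open triangle of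
the three convex ones. The relevant component of the exterior inside that triangle is locally
convex, hence convex (`convex_of_locally_convex`, a Tietze-Nakajima argument). Its supporting lines
show that each chain is behind all its edge lines (`IsFunnelLoop.chain_nonpos`); monotone heights
and slopes follow.

Running time. A step of the matching takes constant time. The choice between two candidate points
depends on later steps, so it is left to a second, backward loop. Both loops have fewer than `n`
rounds. -/

/-! ## A small language for the real RAM -/

namespace RealRAM

/-- Real expressions over the memory: `ld a off` reads the cell whose address is the content of the
integer register `a` plus `off`, and `sel c e f` is `e` if `0 ≤ c` and `f` otherwise. -/
inductive RExp where
  | ld (a off : ℕ)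
  | const (q : ℚ)
  | add (e f : RExp)
  | sub (e f : RExp)
  | mul (e f : RExp)
  | div (e f : RExp)
  | sel (c e f : RExp)

namespace RExp

open Classical in
/-- The value of an expression. -/
noncomputable def eval (s : State) : RExp → ℝ
  | ld a off => s.rmem (s.ireg a + off)
  | const q => q
  | add e f => e.eval s + f.eval s
  | sub e f => e.eval s - f.eval s
  | mul e f => e.eval s * f.eval s
  | div e f => e.eval s / f.eval s
  | sel c e f => if 0 ≤ c.eval s then e.eval s else f.eval s

/-- No division by zero occurs in the evaluation. -/
def Defined (s : State) : RExp → Prop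
  | ld _ _ => True
  | const _ => True
  | add e f => e.Defined s ∧ f.Defined s
  | sub e f => e.Defined s ∧ f.Defined s
  | mul e f => e.Defined s ∧ f.Defined s
  | div e f => e.Defined s ∧ f.Defined s ∧ f.eval s ≠ 0
  | sel c e f => c.Defined s ∧ (0 ≤ c.eval s → e.Defined s) ∧ (c.eval s < 0 → f.Defined s)

/-- All registers are below `50`. -/
def wf : RExp → Bool
  | ld a _ => a < 50
  | const _ => true
  | add e f => e.wf && f.wf
  | sub e f => e.wf && f.wf
  | mul e f => e.wf && f.wf
  | div e f => e.wf && f.wf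
  | sel c e f => c.wf && e.wf && f.wf

/-- Code that evaluates an expression into the real register `d`, using only real registers from `d`
on and the integer register `50`. -/
def code : RExp → ℕ → Program
  | ld a off, d => .seq (.instr (.natConst 50 off))
      (.seq (.instr (.natAdd 50 a 50)) (.instr (.realLoad d 50)))
  | const q, d => .instr (.realConst d q)
  | add e f, d => .seq (e.code d) (.seq (f.code (d + 1)) (.instr (.realAdd d d (d + 1))))
  | sub e f, d => .seq (e.code d) (.seq (f.code (d + 1)) (.instr (.realSub d d (d + 1))))
  | mul e f, d => .seq (e.code d) (.seq (f.code (d + 1)) (.instr (.realMul d d (d + 1))))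
  | div e f, d => .seq (e.code d) (.seq (f.code (d + 1)) (.instr (.realDiv d d (d + 1))))
  | sel c e f, d => .seq (.instr (.realConst d 0))
      (.seq (c.code (d + 1)) (.ite (.realLe d (d + 1)) (e.code d) (f.code d)))

/-- A bound for the number of steps of the code. -/
def cost : RExp → ℕ
  | ld _ _ => 3
  | const _ => 1
  | add e f => e.cost + f.cost + 1
  | sub e f => e.cost + f.cost + 1
  | mul e f => e.cost + f.cost + 1
  | div e f => e.cost + f.cost + 1
  | sel c e f => c.cost + e.cost + f.cost + 2

end RExp

/-! ### Correctness of code up to scratch registers -/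

/-- Two configurations agree up to scratch registers. -/
structure Sim (σ s : State) : Prop where
  ireg : ∀ a < 50, σ.ireg a = s.ireg a
  imem : σ.imem = s.imem
  rmem : σ.rmem = s.rmem

/-- The program takes every configuration like `s` in at most `K` steps to a configuration like
`s'`. -/
def Runs (p : Program) (s : State) (K : ℕ) (s' : State) : Prop :=
  ∀ σ, Sim σ s → ∃ k ≤ K, ∃ σ', Exec p σ k σ' ∧ Sim σ' s'

theorem Runs.seq {p q : Program} {s₁ s₂ s₃ : State} {K L : ℕ} (h₁ : Runs p s₁ K s₂)
    (h₂ : Runs q s₂ L s₃) : Runs (.seq p q) s₁ (K + L) s₃ := by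
  intro σ hσ
  obtain ⟨k, hk, σ', he, hσ'⟩ := h₁ σ hσ
  obtain ⟨l, hl, σ'', he', hσ''⟩ := h₂ σ' hσ'
  exact ⟨k + l, by omega, σ'', .seq he he', hσ''⟩

/-- The code evaluates `v` into register `d`, leaving lower registers alone. -/
def Evaluates (p : Program) (s : State) (K d : ℕ) (v : ℝ) : Prop :=
  ∀ σ, Sim σ s → ∃ k ≤ K, ∃ σ', Exec p σ k σ' ∧ Sim σ' s ∧ σ'.rreg d = v ∧
    ∀ x < d, σ'.rreg x = σ.rreg x

/-- The frame condition on lower registers keeps the first operand in register `d` while the second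
one is computed into `d + 1`. -/
theorem Evaluates.binary {p q : Program} {s : State} {K L d : ℕ} {u v r : ℝ}
    (hp : Evaluates p s K d u) (hq : Evaluates q s L (d + 1) v) {i : Instr}
    (hi : ∀ σ : State, σ.rreg d = u → σ.rreg (d + 1) = v →
      i.run σ = some { σ with rreg := Function.update σ.rreg d r }) :
    Evaluates (.seq p (.seq q (.instr i))) s (K + L + 1) d r := by
  intro σ hσ
  obtain ⟨k, hk, σ₁, e₁, s₁, v₁, f₁⟩ := hp σ hσ
  obtain ⟨l, hl, σ₂, e₂, s₂, v₂, f₂⟩ := hq σ₁ s₁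
  refine ⟨k + (l + 1), by omega, _,
    .seq e₁ (.seq e₂ (.instr (hi σ₂ (by rw [f₂ d (Nat.lt_succ_self d), v₁]) v₂))),
    ⟨s₂.ireg, s₂.imem, s₂.rmem⟩, by simp, fun x hx => ?_⟩
  simp only [Function.update_of_ne hx.ne]
  rw [f₂ x (by omega), f₁ x hx]

theorem RExp.evaluates (e : RExp) {s : State} (hw : e.wf = true) (hd : e.Defined s) (d : ℕ) :
    Evaluates (e.code d) s e.cost d (e.eval s) := by
  induction e generalizing d with
  | ld a off =>
    intro σ hσ
    have ha : a < 50 := by simpa [wf] using hw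
    refine ⟨1 + (1 + 1), le_rfl, _, .seq (.instr rfl) (.seq (.instr rfl) (.instr rfl)),
      ⟨fun b hb => ?_, hσ.imem, hσ.rmem⟩, ?_, fun x hx => ?_⟩
    · simp only [Function.update_of_ne hb.ne]
      exact hσ.ireg b hb
    · simp [eval, Function.update_of_ne ha.ne, hσ.ireg a ha, hσ.rmem]
    · simp [Function.update_of_ne hx.ne]
  | const q =>
    intro σ hσ
    exact ⟨1, le_rfl, _, .instr rfl, ⟨hσ.ireg, hσ.imem, hσ.rmem⟩, by simp [eval],
      fun x hx => by simp [Function.update_of_ne hx.ne]⟩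
  | add e f he hf =>
    simp only [wf, Bool.and_eq_true] at hw
    exact (he hw.1 hd.1 d).binary (hf hw.2 hd.2 _) fun σ h1 h2 => by
      simp only [Instr.run, h1, h2, eval]
  | sub e f he hf =>
    simp only [wf, Bool.and_eq_true] at hw
    exact (he hw.1 hd.1 d).binary (hf hw.2 hd.2 _) fun σ h1 h2 => by
      simp only [Instr.run, h1, h2, eval]
  | mul e f he hf =>
    simp only [wf, Bool.and_eq_true] at hw
    exact (he hw.1 hd.1 d).binary (hf hw.2 hd.2 _) fun σ h1 h2 => by
      simp only [Instr.run, h1, h2, eval]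
  | div e f he hf =>
    simp only [wf, Bool.and_eq_true] at hw
    exact (he hw.1 hd.1 d).binary (hf hw.2 hd.2.1 _) fun σ h1 h2 => by
      simp only [Instr.run, h1, h2, eval, if_neg hd.2.2]
  | sel c e f hc he hf =>
    simp only [wf, Bool.and_eq_true] at hw
    intro σ hσ
    -- Register `d` serves as the constant `0` of the comparison and is then overwritten by the
    -- chosen branch.
    obtain ⟨k, hk, σ₁, e₁, s₁, v₁, f₁⟩ := hc hw.1.1 hd.1 (d + 1)
      { σ with rreg := Function.update σ.rreg d ((0 : ℚ) : ℝ) } ⟨hσ.ireg, hσ.imem, hσ.rmem⟩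
    have h0 : σ₁.rreg d = 0 := by rw [f₁ d (Nat.lt_succ_self d)]; simp
    have hrest : ∀ x < d, σ₁.rreg x = σ.rreg x := fun x hx => by
      rw [f₁ x (by omega)]; simp [Function.update_of_ne hx.ne]
    by_cases h : 0 ≤ c.eval s
    · obtain ⟨l, hl, σ₂, e₂, s₂, v₂, f₂⟩ := he hw.1.2 (hd.2.1 h) d σ₁ s₁
      refine ⟨1 + (k + (l + 1)), by simp only [cost]; omega, σ₂,
        .seq (.instr rfl) (.seq e₁ (.iteTrue ?_ e₂)), s₂, by rw [v₂]; simp [eval, h],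
        fun x hx => by rw [f₂ x hx, hrest x hx]⟩
      change σ₁.rreg d ≤ σ₁.rreg (d + 1)
      rwa [h0, v₁]
    · obtain ⟨l, hl, σ₂, e₂, s₂, v₂, f₂⟩ := hf hw.2 (hd.2.2 (not_le.1 h)) d σ₁ s₁
      refine ⟨1 + (k + (l + 1)), by simp only [cost]; omega, σ₂,
        .seq (.instr rfl) (.seq e₁ (.iteFalse ?_ e₂)), s₂, by rw [v₂]; simp [eval, h],
        fun x hx => by rw [f₂ x hx, hrest x hx]⟩
      change ¬ σ₁.rreg d ≤ σ₁.rreg (d + 1)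
      rwa [h0, v₁]

/-! ### Writing blocks of computed values -/

/-- Evaluation of a list of expressions into consecutive real registers. -/
def evalList : List RExp → ℕ → Program
  | [], d => .instr (.realConst d 0)
  | e :: es, d => .seq (e.code d) (evalList es (d + 1))

/-- The cost of `evalList`. -/
def evalListCost : List RExp → ℕ
  | [] => 1
  | e :: es => e.cost + evalListCost es

theorem evalList_spec (es : List RExp) {s : State} (hw : es.all RExp.wf = true)
    (hd : ∀ e ∈ es, e.Defined s) (d : ℕ) : ∀ σ, Sim σ s → ∃ k ≤ evalListCost es, ∃ σ',
      Exec (evalList es d) σ k σ' ∧ Sim σ' s ∧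
      (∀ x (hx : x < es.length), σ'.rreg (d + x) = es[x].eval s) ∧
      ∀ x < d, σ'.rreg x = σ.rreg x := by
  induction es generalizing d with
  | nil =>
    intro σ hσ
    exact ⟨1, le_rfl, _, .instr rfl, ⟨hσ.ireg, hσ.imem, hσ.rmem⟩,
      fun x hx => absurd hx (Nat.not_lt_zero x), fun x hx => by simp [Function.update_of_ne hx.ne]⟩
  | cons e es ih =>
    intro σ hσ
    simp only [List.all_cons, Bool.and_eq_true] at hw
    obtain ⟨k, hk, σ₁, e₁, s₁, v₁, f₁⟩ := e.evaluates hw.1 (hd e (by simp)) d σ hσ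
    obtain ⟨l, hl, σ₂, e₂, s₂, v₂, f₂⟩ :=
      ih hw.2 (fun f hf => hd f (by simp [hf])) (d + 1) σ₁ s₁
    refine ⟨k + l, by simp only [evalListCost]; omega, σ₂, .seq e₁ e₂, s₂, fun x hx => ?_,
      fun x hx => by rw [f₂ x (by omega), f₁ x hx]⟩
    rcases x with _ | x
    · rw [Nat.add_zero, f₂ d (Nat.lt_succ_self d), v₁]; rfl
    · rw [show d + (x + 1) = d + 1 + x by omega, v₂ x (by simpa using hx)]; rfl

/-- Storing the first `m` real registers at the address in the integer register `a`. -/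
def storeAll (a : ℕ) : ℕ → Program
  | 0 => .instr (.realConst 0 0)
  | m + 1 => .seq (.seq (.instr (.natConst 50 m))
      (.seq (.instr (.natAdd 50 a 50)) (.instr (.realStore 50 m)))) (storeAll a m)

/-- Memory with a block of values written at address `b`. -/
noncomputable def writeBlock (M : ℕ → ℝ) (b m : ℕ) (val : ℕ → ℝ) (x : ℕ) : ℝ :=
  if b ≤ x ∧ x < b + m then val (x - b) else M x

/-- The cells are written from the top down, so the induction hypothesis is applied with offset `m`
already filled. The dummy instruction at the end overwrites register `0` only after all stores. -/
theorem storeAll_spec {a : ℕ} (ha : a < 50) (m : ℕ) (σ : State) :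
    ∃ k ≤ 3 * m + 1, ∃ σ', Exec (storeAll a m) σ k σ' ∧ (∀ x < 50, σ'.ireg x = σ.ireg x) ∧
      σ'.imem = σ.imem ∧ σ'.rmem = writeBlock σ.rmem (σ.ireg a) m σ.rreg := by
  induction m generalizing σ with
  | zero =>
    refine ⟨1, by omega, _, .instr rfl, fun _ _ => rfl, rfl, ?_⟩
    funext x
    simp only [writeBlock, Nat.add_zero]
    rw [if_neg (by omega)]
  | succ m ih =>
    obtain ⟨k, hk, σ', he, h1, h2, h3⟩ := ih { σ with
      ireg := Function.update (Function.update σ.ireg 50 m) 50 (σ.ireg a + m)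
      rmem := Function.update σ.rmem (σ.ireg a + m) (σ.rreg m) }
    refine ⟨1 + (1 + 1) + k, by omega, σ', .seq (.seq (.instr rfl)
      (.seq (.instr rfl) (.instr (s' := _) ?_))) he, fun x hx => ?_, h2, ?_⟩
    · simp [Instr.run, Function.update_of_ne ha.ne]
    · rw [h1 x hx]
      simp [Function.update_of_ne hx.ne]
    · rw [h3]
      funext x
      simp only [writeBlock, Function.update_of_ne ha.ne, Function.update_apply]
      by_cases hx : x = σ.ireg a + m
      · subst hx
        rw [if_neg (by omega), if_pos rfl, if_pos (by omega), Nat.add_sub_cancel_left]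
      · rw [if_neg hx]
        by_cases hx' : σ.ireg a ≤ x ∧ x < σ.ireg a + m
        · rw [if_pos hx', if_pos (by omega)]
        · rw [if_neg hx', if_neg (by omega)]

/-! ### Commands and loops -/

/-- Loop-free commands. -/
inductive Cmd where
  | set (a k : ℕ)
  | inc (a k : ℕ)
  | dec (a k : ℕ)
  | sum (a b c : ℕ)
  | load (a b : ℕ)
  | put (a b : ℕ)
  | store (a : ℕ) (es : List RExp)
  | iteNonneg (e : RExp) (c d : Cmd)
  | iteLe (a b : ℕ) (c d : Cmd)
  | seq (c d : Cmd)

namespace Cmd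

open Classical in
/-- The effect of a command. -/
noncomputable def eval : Cmd → State → State
  | set a k, s => { s with ireg := Function.update s.ireg a k }
  | inc a k, s => { s with ireg := Function.update s.ireg a (s.ireg a + k) }
  | dec a k, s => { s with ireg := Function.update s.ireg a (s.ireg a - k) }
  | sum a b c, s => { s with ireg := Function.update s.ireg a (s.ireg b + s.ireg c) }
  | load a b, s => { s with ireg := Function.update s.ireg a (s.imem (s.ireg b)) }
  | put a b, s => { s with imem := Function.update s.imem (s.ireg a) (s.ireg b) }
  | store a es, s => { s with
      rmem := writeBlock s.rmem (s.ireg a) es.length fun x => (es.map (RExp.eval s)).getD x 0 }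
  | iteNonneg e c d, s => if 0 ≤ e.eval s then c.eval s else d.eval s
  | iteLe a b c d, s => if s.ireg a ≤ s.ireg b then c.eval s else d.eval s
  | seq c d, s => d.eval (c.eval s)

/-- No division by zero occurs. -/
def Defined : Cmd → State → Prop
  | store _ es, s => ∀ e ∈ es, e.Defined s
  | iteNonneg e c d, s => e.Defined s ∧ (0 ≤ e.eval s → c.Defined s) ∧
      (e.eval s < 0 → d.Defined s)
  | iteLe a b c d, s => (s.ireg a ≤ s.ireg b → c.Defined s) ∧
      (¬ s.ireg a ≤ s.ireg b → d.Defined s)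
  | seq c d, s => c.Defined s ∧ d.Defined (c.eval s)
  | _, _ => True

/-- All registers are below `50`. -/
def wf : Cmd → Bool
  | set a _ => a < 50
  | inc a _ => a < 50
  | dec a _ => a < 50
  | sum a b c => a < 50 && b < 50 && c < 50
  | load a b => a < 50 && b < 50
  | put a b => a < 50 && b < 50
  | store a es => a < 50 && es.all RExp.wf
  | iteNonneg e c d => e.wf && c.wf && d.wf
  | iteLe a b c d => a < 50 && b < 50 && c.wf && d.wf
  | seq c d => c.wf && d.wf

/-- The program of a command. -/
def code : Cmd → Program
  | set a k => .instr (.natConst a k)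
  | inc a k => .seq (.instr (.natConst 50 k)) (.instr (.natAdd a a 50))
  | dec a k => .seq (.instr (.natConst 50 k)) (.instr (.natSub a a 50))
  | sum a b c => .instr (.natAdd a b c)
  | load a b => .instr (.natLoad a b)
  | put a b => .instr (.natStore a b)
  | store a es => .seq (evalList es 0) (storeAll a es.length)
  | iteNonneg e c d => .seq (.instr (.realConst 0 0))
      (.seq (e.code 1) (.ite (.realLe 0 1) c.code d.code))
  | iteLe a b c d => .ite (.natLe a b) c.code d.code
  | seq c d => .seq c.code d.code

/-- A bound for the number of steps of a command. -/
def cost : Cmd → ℕ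
  | store _ es => evalListCost es + (3 * es.length + 1)
  | iteNonneg e c d => e.cost + c.cost + d.cost + 2
  | iteLe _ _ c d => c.cost + d.cost + 1
  | seq c d => c.cost + d.cost
  | _ => 2

theorem sim_update {σ s : State} (h : Sim σ s) {a v v' : ℕ} (hv : v = v') {f : ℕ → ℕ}
    (hf : ∀ x < 50, f x = σ.ireg x) :
    Sim { σ with ireg := Function.update f a v } { s with ireg := Function.update s.ireg a v' } where
  ireg x hx := by
    simp only [Function.update_apply]
    split
    · exact hv
    · rw [hf x hx, h.ireg x hx]
  imem := h.imem
  rmem := h.rmem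

theorem runs (c : Cmd) {s : State} (hw : c.wf = true) (hd : c.Defined s) :
    Runs c.code s c.cost (c.eval s) := by
  induction c generalizing s with
  | set a k =>
    intro σ hσ
    exact ⟨1, by simp [cost], _, .instr rfl, sim_update hσ rfl fun _ _ => rfl⟩
  | inc a k =>
    intro σ hσ
    have ha : a < 50 := by simpa [wf] using hw
    exact ⟨1 + 1, by simp [cost], _, .seq (.instr rfl) (.instr rfl),
      sim_update hσ (by simp [Function.update_of_ne ha.ne, hσ.ireg a ha])
        fun x hx => by simp [Function.update_of_ne hx.ne]⟩
  | dec a k =>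
    intro σ hσ
    have ha : a < 50 := by simpa [wf] using hw
    exact ⟨1 + 1, by simp [cost], _, .seq (.instr rfl) (.instr rfl),
      sim_update hσ (by simp [Function.update_of_ne ha.ne, hσ.ireg a ha])
        fun x hx => by simp [Function.update_of_ne hx.ne]⟩
  | sum a b c =>
    intro σ hσ
    simp only [wf, Bool.and_eq_true, decide_eq_true_eq] at hw
    exact ⟨1, by simp [cost], _, .instr rfl,
      sim_update hσ (by rw [hσ.ireg b hw.1.2, hσ.ireg c hw.2]) fun _ _ => rfl⟩
  | load a b =>
    intro σ hσ
    simp only [wf, Bool.and_eq_true, decide_eq_true_eq] at hw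
    exact ⟨1, by simp [cost], _, .instr rfl,
      sim_update hσ (by rw [hσ.ireg b hw.2, hσ.imem]) fun _ _ => rfl⟩
  | put a b =>
    intro σ hσ
    simp only [wf, Bool.and_eq_true, decide_eq_true_eq] at hw
    exact ⟨1, by simp [cost], _, .instr rfl, ⟨hσ.ireg,
      by simp only [eval]; rw [hσ.ireg a hw.1, hσ.ireg b hw.2, hσ.imem], hσ.rmem⟩⟩
  | store a es =>
    intro σ hσ
    simp only [wf, Bool.and_eq_true, decide_eq_true_eq] at hw
    obtain ⟨k, hk, σ₁, e₁, s₁, v₁, -⟩ := evalList_spec es hw.2 hd 0 σ hσ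
    obtain ⟨l, hl, σ₂, e₂, i₂, m₂, r₂⟩ := storeAll_spec hw.1 es.length σ₁
    refine ⟨k + l, by simp only [cost]; omega, σ₂, .seq e₁ e₂,
      fun x hx => (i₂ x hx).trans (s₁.ireg x hx), m₂.trans s₁.imem, ?_⟩
    rw [r₂, s₁.ireg a hw.1, s₁.rmem]
    funext x
    simp only [eval, writeBlock]
    split_ifs with h
    · have := v₁ (x - s.ireg a) (by omega)
      rw [Nat.zero_add] at this
      rw [this, List.getD_eq_getElem _ _ (by simp; omega), List.getElem_map]
    · rfl
  | iteNonneg e c d hc hd' =>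
    intro σ hσ
    simp only [wf, Bool.and_eq_true] at hw
    obtain ⟨k, hk, σ₁, e₁, s₁, v₁, f₁⟩ := e.evaluates hw.1.1 hd.1 1
      { σ with rreg := Function.update σ.rreg 0 ((0 : ℚ) : ℝ) } ⟨hσ.ireg, hσ.imem, hσ.rmem⟩
    have h0 : σ₁.rreg 0 = 0 := by rw [f₁ 0 one_pos]; simp
    by_cases h : 0 ≤ e.eval s
    · obtain ⟨l, hl, σ₂, e₂, s₂⟩ := hc hw.1.2 (hd.2.1 h) σ₁ s₁
      refine ⟨1 + (k + (l + 1)), by simp only [cost]; omega, σ₂,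
        .seq (.instr rfl) (.seq e₁ (.iteTrue ?_ e₂)), by simpa [eval, h] using s₂⟩
      change σ₁.rreg 0 ≤ σ₁.rreg 1
      rwa [h0, v₁]
    · obtain ⟨l, hl, σ₂, e₂, s₂⟩ := hd' hw.2 (hd.2.2 (not_le.1 h)) σ₁ s₁
      refine ⟨1 + (k + (l + 1)), by simp only [cost]; omega, σ₂,
        .seq (.instr rfl) (.seq e₁ (.iteFalse ?_ e₂)), by simpa [eval, h] using s₂⟩
      change ¬ σ₁.rreg 0 ≤ σ₁.rreg 1
      rwa [h0, v₁]
  | iteLe a b c d hc hd' =>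
    intro σ hσ
    simp only [wf, Bool.and_eq_true, decide_eq_true_eq] at hw
    have ha := hσ.ireg a hw.1.1.1
    have hb := hσ.ireg b hw.1.1.2
    by_cases h : s.ireg a ≤ s.ireg b
    · obtain ⟨l, hl, σ₂, e₂, s₂⟩ := hc hw.1.2 (hd.1 h) σ hσ
      refine ⟨l + 1, by simp only [cost]; omega, σ₂, .iteTrue ?_ e₂, by simpa [eval, h] using s₂⟩
      change σ.ireg a ≤ σ.ireg b
      rwa [ha, hb]
    · obtain ⟨l, hl, σ₂, e₂, s₂⟩ := hd' hw.2 (hd.2 h) σ hσ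
      refine ⟨l + 1, by simp only [cost]; omega, σ₂, .iteFalse ?_ e₂, by simpa [eval, h] using s₂⟩
      change ¬ σ.ireg a ≤ σ.ireg b
      rwa [ha, hb]
  | seq c d hc hd' =>
    simp only [wf, Bool.and_eq_true] at hw
    exact (hc hw.1 hd.1).seq (hd' hw.2 hd.2)

/-- A loop whose guard holds for exactly `N` rounds. -/
theorem runs_while {a b : ℕ} (ha : a < 50) (hb : b < 50) {c : Cmd} (hw : c.wf = true) (N : ℕ)
    {s : State} (hd : ∀ k < N, (c.eval^[k] s).ireg a ≤ (c.eval^[k] s).ireg b ∧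
      c.Defined (c.eval^[k] s))
    (hN : ¬ (c.eval^[N] s).ireg a ≤ (c.eval^[N] s).ireg b) :
    Runs (.while (.natLe a b) c.code) s (N * (c.cost + 1) + 1) (c.eval^[N] s) := by
  induction N generalizing s with
  | zero =>
    intro σ hσ
    refine ⟨1, by omega, σ, .whileFalse ?_, hσ⟩
    change ¬ σ.ireg a ≤ σ.ireg b
    rwa [hσ.ireg a ha, hσ.ireg b hb]
  | succ N ih =>
    intro σ hσ
    obtain ⟨h1, h2⟩ := hd 0 (Nat.succ_pos N)
    obtain ⟨k, hk, σ₁, e₁, s₁⟩ := c.runs hw h2 σ hσ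
    obtain ⟨l, hl, σ₂, e₂, s₂⟩ := ih (s := c.eval s) (fun k hk => hd (k + 1) (by omega)) hN σ₁ s₁
    refine ⟨k + l + 1, by rw [Nat.succ_mul]; omega, σ₂, .whileTrue ?_ e₁ e₂, s₂⟩
    change σ.ireg a ≤ σ.ireg b
    rw [hσ.ireg a ha, hσ.ireg b hb]
    exact h1

end Cmd

end RealRAM

/-! ## Funnels in coordinates -/

/-- Two chains `a 0, …, a p` and `b 0, …, b q` in coordinates `(x, y)`, with `x' = -x`. Both start
at height `0` and rise to a common apex. The region lies between the graph of the maximum of the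
affine functions `c i + m i * y` and that of the minimum of the functions `-(c' j + m' j * y)`. -/
structure FunnelChart where
  (p q : ℕ)
  (a b : ℕ → ℝ × ℝ)
  (x x' y : ℝ × ℝ → ℝ)
  (c m c' m' : ℕ → ℝ)
  p_pos : 0 < p
  q_pos : 0 < q
  x_add : ∀ z, x z + x' z = 0
  x_line : ∀ u v s, x (AffineMap.lineMap u v s) = (1 - s) * x u + s * x v
  y_line : ∀ u v s, y (AffineMap.lineMap u v s) = (1 - s) * y u + s * y v
  m_lt : ∀ i, i + 1 < p → m i < m (i + 1)
  m'_lt : ∀ j, j + 1 < q → m' j < m' (j + 1)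
  m_add : ∀ i j, i < p → j < q → m i + m' j < 0
  y_a_succ : ∀ i < p, y (a i) < y (a (i + 1))
  y_b_succ : ∀ j < q, y (b j) < y (b (j + 1))
  y_a_zero : y (a 0) = 0
  y_b_zero : y (b 0) = 0
  apex : a p = b q
  a_left : ∀ i < p, x (a i) = c i + m i * y (a i)
  a_right : ∀ i < p, x (a (i + 1)) = c i + m i * y (a (i + 1))
  b_left : ∀ j < q, x' (b j) = c' j + m' j * y (b j)
  b_right : ∀ j < q, x' (b (j + 1)) = c' j + m' j * y (b (j + 1))

namespace FunnelChart

/-- The chart with the two chains exchanged. -/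
def symm (C : FunnelChart) : FunnelChart where
  p := C.q
  q := C.p
  a := C.b
  b := C.a
  x := C.x'
  x' := C.x
  y := C.y
  c := C.c'
  m := C.m'
  c' := C.c
  m' := C.m
  p_pos := C.q_pos
  q_pos := C.p_pos
  x_add z := by rw [add_comm]; exact C.x_add z
  x_line u v s := by
    have h1 := C.x_add (AffineMap.lineMap u v s)
    have h2 := C.x_add u
    have h3 := C.x_add v
    have h4 := C.x_line u v s
    linear_combination h1 - h4 - (1 - s) * h2 - s * h3
  y_line := C.y_line
  m_lt := C.m'_lt
  m'_lt := C.m_lt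
  m_add i j hi hj := by rw [add_comm]; exact C.m_add j i hj hi
  y_a_succ := C.y_b_succ
  y_b_succ := C.y_a_succ
  y_a_zero := C.y_b_zero
  y_b_zero := C.y_a_zero
  apex := C.apex.symm
  a_left := C.b_left
  a_right := C.b_right
  b_left := C.a_left
  b_right := C.a_right

/-- Nonnegative on the inner side of the line through the `i`-th edge of the first chain. -/
def A (C : FunnelChart) (i : ℕ) (z : ℝ × ℝ) : ℝ := C.c i + C.m i * C.y z - C.x z

/-- Nonnegative on the inner side of the line through the `j`-th edge of the second chain. -/
def B (C : FunnelChart) (j : ℕ) (z : ℝ × ℝ) : ℝ := C.c' j + C.m' j * C.y z - C.x' z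

variable (C : FunnelChart)

/-- The region between the two chains. -/
def region : Set (ℝ × ℝ) :=
  {z | 0 ≤ C.y z ∧ (∃ i < C.p, 0 ≤ C.A i z) ∧ ∃ j < C.q, 0 ≤ C.B j z}

theorem symm_region : C.symm.region = C.region := by
  ext z
  exact and_congr_right fun _ => and_comm

variable {C}

theorem A_line (i : ℕ) (u v : ℝ × ℝ) (s : ℝ) :
    C.A i (AffineMap.lineMap u v s) = (1 - s) * C.A i u + s * C.A i v := by
  simp only [A, C.x_line, C.y_line]; ring

theorem A_left {i : ℕ} (hi : i < C.p) : C.A i (C.a i) = 0 := by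
  simp [A, C.a_left i hi]

theorem A_right {i : ℕ} (hi : i < C.p) : C.A i (C.a (i + 1)) = 0 := by
  simp [A, C.a_right i hi]

theorem B_left {j : ℕ} (hj : j < C.q) : C.B j (C.b j) = 0 := C.symm.A_left hj

theorem B_right {j : ℕ} (hj : j < C.q) : C.B j (C.b (j + 1)) = 0 := C.symm.A_right hj

theorem y_a_lt {i k : ℕ} (hik : i < k) (hk : k ≤ C.p) : C.y (C.a i) < C.y (C.a k) := by
  induction k, hik using Nat.le_induction with
  | base => exact C.y_a_succ i (by omega)
  | succ k hk' ih => exact (ih (by omega)).trans (C.y_a_succ k (by omega))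

theorem y_a_le {i k : ℕ} (hik : i ≤ k) (hk : k ≤ C.p) : C.y (C.a i) ≤ C.y (C.a k) := by
  rcases hik.eq_or_lt with rfl | h
  · exact le_rfl
  · exact (y_a_lt h hk).le

theorem y_a_nonneg {i : ℕ} (hi : i ≤ C.p) : 0 ≤ C.y (C.a i) :=
  C.y_a_zero ▸ y_a_le (Nat.zero_le i) hi

/-- Both edge functions vanish at the common vertex of the two edges. As slopes increase, the later
function is the larger one above this vertex and the smaller one below it; the next four lemmas
chain this comparison. -/
theorem A_succ_sub {i : ℕ} (hi : i + 1 < C.p) (z : ℝ × ℝ) :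
    C.A (i + 1) z - C.A i z = (C.m (i + 1) - C.m i) * (C.y z - C.y (C.a (i + 1))) := by
  have h1 := C.a_right i (by omega)
  have h2 := C.a_left (i + 1) hi
  simp only [A]
  linear_combination h1 - h2

theorem A_mono {i k : ℕ} (hik : i ≤ k) (hk : k < C.p) {z : ℝ × ℝ} (hz : C.y (C.a k) ≤ C.y z) :
    C.A i z ≤ C.A k z := by
  induction k, hik using Nat.le_induction with
  | base => exact le_rfl
  | succ k hk' ih =>
    have h1 := ih (by omega) ((C.y_a_succ k (by omega)).le.trans hz)
    have h2 := A_succ_sub hk z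
    have h3 := C.m_lt k hk
    nlinarith

theorem A_anti {i k : ℕ} (hik : i ≤ k) (hk : k < C.p) {z : ℝ × ℝ}
    (hz : C.y z ≤ C.y (C.a (i + 1))) : C.A k z ≤ C.A i z := by
  induction k, hik using Nat.le_induction with
  | base => exact le_rfl
  | succ k hk' ih =>
    have h1 := ih (by omega)
    have h2 := A_succ_sub hk z
    have h3 := C.m_lt k hk
    have h4 : C.y (C.a (i + 1)) ≤ C.y (C.a (k + 1)) := y_a_le (by omega) (by omega)
    nlinarith

theorem A_strictMono {i k : ℕ} (hik : i < k) (hk : k < C.p) {z : ℝ × ℝ}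
    (hz : C.y (C.a k) < C.y z) : C.A i z < C.A k z := by
  have h1 : C.A (i + 1) z ≤ C.A k z := A_mono hik hk hz.le
  have h2 := A_succ_sub (C := C) (i := i) (by omega) z
  have h3 := C.m_lt i (by omega)
  have h4 : C.y (C.a (i + 1)) ≤ C.y (C.a k) := y_a_le hik (by omega)
  nlinarith

theorem A_strictAnti {i k : ℕ} (hik : i < k) (hk : k < C.p) {z : ℝ × ℝ}
    (hz : C.y z < C.y (C.a (i + 1))) : C.A k z < C.A i z := by
  have h2 := A_succ_sub (C := C) (i := i) (by omega) z
  have h3 := C.m_lt i (by omega)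
  have h4 : C.A k z ≤ C.A (i + 1) z :=
    A_anti hik hk (hz.le.trans (C.y_a_succ (i + 1) (by omega)).le)
  nlinarith

/-- In a sum over both chains the coordinates `x` and `x'` cancel, leaving an affine function of the
height alone, with negative slope by `m_add`. Comparisons between the chains rest on this. -/
theorem add_sub_add {i j : ℕ} (z w : ℝ × ℝ) :
    (C.A i z + C.B j z) - (C.A i w + C.B j w) = (C.m i + C.m' j) * (C.y z - C.y w) := by
  have h1 := C.x_add z
  have h2 := C.x_add w
  simp only [A, B]
  linear_combination h2 - h1

theorem add_anti {i j : ℕ} (hi : i < C.p) (hj : j < C.q) {z w : ℝ × ℝ} (h : C.y z ≤ C.y w) :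
    C.A i w + C.B j w ≤ C.A i z + C.B j z := by
  have h1 := add_sub_add (C := C) (i := i) (j := j) z w
  have h2 := C.m_add i j hi hj
  nlinarith

theorem add_strictAnti {i j : ℕ} (hi : i < C.p) (hj : j < C.q) {z w : ℝ × ℝ}
    (h : C.y z < C.y w) : C.A i w + C.B j w < C.A i z + C.B j z := by
  have h1 := add_sub_add (C := C) (i := i) (j := j) z w
  have h2 := C.m_add i j hi hj
  nlinarith

/-- At `a k` the function of an edge that ends there is zero, and by the crossing pattern it
dominates the function of `i`. -/
theorem A_vertex_nonpos {i k : ℕ} (hi : i < C.p) (hk : k ≤ C.p) : C.A i (C.a k) ≤ 0 := by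
  rcases lt_or_ge i k with h | h
  · obtain ⟨k, rfl⟩ : ∃ l, k = l + 1 := ⟨k - 1, by omega⟩
    rw [← A_right (C := C) (i := k) (by omega)]
    exact A_mono (by omega) (by omega) (C.y_a_succ k (by omega)).le
  · rcases h.eq_or_lt with rfl | h
    · exact (A_left hi).le
    · rw [← A_left (C := C) (i := k) (by omega)]
      exact A_anti h.le hi (C.y_a_succ k (by omega)).le

theorem A_apex_neg {i : ℕ} (hi : i + 1 < C.p) : C.A i (C.a C.p) < 0 := by
  have h1 : C.A (C.p - 1) (C.a C.p) = 0 := by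
    have := A_right (C := C) (i := C.p - 1) (by omega)
    rwa [Nat.sub_add_cancel C.p_pos] at this
  rw [← h1]
  exact A_strictMono (by omega) (by omega) (y_a_lt (by omega) le_rfl)

/-! ### Points on open edges and what they cannot see -/

/-- Points of the open `i`-th edge of the first chain. -/
structure OnA (C : FunnelChart) (i : ℕ) (u : ℝ × ℝ) : Prop where
  lt : i < C.p
  zero : C.A i u = 0
  left : C.y (C.a i) < C.y u
  right : C.y u < C.y (C.a (i + 1))

/-- Points of the open `j`-th edge of the second chain. -/
abbrev OnB (C : FunnelChart) (j : ℕ) (w : ℝ × ℝ) : Prop := C.symm.OnA j w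

theorem onA_lineMap {i : ℕ} (hi : i < C.p) {s : ℝ} (h0 : 0 < s) (h1 : s < 1) :
    C.OnA i (AffineMap.lineMap (C.a i) (C.a (i + 1)) s) := by
  have := C.y_a_succ i hi
  refine ⟨hi, by rw [A_line, A_left hi, A_right hi]; ring, ?_, ?_⟩ <;> rw [C.y_line] <;> nlinarith

theorem OnA.neg {i k : ℕ} {u : ℝ × ℝ} (h : C.OnA i u) (hk : k < C.p) (hki : k ≠ i) :
    C.A k u < 0 := by
  rw [← h.zero]
  rcases hki.lt_or_gt with hl | hl
  · exact A_strictMono hl h.lt h.left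
  · exact A_strictAnti hl hk h.right

theorem OnA.nonpos {i k : ℕ} {u : ℝ × ℝ} (h : C.OnA i u) (hk : k < C.p) : C.A k u ≤ 0 := by
  rcases eq_or_ne k i with rfl | hki
  · exact h.zero.le
  · exact (h.neg hk hki).le

/-- Below the apex, everything behind the second chain is in front of the last edge of the
first one. -/
theorem A_last_nonneg {z : ℝ × ℝ} (hy : C.y z ≤ C.y (C.a C.p)) (hz : C.B (C.q - 1) z ≤ 0) :
    0 ≤ C.A (C.p - 1) z := by
  have hp := C.p_pos
  have hq := C.q_pos
  have h1 := add_anti (C := C) (i := C.p - 1) (j := C.q - 1) (by omega) (by omega) hy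
  have h2 := A_right (C := C) (i := C.p - 1) (by omega)
  have h3 := B_right (C := C) (j := C.q - 1) (by omega)
  rw [Nat.sub_add_cancel hp] at h2
  rw [Nat.sub_add_cancel hq, ← C.apex] at h3
  linarith

theorem A_last_vertex_nonneg {j : ℕ} (hj : j ≤ C.q) : 0 ≤ C.A (C.p - 1) (C.b j) := by
  have hq := C.q_pos
  refine A_last_nonneg ?_ (C.symm.A_vertex_nonpos (show C.q - 1 < C.q by omega) hj)
  rw [C.apex]
  exact C.symm.y_a_le hj le_rfl

theorem OnA.B_last_nonneg {i : ℕ} {u : ℝ × ℝ} (h : C.OnA i u) : 0 ≤ C.B (C.q - 1) u := by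
  have hp := C.p_pos
  refine C.symm.A_last_nonneg ?_ (h.nonpos (show C.p - 1 < C.p by omega))
  change C.y u ≤ C.y (C.b C.q)
  rw [← C.apex]
  exact h.right.le.trans (y_a_le h.lt le_rfl)

theorem OnA.mem_region {i : ℕ} {u : ℝ × ℝ} (h : C.OnA i u) : u ∈ C.region := by
  have hq := C.q_pos
  exact ⟨(y_a_nonneg h.lt.le).trans h.left.le, ⟨i, h.lt, h.zero.ge⟩, C.q - 1, by omega,
    h.B_last_nonneg⟩

theorem OnB.mem_region {j : ℕ} {w : ℝ × ℝ} (h : C.OnB j w) : w ∈ C.region :=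
  C.symm_region ▸ OnA.mem_region (C := C.symm) h

/-- Of the upper ends of two edges on different chains, the lower one is on the inner side of the
other edge. -/
theorem B_nonneg_of_le {i j : ℕ} (hi : i < C.p) (hj : j < C.q)
    (h : C.y (C.a (i + 1)) ≤ C.y (C.b (j + 1))) : 0 ≤ C.B j (C.a (i + 1)) := by
  -- Use the last edge of the first chain: `A (p - 1) + B j` is nonnegative at `b (j + 1)`, hence
  -- also at the lower point `a (i + 1)`, where the first summand is nonpositive.
  have hp := C.p_pos
  have h1 := A_last_vertex_nonneg (C := C) (j := j + 1) hj
  have h2 := add_anti (C := C) (i := C.p - 1) (j := j) (by omega) hj h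
  have h3 := B_right (C := C) hj
  have h4 := A_vertex_nonpos (C := C) (i := C.p - 1) (k := i + 1) (by omega) hi
  linarith

theorem lt_of_A_neg {i j : ℕ} (hi : i < C.p) (hj : j < C.q) (h : C.A i (C.b (j + 1)) < 0) :
    C.y (C.a (i + 1)) < C.y (C.b (j + 1)) := by
  by_contra! hle
  exact absurd (C.symm.B_nonneg_of_le hj hi hle) (not_le.2 h)

/-- At most one of the two current edges has the upper end of the other behind it, so the greedy
rule is unambiguous. -/
theorem B_nonneg_of_A_neg {i j : ℕ} (hi : i < C.p) (hj : j < C.q)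
    (h : C.A i (C.b (j + 1)) < 0) : 0 ≤ C.B j (C.a (i + 1)) :=
  B_nonneg_of_le hi hj (lt_of_A_neg hi hj h).le

/-- Behind an edge of the first chain but in front of its last edge: then also behind all lower
edges. -/
theorem A_neg_of_le {i k : ℕ} {z : ℝ × ℝ} (hik : i ≤ k) (hk : k < C.p) (h : C.A k z < 0)
    (hz : 0 ≤ C.A (C.p - 1) z) : C.A i z < 0 := by
  refine (A_mono hik hk ?_).trans_lt h
  -- Below `a k` the edge functions decrease from `k` on, so the last one would be negative too.
  by_contra! hlt
  have := A_anti (C := C) (i := k) (k := C.p - 1) (z := z) (by omega) (by omega)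
    (hlt.le.trans (C.y_a_succ k hk).le)
  linarith

/-- The sum `A i + B j'` falls strictly from `b (j + 1)` up to `w`, while `B j'` goes from a
nonpositive value to zero; so `A i` falls. -/
theorem A_neg_of_onB {i j j' : ℕ} {w : ℝ × ℝ} (hi : i < C.p) (hj : j < j')
    (hw : C.OnB j' w) (h : C.A i (C.b (j + 1)) < 0) : C.A i w < 0 := by
  have hj' : j' < C.q := hw.lt
  have h1 : C.B j' w = 0 := hw.zero
  have h2 : C.B j' (C.b (j + 1)) ≤ 0 := C.symm.A_vertex_nonpos hj' (show j + 1 ≤ C.q by omega)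
  have h3 : C.y (C.b j') < C.y w := hw.left
  have h4 : C.y (C.b (j + 1)) ≤ C.y (C.b j') := C.symm.y_a_le hj hj'.le
  have h5 := add_strictAnti (C := C) hi hj' (h4.trans_lt h3)
  linarith

theorem continuous_A_line (i : ℕ) (u w : ℝ × ℝ) :
    Continuous fun s : ℝ => C.A i (AffineMap.lineMap u w s) := by
  simp only [A_line]
  fun_prop

/-- Just after leaving `u` the segment is behind the edge `i`, since an affine function that starts
at zero and ends negative is negative in between, and behind all other edges of the chain, since
their functions are already negative at `u`. So it leaves the region at once. -/
theorem not_sees {i : ℕ} {u w : ℝ × ℝ} (hu : C.OnA i u) (hw : C.A i w < 0) :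
    ¬ Sees C.region u w := by
  intro hs
  have key : ∀ k ∈ Finset.range C.p, ∀ᶠ s : ℝ in 𝓝[>] 0,
      C.A k (AffineMap.lineMap u w s) < 0 := by
    intro k hk
    rw [Finset.mem_range] at hk
    rcases eq_or_ne k i with rfl | hki
    · filter_upwards [self_mem_nhdsWithin] with s hs
      rw [A_line, hu.zero]
      have : (0 : ℝ) < s := hs
      nlinarith
    · have h0 : C.A k (AffineMap.lineMap u w (0 : ℝ)) < 0 := by
        simpa using hu.neg hk hki
      exact ((continuous_A_line k u w).continuousAt.eventually_lt continuousAt_const h0).filter_mono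
        nhdsWithin_le_nhds
  have h1 := (Filter.eventually_all_finset _).2 key
  have h2 : ∀ᶠ s : ℝ in 𝓝[>] 0, s < 1 :=
    (eventually_lt_nhds one_pos).filter_mono nhdsWithin_le_nhds
  obtain ⟨s, hs1, hs2, hs3⟩ := (h1.and (h2.and self_mem_nhdsWithin)).exists
  have hmem : AffineMap.lineMap u w s ∈ segment ℝ u w := by
    rw [segment_eq_image_lineMap]
    exact ⟨s, ⟨le_of_lt hs3, hs2.le⟩, rfl⟩
  obtain ⟨-, ⟨k, hk, hk'⟩, -⟩ := hs hmem
  exact absurd hk' (not_le.2 (hs1 k (Finset.mem_range.2 hk)))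

/-! ### The greedy trace -/

/-- A trace of the greedy matching of the edges of the two chains: at step `k` the current edges are
`ii k` and `jj k`; `sa k` (`sb k`) says that only the first (second) chain advances. -/
structure Trace (C : FunnelChart) (N : ℕ) (ii jj : ℕ → ℕ) (sa sb : ℕ → Prop) : Prop where
  ii_zero : ii 0 = 0
  jj_zero : jj 0 = 0
  ii_lt : ∀ k < N, ii k < C.p
  jj_lt : ∀ k < N, jj k < C.q
  ii_succ : ∀ k < N, (sb k → ii (k + 1) = ii k) ∧ (¬ sb k → ii (k + 1) = ii k + 1)
  jj_succ : ∀ k < N, (sa k → jj (k + 1) = jj k) ∧ (¬ sa k → jj (k + 1) = jj k + 1)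
  sa_iff : ∀ k < N, sa k ↔ C.A (ii k) (C.b (jj k + 1)) < 0
  sb_iff : ∀ k < N, sb k ↔ C.B (jj k) (C.a (ii k + 1)) < 0
  ii_end : ii N = C.p
  jj_end : jj N = C.q

namespace Trace

variable {N : ℕ} {ii jj : ℕ → ℕ} {sa sb : ℕ → Prop}

theorem symm (T : C.Trace N ii jj sa sb) : C.symm.Trace N jj ii sb sa where
  ii_zero := T.jj_zero
  jj_zero := T.ii_zero
  ii_lt := T.jj_lt
  jj_lt := T.ii_lt
  ii_succ := T.jj_succ
  jj_succ := T.ii_succ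
  sa_iff := T.sb_iff
  sb_iff := T.sa_iff
  ii_end := T.jj_end
  jj_end := T.ii_end

theorem not_sb (T : C.Trace N ii jj sa sb) {k : ℕ} (hk : k < N) (h : sa k) : ¬ sb k := by
  rw [T.sb_iff k hk, not_lt]
  exact B_nonneg_of_A_neg (T.ii_lt k hk) (T.jj_lt k hk) ((T.sa_iff k hk).1 h)

theorem ii_mono (T : C.Trace N ii jj sa sb) {k l : ℕ} (hkl : k ≤ l) (hl : l ≤ N) :
    ii k ≤ ii l := by
  induction l, hkl using Nat.le_induction with
  | base => exact le_rfl
  | succ l hl' ih =>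
    have h1 := T.ii_succ l (by omega)
    have h2 := ih (by omega)
    by_cases h : sb l
    · rw [h1.1 h]; exact h2
    · rw [h1.2 h]; omega

theorem jj_mono (T : C.Trace N ii jj sa sb) {k l : ℕ} (hkl : k ≤ l) (hl : l ≤ N) :
    jj k ≤ jj l := T.symm.ii_mono hkl hl

theorem ii_lt_of_lt (T : C.Trace N ii jj sa sb) {k l : ℕ} (hkl : k < l) (hl : l ≤ N)
    (h : ¬ sb k) : ii k < ii l := by
  have h1 := (T.ii_succ k (by omega)).2 h
  have h2 : ii (k + 1) ≤ ii l := T.ii_mono hkl hl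
  omega

/-- Advancing on the first chain does not lose a point in front of one of its later edges. -/
theorem exists_A_nonneg_succ (T : C.Trace N ii jj sa sb) {k : ℕ} (hk : k + 1 < N) {z : ℝ × ℝ}
    (hz : ∃ i, ii k ≤ i ∧ i < C.p ∧ 0 ≤ C.A i z)
    (hn : ¬ (0 ≤ C.A (ii k) z ∧ 0 ≤ C.B (jj k) z)) :
    ∃ i, ii (k + 1) ≤ i ∧ i < C.p ∧ 0 ≤ C.A i z := by
  obtain ⟨i, h1, h2, h3⟩ := hz
  by_cases hsb : sb k
  · exact ⟨i, by rw [(T.ii_succ k (by omega)).1 hsb]; exact h1, h2, h3⟩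
  have hs := (T.ii_succ k (by omega)).2 hsb
  have hlt := T.ii_lt (k + 1) hk
  rcases h1.lt_or_eq with h | rfl
  · exact ⟨i, by omega, h2, h3⟩
  refine ⟨ii (k + 1), le_rfl, hlt, ?_⟩
  rw [hs] at hlt ⊢
  -- Otherwise `z` is behind the edge `jj k`, by `hn`, and not above `a (ii k + 1)`. The sum of the
  -- next edge function and `B (jj k)` is then at least its value at that vertex, which is
  -- nonnegative because `sb k` fails.
  by_contra! hneg
  have hB : C.B (jj k) z < 0 := by
    by_contra! h
    exact hn ⟨h3, h⟩
  have hsb' : 0 ≤ C.B (jj k) (C.a (ii k + 1)) := by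
    rw [T.sb_iff k (by omega)] at hsb
    exact not_lt.1 hsb
  have hy : C.y z ≤ C.y (C.a (ii k + 1)) := by
    by_contra! h
    have := A_mono (C := C) (Nat.le_succ (ii k)) hlt h.le
    linarith
  have := add_anti (C := C) hlt (T.jj_lt k (by omega)) hy
  have h4 := A_left (C := C) hlt
  linarith

/-- The triangles of a trace cover the region. -/
theorem cover (T : C.Trace N ii jj sa sb) {z : ℝ × ℝ} (hz : z ∈ C.region) :
    ∃ k < N, 0 ≤ C.A (ii k) z ∧ 0 ≤ C.B (jj k) z := by
  by_contra! hno
  have hN : 0 < N := by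
    by_contra! h
    have h1 := T.ii_end
    have h2 := T.ii_zero
    have h3 := C.p_pos
    obtain rfl : N = 0 := by omega
    omega
  have hn : ∀ k < N, ¬ (0 ≤ C.A (ii k) z ∧ 0 ≤ C.B (jj k) z) :=
    fun k hk h => absurd h.2 (not_le.2 (hno k hk h.1))
  -- Before each step, `z` is in front of a current or later edge of either chain. At the last step
  -- only the current edges are left, which puts `z` into their triangle.
  have key : ∀ k < N, (∃ i, ii k ≤ i ∧ i < C.p ∧ 0 ≤ C.A i z) ∧
      ∃ j, jj k ≤ j ∧ j < C.q ∧ 0 ≤ C.B j z := by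
    intro k
    induction k with
    | zero =>
      intro _
      obtain ⟨-, ⟨i, hi, hi'⟩, j, hj, hj'⟩ := hz
      exact ⟨⟨i, by rw [T.ii_zero]; omega, hi, hi'⟩, j, by rw [T.jj_zero]; omega, hj, hj'⟩
    | succ k ih =>
      intro hk
      obtain ⟨h1, h2⟩ := ih (by omega)
      have h3 := hn k (by omega)
      exact ⟨T.exists_A_nonneg_succ hk h1 h3,
        T.symm.exists_A_nonneg_succ hk h2 fun h => h3 ⟨h.2, h.1⟩⟩
  obtain ⟨M, rfl⟩ : ∃ M, N = M + 1 := ⟨N - 1, by omega⟩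
  obtain ⟨⟨i, h1, h2, h3⟩, j, h4, h5, h6⟩ := key M (by omega)
  have e1 := T.ii_succ M (by omega)
  have e2 := T.jj_succ M (by omega)
  have l1 := T.ii_lt M (by omega)
  have l2 := T.jj_lt M (by omega)
  have f1 := T.ii_end
  have f2 := T.jj_end
  have g1 : i = ii M := by
    by_cases h : sb M
    · have := e1.1 h; omega
    · have := e1.2 h; omega
  have g2 : j = jj M := by
    by_cases h : sa M
    · have := e2.1 h; omega
    · have := e2.2 h; omega
  subst g1 g2
  exact hn M (by omega) ⟨h3, h6⟩

/-- The value at the bottom of the triangle of a step of a trace is positive. -/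
theorem add_pos (T : C.Trace N ii jj sa sb) {k : ℕ} (hk : k < N) {z : ℝ × ℝ} (hz : C.y z = 0) :
    0 < C.A (ii k) z + C.B (jj k) z := by
  have hi := T.ii_lt k hk
  have hj := T.jj_lt k hk
  -- The sum decreases with height and is nonnegative at a point of positive height: at the upper
  -- end of the second edge if only the second chain advances, else at that of the first edge.
  by_cases h : sb k
  · have h1 : 0 ≤ C.A (ii k) (C.b (jj k + 1)) := by
      by_contra! hlt
      exact T.not_sb hk ((T.sa_iff k hk).2 hlt) h
    have h2 : C.y (C.b (jj k)) < C.y (C.b (jj k + 1)) := C.y_b_succ _ hj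
    have h3 : 0 ≤ C.y (C.b (jj k)) := C.symm.y_a_nonneg hj.le
    have := add_strictAnti (C := C) hi hj (show C.y z < C.y (C.b (jj k + 1)) by linarith)
    have := B_right (C := C) hj
    linarith
  · rw [T.sb_iff k hk, not_lt] at h
    have h2 := C.y_a_succ _ hi
    have h3 : 0 ≤ C.y (C.a (ii k)) := y_a_nonneg hi.le
    have := add_strictAnti (C := C) hi hj (show C.y z < C.y (C.a (ii k + 1)) by linarith)
    have := A_right (C := C) hi
    linarith

/-- After a step `k` in which only the first chain advances, the later steps `l` are on later edges
of the second chain, or else still below the same edge, with the previous edge of the first chain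
behind its upper end. -/
theorem lt_or_of_sa (T : C.Trace N ii jj sa sb) {k l : ℕ} (hkl : k < l) (hl : l < N) (h : sa k) :
    jj k < jj l ∨ jj k = jj l ∧ ∃ i, ii l = i + 1 ∧ ii k ≤ i ∧ C.A i (C.b (jj l + 1)) < 0 := by
  induction l, hkl using Nat.le_induction with
  | base =>
    right
    have h1 := (T.jj_succ k (by omega)).1 h
    refine ⟨h1.symm, ii k, (T.ii_succ k (by omega)).2 (T.not_sb (by omega) h), le_rfl, ?_⟩
    rw [h1]
    exact (T.sa_iff k (by omega)).1 h
  | succ l hl' ih =>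
    by_cases hs : sa l
    · have h1 := (T.jj_succ l (by omega)).1 hs
      have h2 := T.ii_mono (k := k) (l := l) (by omega) (by omega)
      rw [h1]
      have h3 := T.jj_mono (k := k) (l := l) (by omega) (by omega)
      rcases h3.lt_or_eq with h3 | h3
      · exact Or.inl h3
      · exact Or.inr ⟨h3, ii l, (T.ii_succ l (by omega)).2 (T.not_sb (by omega) hs), h2,
          (T.sa_iff l (by omega)).1 hs⟩
    · have h1 := (T.jj_succ l (by omega)).2 hs
      have h3 := T.jj_mono (k := k) (l := l) (by omega) (by omega)
      left; omega

/-- A point on the second chain, emitted at step `l`, is hidden from the points on the edges of the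
first chain up to an earlier step `k` in which only the first chain advanced. -/
theorem A_neg_of_sa (T : C.Trace N ii jj sa sb) {k l i : ℕ} {w : ℝ × ℝ} (hkl : k < l) (hl : l < N)
    (h : sa k) (hw : C.OnB (jj l) w)
    (hw' : ∀ i, ii l = i + 1 → C.A i (C.b (jj l + 1)) < 0 → C.A i w < 0) (hi : i ≤ ii k) :
    C.A i w < 0 := by
  have hlast : 0 ≤ C.A (C.p - 1) w := OnA.B_last_nonneg (C := C.symm) hw
  have hk := T.ii_lt k (by omega)
  -- Either `w` is on an edge above a vertex that is behind `ii k`, or the second chain has not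
  -- moved; then the previous edge `i'` of the first chain has the upper end of the edge of `w`
  -- behind it, and `hw'` carries this to `w`.
  rcases T.lt_or_of_sa hkl hl h with h1 | ⟨-, i', h1, h2, h3⟩
  · exact A_neg_of_le hi hk (A_neg_of_onB hk h1 hw ((T.sa_iff k (by omega)).1 h)) hlast
  · have := T.ii_lt l hl
    exact A_neg_of_le (hi.trans h2) (by omega) (hw' i' h1 h3) hlast

/-- Which chain the point of step `k` is on: steps in which only one chain advances take their point
on that chain, and the others do as their successor. -/
structure Sides (N : ℕ) (sa sb : ℕ → Prop) (ta : ℕ → Prop) : Prop where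
  of_sa : ∀ k < N, sa k → ta k
  of_sb : ∀ k < N, sb k → ¬ ta k
  of_succ : ∀ k, k + 1 < N → ¬ sa k → ¬ sb k → (ta k ↔ ta (k + 1))

/-- Consider a step where the side changes from the first chain to the second. It is not in `sb`,
which would put it on the second chain, and a step in which both chains advance has the side of its
successor; so it is in `sa`. -/
theorem Sides.exists_sa {ta : ℕ → Prop} (S : Sides N sa sb ta) {k l : ℕ} (hkl : k ≤ l) (hl : l < N)
    (hk : ta k) (hl' : ¬ ta l) : ∃ r, k ≤ r ∧ r < l ∧ sa r := by
  induction l, hkl using Nat.le_induction with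
  | base => exact absurd hk hl'
  | succ l hl1 ih =>
    by_cases h : ta l
    · refine ⟨l, hl1, Nat.lt_succ_self l, ?_⟩
      by_contra hs
      by_cases hb : sb l
      · exact S.of_sb l (by omega) hb h
      · exact hl' ((S.of_succ l hl hs hb).1 h)
    · obtain ⟨r, h1, h2, h3⟩ := ih (by omega) h
      exact ⟨r, h1, by omega, h3⟩

theorem Sides.symm {ta : ℕ → Prop} (S : Sides N sa sb ta) : Sides N sb sa fun k => ¬ ta k where
  of_sa := S.of_sb
  of_sb k hk h := not_not.2 (S.of_sa k hk h)
  of_succ k hk h1 h2 := not_congr (S.of_succ k hk h2 h1)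

/-- The later point is behind the edge of the earlier one. On the same chain it is on another edge,
because a step on the first chain advances that chain; on the other chain it is hidden by an
intermediate step of `sa`. -/
theorem not_sees_of_side (T : C.Trace N ii jj sa sb) {ta : ℕ → Prop} (S : Sides N sa sb ta)
    {pt : ℕ → ℝ × ℝ} (hA : ∀ k < N, ta k → C.OnA (ii k) (pt k))
    (hB : ∀ k < N, ¬ ta k → C.OnB (jj k) (pt k) ∧
      ∀ i, ii k = i + 1 → C.A i (C.b (jj k + 1)) < 0 → C.A i (pt k) < 0)
    {k l : ℕ} (hkl : k < l) (hl : l < N) (hk : ta k) : ¬ Sees C.region (pt k) (pt l) := by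
  refine not_sees (hA k (by omega) hk) ?_
  by_cases h : ta l
  · exact (hA l hl h).neg (T.ii_lt k (by omega))
      (T.ii_lt_of_lt hkl hl.le fun hs => S.of_sb k (by omega) hs hk).ne
  · obtain ⟨r, h1, h2, h3⟩ := S.exists_sa hkl.le hl hk h
    obtain ⟨h4, h5⟩ := hB l hl h
    exact T.A_neg_of_sa h2 hl h3 h4 h5 (T.ii_mono h1 (by omega))

/-- The points of a trace do not see each other. -/
theorem not_sees (T : C.Trace N ii jj sa sb) {ta : ℕ → Prop} (S : Sides N sa sb ta)
    {pt : ℕ → ℝ × ℝ}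
    (hA : ∀ k < N, ta k → C.OnA (ii k) (pt k) ∧
      ∀ j, jj k = j + 1 → C.B j (C.a (ii k + 1)) < 0 → C.B j (pt k) < 0)
    (hB : ∀ k < N, ¬ ta k → C.OnB (jj k) (pt k) ∧
      ∀ i, ii k = i + 1 → C.A i (C.b (jj k + 1)) < 0 → C.A i (pt k) < 0)
    {k l : ℕ} (hkl : k < l) (hl : l < N) : ¬ Sees C.region (pt k) (pt l) := by
  by_cases h : ta k
  · exact T.not_sees_of_side S (fun k hk h => (hA k hk h).1) hB hkl hl h
  · have := T.symm.not_sees_of_side S.symm (pt := pt) (fun k hk h => (hB k hk h).1)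
      (fun k hk h => hA k hk (not_not.1 h)) hkl hl h
    rwa [C.symm_region] at this

end Trace

end FunnelChart

/-! ## Locally convex connected open sets -/

section LocallyConvex

variable {E : Type*} [NormedAddCommGroup E] [NormedSpace ℝ E] {K V : Set E}

/-- The parameters of points in `V` form a relatively closed set: at a limit parameter `s`,
reflection in `s` makes `b` the midpoint of a point of `V` and a point of its closure, both near
`b`, where `V` is open and convex. Connectedness of the interval gives the rest. -/
theorem segment_subset_of_subset_closure (hK : Convex ℝ K) (hV : IsOpen V) (hVK : V ⊆ K)
    (h : ∀ b ∈ K, b ∈ closure V → b ∉ V →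
      ∃ S : Set E, Convex ℝ S ∧ ∀ᶠ z in 𝓝 b, (z ∈ V ↔ z ∈ S))
    {x y : E} (hx : x ∈ V) (hy : y ∈ V) (hxy : segment ℝ x y ⊆ closure V) :
    segment ℝ x y ⊆ V := by
  rw [segment_eq_image_lineMap] at hxy ⊢
  rw [image_subset_iff] at hxy ⊢
  have hcont : Continuous (AffineMap.lineMap x y : ℝ → E) := AffineMap.lineMap_continuous
  refine isPreconnected_Icc.subset_of_closure_inter_subset (hV.preimage hcont)
    ⟨0, ⟨le_rfl, zero_le_one⟩, by simpa using hx⟩ ?_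
  rintro s ⟨hs, hs01⟩
  by_contra hsV
  have h0 : s ≠ 0 := by rintro rfl; exact hsV (by simpa using hx)
  have h1 : s ≠ 1 := by rintro rfl; exact hsV (by simpa using hy)
  have hbK : AffineMap.lineMap x y s ∈ K := by
    refine hK.segment_subset (hVK hx) (hVK hy) ?_
    rw [segment_eq_image_lineMap]
    exact ⟨s, hs01, rfl⟩
  obtain ⟨S, hS, hev⟩ := h _ hbK (hxy hs01) hsV
  obtain ⟨r, hr, hball⟩ := Metric.eventually_nhds_iff_ball.1 hev
  set b : E := AffineMap.lineMap x y s with hb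
  have hCeq : V ∩ Metric.ball b r = S ∩ Metric.ball b r := by
    ext z
    exact and_congr_left fun hz => hball z hz
  have hCconv : Convex ℝ (V ∩ Metric.ball b r) := hCeq ▸ hS.inter (convex_ball b r)
  have hCopen : IsOpen (V ∩ Metric.ball b r) := hV.inter Metric.isOpen_ball
  have hnear : ∀ᶠ t in 𝓝 s, AffineMap.lineMap x y t ∈ Metric.ball b r :=
    hcont.continuousAt.eventually (Metric.ball_mem_nhds b hr)
  have h01 : ∀ᶠ t in 𝓝 s, t ∈ Icc (0 : ℝ) 1 :=
    Icc_mem_nhds (lt_of_le_of_ne hs01.1 h0.symm) (lt_of_le_of_ne hs01.2 h1)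
  have hrefl : Filter.Tendsto (fun t : ℝ => 2 * s - t) (𝓝 s) (𝓝 s) := by
    have : Continuous fun t : ℝ => 2 * s - t := by fun_prop
    simpa [two_mul] using this.tendsto s
  obtain ⟨t, ht, ⟨ht1, -⟩, ht2, ht3⟩ := (mem_closure_iff_frequently.1 hs).and_eventually
    ((hnear.and h01).and (hrefl.eventually (hnear.and h01))) |>.exists
  have m1 : AffineMap.lineMap x y t ∈ interior (V ∩ Metric.ball b r) := by
    rw [hCopen.interior_eq]; exact ⟨ht, ht1⟩
  have m2 : AffineMap.lineMap x y (2 * s - t) ∈ closure (V ∩ Metric.ball b r) := by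
    rw [inter_comm]
    exact Metric.isOpen_ball.inter_closure ⟨ht2, hxy ht3⟩
  have hmem := hCconv.openSegment_interior_closure_subset_interior m1 m2
    (show b ∈ openSegment ℝ _ _ from
      ⟨1 / 2, 1 / 2, by norm_num, by norm_num, by norm_num, by
        simp only [hb, AffineMap.lineMap_apply_module]; module⟩)
  exact hsV (interior_subset hmem).1

/-- A connected open subset of a convex set is convex if it is locally convex at its boundary
points. -/
theorem convex_of_locally_convex (hK : Convex ℝ K) (hV : IsOpen V) (hVc : IsPreconnected V)
    (hVK : V ⊆ K)
    (h : ∀ b ∈ K, b ∈ closure V → b ∉ V →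
      ∃ S : Set E, Convex ℝ S ∧ ∀ᶠ z in 𝓝 b, (z ∈ V ↔ z ∈ S)) :
    Convex ℝ V := by
  rw [convex_iff_segment_subset]
  intro x hx y hy
  -- The set of points that `x` sees inside `V` is open by compactness of the parameter interval and
  -- relatively closed by the previous lemma.
  have hopen : IsOpen {y : E | segment ℝ x y ⊆ V} := by
    rw [isOpen_iff_mem_nhds]
    intro y hy
    have hcont : Continuous fun p : E × ℝ => AffineMap.lineMap x p.1 p.2 := by
      simp only [AffineMap.lineMap_apply_module]
      fun_prop
    have := (isCompact_Icc (a := (0 : ℝ)) (b := 1)).eventually_forall_of_forall_eventually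
      (x₀ := y) (P := fun (y : E) s => AffineMap.lineMap x y s ∈ V) (fun s hs =>
        hcont.continuousAt.eventually (hV.mem_nhds (hy (by
          rw [segment_eq_image_lineMap]; exact ⟨s, hs, rfl⟩))))
    filter_upwards [this] with z hz
    rw [segment_eq_image_lineMap, image_subset_iff]
    exact hz
  refine hVc.subset_of_closure_inter_subset hopen ⟨x, hx, by simpa using hx⟩ ?_ hy
  rintro y ⟨hy1, hy2⟩
  refine segment_subset_of_subset_closure hK hV hVK h hx hy2 ?_
  rw [segment_eq_image_lineMap, image_subset_iff]
  intro s hs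
  have hcont : Continuous fun z : E => AffineMap.lineMap x z s := by
    simp only [AffineMap.lineMap_apply_module]
    fun_prop
  refine map_mem_closure (f := fun z : E => AffineMap.lineMap x z s) hcont hy1 fun z hz => ?_
  refine hz ?_
  rw [segment_eq_image_lineMap]
  exact ⟨s, hs, rfl⟩

end LocallyConvex

/-! ## Saturated sets -/

/-- `G` contains every connected subset of `W` that it meets. -/
def Saturated (W G : Set (ℝ × ℝ)) : Prop :=
  ∀ A : Set (ℝ × ℝ), IsPreconnected A → A ⊆ W → (A ∩ G).Nonempty → A ⊆ G

theorem Saturated.compl {W G : Set (ℝ × ℝ)} (h : Saturated W G) : Saturated W Gᶜ := by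
  rintro A hA hAW ⟨z, hzA, hz⟩ y hy hyG
  exact hz (h A hA hAW ⟨y, hy, hyG⟩ hzA)

/-- A small ball cuts `S` in a connected piece of `W`, which is contained in `G` as soon as it meets
`G`. -/
theorem Saturated.dichotomy {W G S : Set (ℝ × ℝ)} (h : Saturated W G) {c : ℝ × ℝ}
    (hS : ∀ r, 0 < r → IsPreconnected (S ∩ Metric.ball c r)) (hSW : ∀ᶠ z in 𝓝 c, z ∈ S → z ∈ W) :
    (∀ᶠ z in 𝓝 c, z ∈ S → z ∈ G) ∨ ∀ᶠ z in 𝓝 c, z ∈ S → z ∈ Gᶜ := by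
  obtain ⟨r, hr, hball⟩ := Metric.eventually_nhds_iff_ball.1 hSW
  have hW : S ∩ Metric.ball c r ⊆ W := fun z hz => hball z hz.2 hz.1
  by_cases hne : (S ∩ Metric.ball c r ∩ G).Nonempty
  · left
    filter_upwards [Metric.ball_mem_nhds c hr] with z hz hzS
    exact h _ (hS r hr) hW hne ⟨hzS, hz⟩
  · right
    filter_upwards [Metric.ball_mem_nhds c hr] with z hz hzS hzG
    exact hne ⟨z, ⟨hzS, hz⟩, hzG⟩

theorem saturated_connectedComponentIn (W : Set (ℝ × ℝ)) (x : ℝ × ℝ) :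
    Saturated W (connectedComponentIn W x) := by
  rintro A hA hAW ⟨z, hzA, hz⟩
  rw [connectedComponentIn_eq hz]
  exact hA.subset_connectedComponentIn hzA hAW

/-! ## The two sides of an edge -/

theorem continuous_orient (p q : ℝ × ℝ) : Continuous (orient p q) := by
  unfold orient
  fun_prop

theorem orient_lineMap (p q u v : ℝ × ℝ) (s : ℝ) :
    orient p q (AffineMap.lineMap u v s) = (1 - s) * orient p q u + s * orient p q v := by
  simp only [orient, AffineMap.lineMap_apply_module, Prod.fst_add, Prod.snd_add, Prod.smul_fst,
    Prod.smul_snd, smul_eq_mul]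
  ring

theorem orient_combo (p q u v : ℝ × ℝ) {s t : ℝ} (h : s + t = 1) :
    orient p q (s • u + t • v) = s * orient p q u + t * orient p q v := by
  obtain rfl : s = 1 - t := by linarith
  rw [← AffineMap.lineMap_apply_module]
  exact orient_lineMap p q u v t

theorem orient_self_left (p q : ℝ × ℝ) : orient p q p = 0 := by simp [orient]

theorem orient_self_right (p q : ℝ × ℝ) : orient p q q = 0 := by simp [orient]; ring

theorem orient_swap (p q z : ℝ × ℝ) : orient q p z = -orient p q z := by simp [orient]; ring

theorem orient_rotate (p q z : ℝ × ℝ) : orient q z p = orient p q z := by simp [orient]; ring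

theorem orient_segment_eq_zero {p q z : ℝ × ℝ} (hz : z ∈ segment ℝ p q) : orient p q z = 0 := by
  obtain ⟨s, t, -, -, hst, rfl⟩ := hz
  rw [orient_combo _ _ _ _ hst, orient_self_left, orient_self_right]
  ring

theorem convex_orient_pos (ε : ℝ) (p q : ℝ × ℝ) : Convex ℝ {z | 0 < ε * orient p q z} := by
  intro u hu v hv s t hs ht hst
  rw [mem_ofPred_eq] at *
  rw [orient_combo _ _ _ _ hst]
  rcases hs.eq_or_lt with rfl | hs
  · obtain rfl : t = 1 := by linarith
    linarith
  · nlinarith [mul_pos hs hu, mul_nonneg ht hv.le]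

theorem frequently_orient_pos {ε : ℝ} (hε : ε ≠ 0) {p q b : ℝ × ℝ} (hpq : p ≠ q)
    (hb : orient p q b = 0) : ∃ᶠ z in 𝓝 b, 0 < ε * orient p q z := by
  -- Leave `b` along the normal of the line, on the side given by the sign of `ε`.
  have hcont : Continuous fun s : ℝ =>
      ((b.1 - s * (ε * (q.2 - p.2)), b.2 + s * (ε * (q.1 - p.1))) : ℝ × ℝ) := by fun_prop
  have ht : Filter.Tendsto (fun s : ℝ =>
      ((b.1 - s * (ε * (q.2 - p.2)), b.2 + s * (ε * (q.1 - p.1))) : ℝ × ℝ)) (𝓝[>] 0) (𝓝 b) := by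
    have := hcont.tendsto 0
    simp only [zero_mul, sub_zero, add_zero, Prod.mk.eta] at this
    exact this.mono_left nhdsWithin_le_nhds
  refine ht.frequently (Filter.Eventually.frequently ?_)
  filter_upwards [self_mem_nhdsWithin] with s hs
  have hs : (0 : ℝ) < s := hs
  have hd : 0 < (q.1 - p.1) ^ 2 + (q.2 - p.2) ^ 2 := by
    by_contra! hle
    have h1 : q.1 - p.1 = 0 := by nlinarith [sq_nonneg (q.1 - p.1), sq_nonneg (q.2 - p.2)]
    have h2 : q.2 - p.2 = 0 := by nlinarith [sq_nonneg (q.1 - p.1), sq_nonneg (q.2 - p.2)]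
    exact hpq (Prod.ext (by linarith) (by linarith))
  have : ε * orient p q (b.1 - s * (ε * (q.2 - p.2)), b.2 + s * (ε * (q.1 - p.1))) =
      ε ^ 2 * (s * ((q.1 - p.1) ^ 2 + (q.2 - p.2) ^ 2)) := by
    simp only [orient] at hb ⊢
    linear_combination ε * hb
  rw [this]
  positivity

/-- Near `b`, the side of the line `p q` given by the sign of `ε` lies in `G`. -/
def Side (ε : ℝ) (G : Set (ℝ × ℝ)) (p q b : ℝ × ℝ) : Prop :=
  ∀ᶠ z in 𝓝 b, 0 < ε * orient p q z → z ∈ G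

theorem Side.not_compl {ε : ℝ} (hε : ε ≠ 0) {G : Set (ℝ × ℝ)} {p q b : ℝ × ℝ} (hpq : p ≠ q)
    (hb : orient p q b = 0) (h : Side ε G p q b) : ¬ Side ε Gᶜ p q b := by
  intro h'
  obtain ⟨z, hz, h1, h2⟩ := ((frequently_orient_pos hε hpq hb).and_eventually (h.and h')).exists
  exact h2 hz (h1 hz)

theorem side_swap {ε : ℝ} {G : Set (ℝ × ℝ)} {p q b : ℝ × ℝ} :
    Side (-ε) G q p b ↔ Side ε G p q b := by
  simp only [Side, orient_swap p q, neg_mul_neg]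

/-- The open edge `p q` of a polygonal chain `B` inside an open set `K`. -/
structure IsOpenEdge (K B : Set (ℝ × ℝ)) (p q : ℝ × ℝ) : Prop where
  ne : p ≠ q
  mem : ∀ b ∈ openSegment ℝ p q, b ∈ K
  local_eq : ∀ b ∈ openSegment ℝ p q, ∀ᶠ z in 𝓝 b, z ∈ B → orient p q z = 0

theorem isOpenEdge_swap {K B : Set (ℝ × ℝ)} {p q : ℝ × ℝ} (h : IsOpenEdge K B p q) :
    IsOpenEdge K B q p where
  ne := h.ne.symm
  mem := by rw [openSegment_symm]; exact h.mem
  local_eq := by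
    rw [openSegment_symm]
    simpa only [orient_swap p q, neg_eq_zero] using h.local_eq

section Sides

variable {K B G : Set (ℝ × ℝ)} {p c q : ℝ × ℝ} {ε : ℝ}

theorem IsOpenEdge.side_or (hK : IsOpen K) (he : IsOpenEdge K B p q) (hG : Saturated (K \ B) G)
    {b : ℝ × ℝ} (hb : b ∈ openSegment ℝ p q) : Side ε G p q b ∨ Side ε Gᶜ p q b := by
  refine hG.dichotomy (S := {z | 0 < ε * orient p q z})
    (fun r _ => ((convex_orient_pos ε p q).inter (convex_ball b r)).isPreconnected) ?_
  filter_upwards [he.local_eq b hb, hK.mem_nhds (he.mem b hb)] with z h1 h2 (h3 : 0 < _)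
  refine ⟨h2, fun h4 => ?_⟩
  rw [h1 h4, mul_zero] at h3
  exact h3.false

/-- Having `G` on this side and having its complement there are open conditions on the point of the
edge. They exclude each other and exhaust the open edge, which is connected. -/
theorem IsOpenEdge.side_of_side (hK : IsOpen K) (hε : ε ≠ 0) (he : IsOpenEdge K B p q)
    (hG : Saturated (K \ B) G) {b b' : ℝ × ℝ} (hb : b ∈ openSegment ℝ p q)
    (hb' : b' ∈ openSegment ℝ p q) (h : Side ε G p q b) : Side ε G p q b' := by
  have hopen : ∀ G', IsOpen {b | Side ε G' p q b} := by
    intro G'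
    rw [isOpen_iff_eventually]
    exact fun b hb => eventually_eventually_nhds.2 hb
  have hpre := (convex_openSegment (𝕜 := ℝ) p q).isPreconnected
  rw [isPreconnected_iff_subset_of_disjoint] at hpre
  rcases hpre _ _ (hopen G) (hopen Gᶜ) (fun x hx => he.side_or hK hG hx) (by
    rw [eq_empty_iff_forall_notMem]
    rintro x ⟨hx, h1, h2⟩
    exact Side.not_compl hε he.ne (orient_segment_eq_zero (openSegment_subset_segment _ _ _ hx))
      h1 h2) with h1 | h1
  · exact h1 hb'
  · exact absurd (h1 hb) (Side.not_compl hε he.ne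
      (orient_segment_eq_zero (openSegment_subset_segment _ _ _ hb)) h)

/-! ### Sectors at a corner and their transport along a chain -/

/-- The sector at `c` on the side `ε` of the path `p c q`. -/
def sector (ε : ℝ) (p c q : ℝ × ℝ) : Set (ℝ × ℝ) :=
  {z | (0 < ε * orient p c q ∧ 0 < ε * orient p c z ∧ 0 < ε * orient c q z) ∨
    (ε * orient p c q < 0 ∧ (0 < ε * orient p c z ∨ 0 < ε * orient c q z))}

theorem sector_of_pos (h : 0 < ε * orient p c q) :
    sector ε p c q = {z | 0 < ε * orient p c z} ∩ {z | 0 < ε * orient c q z} := by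
  ext z
  simp [sector, h, not_lt.2 h.le]

theorem sector_of_neg (h : ε * orient p c q < 0) :
    sector ε p c q = {z | 0 < ε * orient p c z} ∪ {z | 0 < ε * orient c q z} := by
  ext z
  simp [sector, h, not_lt.2 h.le]

theorem sector_swap : sector (-ε) q c p = sector ε p c q := by
  ext z
  simp only [sector, mem_ofPred_eq, orient_swap p c, orient_swap c q, neg_mul_neg,
    orient_rotate p c q]
  tauto

theorem convex_sector (h : 0 < ε * orient p c q) : Convex ℝ (sector ε p c q) := by
  rw [sector_of_pos h]
  exact (convex_orient_pos _ _ _).inter (convex_orient_pos _ _ _)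

theorem isPreconnected_sector_inter_ball (h : ε * orient p c q ≠ 0) {r : ℝ} (hr : 0 < r) :
    IsPreconnected (sector ε p c q ∩ Metric.ball c r) := by
  rcases h.lt_or_gt with h | h
  · rw [sector_of_neg h, union_inter_distrib_right]
    -- A point common to both half discs: leave `c` against the sum of the directions to `p` and
    -- `q`.
    have hcont : Continuous fun s : ℝ => c - s • ((p - c) + (q - c)) := by fun_prop
    have hev : ∀ᶠ s : ℝ in 𝓝[>] 0, c - s • ((p - c) + (q - c)) ∈ Metric.ball c r := by
      refine Filter.Eventually.filter_mono nhdsWithin_le_nhds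
        (hcont.continuousAt.eventually (Metric.isOpen_ball.mem_nhds ?_))
      simpa using hr
    obtain ⟨s, hs, hs0⟩ := (hev.and self_mem_nhdsWithin).exists
    have hs0 : (0 : ℝ) < s := hs0
    have e1 : ε * orient p c (c - s • ((p - c) + (q - c))) = s * -(ε * orient p c q) := by
      simp [orient]; ring
    have e2 : ε * orient c q (c - s • ((p - c) + (q - c))) = s * -(ε * orient p c q) := by
      simp [orient]; ring
    refine IsPreconnected.union (c - s • ((p - c) + (q - c))) ⟨?_, hs⟩ ⟨?_, hs⟩
      ((convex_orient_pos _ _ _).inter (convex_ball _ _)).isPreconnected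
      ((convex_orient_pos _ _ _).inter (convex_ball _ _)).isPreconnected
    · rw [mem_ofPred_eq, e1]; nlinarith
    · rw [mem_ofPred_eq, e2]; nlinarith
  · exact ((convex_sector h).inter (convex_ball _ _)).isPreconnected

/-- On each edge its own orientation vanishes, which excludes an intersection of half planes; the
other orientation has weakly the sign of the turn, which excludes a union. -/
theorem notMem_sector {z : ℝ × ℝ} (hz : z ∈ segment ℝ p c ∪ segment ℝ c q) :
    z ∉ sector ε p c q := by
  have key : orient p c z = 0 ∧ 0 ≤ (ε * orient c q z) * (ε * orient p c q) ∨
      orient c q z = 0 ∧ 0 ≤ (ε * orient p c z) * (ε * orient p c q) := by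
    rcases hz with hz | hz
    · left
      refine ⟨orient_segment_eq_zero hz, ?_⟩
      obtain ⟨s, t, hs, -, hst, rfl⟩ := hz
      rw [orient_combo _ _ _ _ hst, orient_self_left, orient_rotate p c q]
      nlinarith [mul_nonneg hs (sq_nonneg (ε * orient p c q))]
    · right
      refine ⟨orient_segment_eq_zero hz, ?_⟩
      obtain ⟨s, t, -, ht, hst, rfl⟩ := hz
      rw [orient_combo _ _ _ _ hst, orient_self_right]
      nlinarith [mul_nonneg ht (sq_nonneg (ε * orient p c q))]
  rintro (⟨h1, h2, h3⟩ | ⟨h1, h2⟩)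
  · rcases key with ⟨h4, -⟩ | ⟨h4, -⟩
    · rw [h4] at h2; simp at h2
    · rw [h4] at h3; simp at h3
  · rcases key with ⟨h4, h5⟩ | ⟨h4, h5⟩
    · rcases h2 with h2 | h2
      · rw [h4] at h2; simp at h2
      · nlinarith
    · rcases h2 with h2 | h2
      · nlinarith
      · rw [h4] at h2; simp at h2

/-- Near `c`, the sector on the side `ε` lies in `G`. -/
def SectorIn (ε : ℝ) (G : Set (ℝ × ℝ)) (p c q : ℝ × ℝ) : Prop :=
  ∀ᶠ z in 𝓝 c, z ∈ sector ε p c q → z ∈ G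

/-- A corner `p c q` of a polygonal chain `B` inside an open set `K`. -/
structure IsChainCorner (K B : Set (ℝ × ℝ)) (p c q : ℝ × ℝ) : Prop where
  turn : orient p c q ≠ 0
  mem : c ∈ K
  local_sub : ∀ᶠ z in 𝓝 c, z ∈ B → z ∈ segment ℝ p c ∪ segment ℝ c q

theorem IsChainCorner.swap (h : IsChainCorner K B p c q) : IsChainCorner K B q c p where
  turn := by
    rw [show orient q c p = -orient p c q by simp [orient]; ring]
    exact neg_ne_zero.2 h.turn
  mem := h.mem
  local_sub := by
    filter_upwards [h.local_sub] with z hz hzB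
    rw [segment_symm ℝ q c, segment_symm ℝ c p, union_comm]
    exact hz hzB

theorem IsChainCorner.sectorIn_or (hK : IsOpen K) (hε : ε ≠ 0) (hc : IsChainCorner K B p c q)
    (hG : Saturated (K \ B) G) : SectorIn ε G p c q ∨ SectorIn ε Gᶜ p c q := by
  refine hG.dichotomy (S := sector ε p c q)
    (fun r hr => isPreconnected_sector_inter_ball (mul_ne_zero hε hc.turn) hr) ?_
  filter_upwards [hc.local_sub, hK.mem_nhds hc.mem] with z h1 h2 h3
  exact ⟨h2, fun h4 => notMem_sector (h1 h4) h3⟩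

/-- At points of the edge close to `c`, the half disc on this side is inside the sector;
`IsOpenEdge.side_of_side` carries the conclusion along the edge. -/
theorem SectorIn.side_left (hK : IsOpen K) (hε : ε ≠ 0) (hc : IsChainCorner K B p c q)
    (he : IsOpenEdge K B p c) (hG : Saturated (K \ B) G) (h : SectorIn ε G p c q)
    {b : ℝ × ℝ} (hb : b ∈ openSegment ℝ p c) : Side ε G p c b := by
  have hlim : Filter.Tendsto (fun s : ℝ => AffineMap.lineMap c p s) (𝓝[>] 0) (𝓝 c) := by
    have : Continuous fun s : ℝ => (AffineMap.lineMap c p s : ℝ × ℝ) :=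
      AffineMap.lineMap_continuous
    have := this.tendsto 0
    rw [AffineMap.lineMap_apply_zero] at this
    exact this.mono_left nhdsWithin_le_nhds
  have hlt : ∀ᶠ s : ℝ in 𝓝[>] 0, s < 1 :=
    (eventually_lt_nhds one_pos).filter_mono nhdsWithin_le_nhds
  obtain ⟨s, h1, h2, h3⟩ := ((hlim.eventually (eventually_eventually_nhds.2 h)).and
    (hlt.and self_mem_nhdsWithin)).exists
  have h3 : (0 : ℝ) < s := h3
  refine he.side_of_side hK hε hG (b := AffineMap.lineMap c p s) ?_ hb ?_
  · rw [openSegment_symm, openSegment_eq_image_lineMap]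
    exact ⟨s, ⟨h3, h2⟩, rfl⟩
  rcases (mul_ne_zero hε hc.turn).lt_or_gt with hτ | hτ
  · rw [sector_of_neg hτ] at h1
    filter_upwards [h1] with z hz hpos
    exact hz (Or.inl hpos)
  · rw [sector_of_pos hτ] at h1
    have hpos : 0 < ε * orient c q (AffineMap.lineMap c p s) := by
      rw [orient_lineMap, orient_self_left, orient_rotate p c q]
      nlinarith
    filter_upwards [h1, (continuous_const.mul (continuous_orient c q)).continuousAt.eventually
      (lt_mem_nhds hpos)] with z hz hz1 hz2
    exact hz ⟨hz2, hz1⟩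

theorem SectorIn.swap (h : SectorIn ε G p c q) : SectorIn (-ε) G q c p := by
  rw [SectorIn, sector_swap]; exact h

theorem SectorIn.side_right (hK : IsOpen K) (hε : ε ≠ 0) (hc : IsChainCorner K B p c q)
    (he : IsOpenEdge K B c q) (hG : Saturated (K \ B) G) (h : SectorIn ε G p c q)
    {b : ℝ × ℝ} (hb : b ∈ openSegment ℝ c q) : Side ε G c q b := by
  rw [← side_swap]
  rw [openSegment_symm] at hb
  exact h.swap.side_left hK (neg_ne_zero.2 hε) hc.swap (isOpenEdge_swap he) hG hb

theorem openSegment_nonempty (p q : ℝ × ℝ) : ∃ b, b ∈ openSegment ℝ p q :=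
  ⟨AffineMap.lineMap p q (1 / 2 : ℝ), by
    rw [openSegment_eq_image_lineMap]; exact ⟨1 / 2, by norm_num, rfl⟩⟩

/-- The sector is locally in `G` or in its complement, and the edge excludes the latter. Alternating
with `SectorIn.side_right`, this transports a side from corner to corner. -/
theorem IsChainCorner.sectorIn_of_side_left (hK : IsOpen K) (hε : ε ≠ 0) (hc : IsChainCorner K B p c q)
    (he : IsOpenEdge K B p c) (hG : Saturated (K \ B) G)
    {b : ℝ × ℝ} (hb : b ∈ openSegment ℝ p c) (h : Side ε G p c b) : SectorIn ε G p c q := by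
  refine (hc.sectorIn_or hK hε hG).resolve_right fun h' => ?_
  exact Side.not_compl hε he.ne (orient_segment_eq_zero (openSegment_subset_segment _ _ _ hb)) h
    (h'.side_left hK hε hc he hG.compl hb)

end Sides

/-! ## Polygons with cyclic indices -/

/-- `w` runs periodically through the `n` vertices of a simple polygon. -/
structure IsPolyLoop (n : ℕ) (w : ℕ → ℝ × ℝ) : Prop where
  three_le : 3 ≤ n
  periodic : ∀ k, w (k + n) = w k
  injective : ∀ i j, w i = w j → i % n = j % n
  consecutive : ∀ k, segment ℝ (w k) (w (k + 1)) ∩ segment ℝ (w (k + 1)) (w (k + 2)) = {w (k + 1)}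
  nonconsecutive : ∀ i j, i % n ≠ j % n → j % n ≠ (i + 1) % n → i % n ≠ (j + 1) % n →
    Disjoint (segment ℝ (w i) (w (i + 1))) (segment ℝ (w j) (w (j + 1)))

/-- The union of the edges of a closed polygonal chain. -/
def loopBoundary (w : ℕ → ℝ × ℝ) : Set (ℝ × ℝ) := ⋃ k, segment ℝ (w k) (w (k + 1))

/-- The unbounded part of the complement of `B`. -/
def outerSet (B : Set (ℝ × ℝ)) : Set (ℝ × ℝ) :=
  {z | z ∈ Bᶜ ∧ ¬ Bornology.IsBounded (connectedComponentIn Bᶜ z)}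

theorem saturated_outerSet (B : Set (ℝ × ℝ)) : Saturated (univ \ B) (outerSet B) := by
  rw [← compl_eq_univ_sdiff]
  rintro A hA hAW ⟨z, hzA, -, hz⟩ x hx
  refine ⟨hAW hx, ?_⟩
  rwa [← connectedComponentIn_eq (hA.subset_connectedComponentIn hx hAW hzA)] at hz

/-- A ray that avoids `B` is an unbounded connected subset of the component of its origin. -/
theorem mem_outerSet_of_ray {B : Set (ℝ × ℝ)} {z d : ℝ × ℝ} (hd : d ≠ 0)
    (h : ∀ s : ℝ, 0 ≤ s → z + s • d ∉ B) : z ∈ outerSet B := by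
  refine ⟨by simpa using h 0 le_rfl, fun hb => ?_⟩
  have hcont : Continuous fun s : ℝ => z + s • d := by fun_prop
  have hsub : (fun s : ℝ => z + s • d) '' Ici 0 ⊆ connectedComponentIn Bᶜ z := by
    refine (isPreconnected_Ici.image _ hcont.continuousOn).subset_connectedComponentIn
      ⟨0, mem_Ici.2 le_rfl, by simp⟩ ?_
    rintro _ ⟨s, hs, rfl⟩
    exact h s hs
  obtain ⟨R, hR⟩ := isBounded_iff_forall_norm_le.1 (hb.subset hsub)
  have hd' : 0 < ‖d‖ := norm_pos_iff.2 hd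
  have hR0 : 0 ≤ R := (norm_nonneg _).trans (hR _ ⟨0, mem_Ici.2 le_rfl, rfl⟩)
  have hs : 0 ≤ (R + ‖z‖ + 1) / ‖d‖ := by positivity
  have h1 := hR _ ⟨_, hs, rfl⟩
  have h2 : ‖((R + ‖z‖ + 1) / ‖d‖) • d‖ = R + ‖z‖ + 1 := by
    rw [norm_smul, Real.norm_of_nonneg hs, div_mul_cancel₀ _ hd'.ne']
  have h3 := norm_sub_le (z + ((R + ‖z‖ + 1) / ‖d‖) • d) z
  rw [add_sub_cancel_left, h2] at h3
  simp only at h1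
  linarith

namespace IsPolyLoop

variable {n : ℕ} {w : ℕ → ℝ × ℝ}

theorem periodic_mul (h : IsPolyLoop n w) (k m : ℕ) : w (k + n * m) = w k := by
  induction m with
  | zero => simp
  | succ m ih => rw [Nat.mul_succ, ← add_assoc, h.periodic, ih]

theorem eq_of_mod_eq (h : IsPolyLoop n w) {i j : ℕ} (hij : i % n = j % n) : w i = w j := by
  rw [← Nat.mod_add_div i n, ← Nat.mod_add_div j n, h.periodic_mul, h.periodic_mul, hij]

theorem segment_eq_of_mod_eq (h : IsPolyLoop n w) {i j : ℕ} (hij : i % n = j % n) :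
    segment ℝ (w i) (w (i + 1)) = segment ℝ (w j) (w (j + 1)) := by
  rw [h.eq_of_mod_eq hij, h.eq_of_mod_eq (Nat.ModEq.add_right 1 hij)]

theorem loopBoundary_eq (h : IsPolyLoop n w) :
    loopBoundary w = ⋃ k ∈ Finset.range n, segment ℝ (w k) (w (k + 1)) := by
  have hn := h.three_le
  refine subset_antisymm (iUnion_subset fun k => ?_) (iUnion₂_subset fun k _ => ?_)
  · rw [h.segment_eq_of_mod_eq (Nat.mod_mod k n).symm]
    exact subset_biUnion_of_mem (u := fun k => segment ℝ (w k) (w (k + 1)))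
      (Finset.mem_coe.2 (Finset.mem_range.2 (Nat.mod_lt _ (by omega))))
  · exact subset_iUnion (fun k => segment ℝ (w k) (w (k + 1))) k

theorem isClosed_segment (p q : ℝ × ℝ) : IsClosed (segment ℝ p q) := by
  rw [segment_eq_image_lineMap]
  exact (isCompact_Icc.image AffineMap.lineMap_continuous).isClosed

theorem isClosed_loopBoundary (h : IsPolyLoop n w) : IsClosed (loopBoundary w) := by
  rw [h.loopBoundary_eq]
  exact isClosed_biUnion_finset fun k _ => isClosed_segment _ _

theorem isOpen_diff (h : IsPolyLoop n w) {K : Set (ℝ × ℝ)} (hK : IsOpen K) :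
    IsOpen (K \ loopBoundary w) := hK.sdiff h.isClosed_loopBoundary

theorem eventually_near (h : IsPolyLoop n w) (c : ℝ × ℝ) :
    ∀ᶠ z in 𝓝 c, z ∈ loopBoundary w →
      ∃ k, z ∈ segment ℝ (w k) (w (k + 1)) ∧ c ∈ segment ℝ (w k) (w (k + 1)) := by
  have key : ∀ k ∈ Finset.range n, ∀ᶠ z in 𝓝 c, z ∈ segment ℝ (w k) (w (k + 1)) →
      c ∈ segment ℝ (w k) (w (k + 1)) := by
    intro k _
    by_cases hc : c ∈ segment ℝ (w k) (w (k + 1))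
    · exact Filter.Eventually.of_forall fun _ _ => hc
    · filter_upwards [(isClosed_segment _ _).isOpen_compl.mem_nhds hc] with z hz hz'
      exact absurd hz' hz
  filter_upwards [(Filter.eventually_all_finset _).2 key] with z hz hzB
  rw [h.loopBoundary_eq] at hzB
  obtain ⟨k, hk, hzk⟩ := mem_iUnion₂.1 hzB
  exact ⟨k, hzk, hz k hk hzk⟩

theorem ne_succ (h : IsPolyLoop n w) (k : ℕ) : w k ≠ w (k + 1) := by
  have hn := h.three_le
  intro he
  have h1 : k + 0 ≡ k + 1 [MOD n] := h.injective _ _ he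
  have h2 := Nat.ModEq.add_left_cancel' k h1
  rw [Nat.ModEq, Nat.mod_eq_of_lt (by omega), Nat.mod_eq_of_lt (by omega)] at h2
  omega

theorem mem_segment_vertex (h : IsPolyLoop n w) {i k : ℕ}
    (hi : w (k + 1) ∈ segment ℝ (w i) (w (i + 1))) : i % n = k % n ∨ i % n = (k + 1) % n := by
  by_contra! hne
  by_cases h1 : k % n = (i + 1) % n
  · have h2 : w (k + 1) ∈ segment ℝ (w (i + 1)) (w (i + 2)) := by
      rw [← h.segment_eq_of_mod_eq h1]
      exact right_mem_segment _ _ _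
    have h3 : w (k + 1) ∈ ({w (i + 1)} : Set (ℝ × ℝ)) := by
      rw [← h.consecutive i]
      exact ⟨hi, h2⟩
    rw [mem_singleton_iff, ← h.eq_of_mod_eq h1] at h3
    exact h.ne_succ k h3.symm
  · exact disjoint_left.1 (h.nonconsecutive i k hne.1 h1 hne.2) hi (right_mem_segment _ _ _)

theorem mem_segment_of_openSegment (h : IsPolyLoop n w) {i k : ℕ} {b : ℝ × ℝ}
    (hb : b ∈ openSegment ℝ (w k) (w (k + 1))) (hi : b ∈ segment ℝ (w i) (w (i + 1))) :
    i % n = k % n := by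
  by_contra hne
  have hbk := openSegment_subset_segment _ _ _ hb
  have hl : b ≠ w k := by
    rintro rfl
    exact h.ne_succ k (left_mem_openSegment_iff.1 hb)
  have hr : b ≠ w (k + 1) := by
    rintro rfl
    exact h.ne_succ k (right_mem_openSegment_iff.1 hb)
  by_cases h1 : k % n = (i + 1) % n
  · have h3 : b ∈ ({w (i + 1)} : Set (ℝ × ℝ)) := by
      rw [← h.consecutive i, ← h.segment_eq_of_mod_eq h1]
      exact ⟨hi, hbk⟩
    rw [mem_singleton_iff, ← h.eq_of_mod_eq h1] at h3
    exact hl h3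
  by_cases h2 : i % n = (k + 1) % n
  · have h3 : b ∈ ({w (k + 1)} : Set (ℝ × ℝ)) := by
      rw [← h.consecutive k, ← h.segment_eq_of_mod_eq h2]
      exact ⟨hbk, hi⟩
    exact hr h3
  · exact disjoint_left.1 (h.nonconsecutive i k hne h1 h2) hi hbk

theorem eventually_edge (h : IsPolyLoop n w) {k : ℕ} {b : ℝ × ℝ}
    (hb : b ∈ openSegment ℝ (w k) (w (k + 1))) :
    ∀ᶠ z in 𝓝 b, z ∈ loopBoundary w → z ∈ segment ℝ (w k) (w (k + 1)) := by
  filter_upwards [h.eventually_near b] with z hz hzB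
  obtain ⟨i, h1, h2⟩ := hz hzB
  rwa [← h.segment_eq_of_mod_eq (h.mem_segment_of_openSegment hb h2)]

theorem eventually_vertex (h : IsPolyLoop n w) (k : ℕ) :
    ∀ᶠ z in 𝓝 (w (k + 1)), z ∈ loopBoundary w →
      z ∈ segment ℝ (w k) (w (k + 1)) ∪ segment ℝ (w (k + 1)) (w (k + 2)) := by
  filter_upwards [h.eventually_near (w (k + 1))] with z hz hzB
  obtain ⟨i, h1, h2⟩ := hz hzB
  rcases h.mem_segment_vertex h2 with h3 | h3
  · left; rwa [← h.segment_eq_of_mod_eq h3]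
  · right; rwa [h.segment_eq_of_mod_eq h3] at h1

theorem isOpenEdge (h : IsPolyLoop n w) {K : Set (ℝ × ℝ)} {k : ℕ}
    (hK : ∀ b ∈ openSegment ℝ (w k) (w (k + 1)), b ∈ K) :
    IsOpenEdge K (loopBoundary w) (w k) (w (k + 1)) where
  ne := h.ne_succ k
  mem := hK
  local_eq b hb := by
    filter_upwards [h.eventually_edge hb] with z hz hzB
    exact orient_segment_eq_zero (hz hzB)

theorem isChainCorner (h : IsPolyLoop n w) {K : Set (ℝ × ℝ)} {k : ℕ}
    (ht : orient (w k) (w (k + 1)) (w (k + 2)) ≠ 0) (hK : w (k + 1) ∈ K) :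
    IsChainCorner K (loopBoundary w) (w k) (w (k + 1)) (w (k + 2)) where
  turn := ht
  mem := hK
  local_sub := h.eventually_vertex k

end IsPolyLoop

/-! ## The turns of a funnel -/

theorem sector_congr {ε ε' : ℝ} (h : 0 < ε * ε') (p c q : ℝ × ℝ) :
    sector ε p c q = sector ε' p c q := by
  have key : ∀ r : ℝ, (0 < ε * r ↔ 0 < ε' * r) ∧ (ε * r < 0 ↔ ε' * r < 0) := by
    intro r
    rcases pos_and_pos_or_neg_and_neg_of_mul_pos h with ⟨h1, h2⟩ | ⟨h1, h2⟩
    · simp [h1, h2, mul_neg_iff, h1.not_gt, h2.not_gt]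
    · simp [h1, h2, mul_neg_iff, mul_pos_iff, h1.not_gt, h2.not_gt]
  ext z
  simp only [sector, mem_ofPred_eq, (key _).1, (key _).2]

/-- Near `b`, the points of the line `p q` are on the segment. -/
theorem eventually_mem_segment {p q b : ℝ × ℝ} (hpq : p ≠ q) (hb : b ∈ openSegment ℝ p q) :
    ∀ᶠ z in 𝓝 b, orient p q z = 0 → z ∈ segment ℝ p q := by
  have hd : 0 < (q.1 - p.1) ^ 2 + (q.2 - p.2) ^ 2 := by
    by_contra! hle
    have h1 : q.1 - p.1 = 0 := by nlinarith [sq_nonneg (q.1 - p.1), sq_nonneg (q.2 - p.2)]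
    have h2 : q.2 - p.2 = 0 := by nlinarith [sq_nonneg (q.1 - p.1), sq_nonneg (q.2 - p.2)]
    exact hpq (Prod.ext (by linarith) (by linarith))
  set D := (q.1 - p.1) ^ 2 + (q.2 - p.2) ^ 2 with hD
  -- The parameter of a point along the line, by orthogonal projection; strictly between `0` and `1`
  -- at `b`, hence near `b`.
  have hcont : Continuous fun z : ℝ × ℝ =>
      ((z.1 - p.1) * (q.1 - p.1) + (z.2 - p.2) * (q.2 - p.2)) / D := by fun_prop
  rw [openSegment_eq_image_lineMap] at hb
  obtain ⟨s, hs, rfl⟩ := hb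
  have hval : ((((AffineMap.lineMap p q s : ℝ × ℝ).1 - p.1) * (q.1 - p.1) +
      ((AffineMap.lineMap p q s : ℝ × ℝ).2 - p.2) * (q.2 - p.2)) / D) = s := by
    rw [div_eq_iff hd.ne', hD]
    simp only [AffineMap.lineMap_apply_module, Prod.fst_add, Prod.snd_add, Prod.smul_fst,
      Prod.smul_snd, smul_eq_mul]
    ring
  filter_upwards [hcont.continuousAt.eventually (Ioo_mem_nhds (hs.1.trans_eq hval.symm)
    (hval.trans_lt hs.2))] with z hz hz0
  rw [segment_eq_image_lineMap]
  refine ⟨_, ⟨hz.1.le, hz.2.le⟩, ?_⟩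
  have hne := hd.ne'
  simp only [orient] at hz0
  ext
  · simp only [AffineMap.lineMap_apply_module, Prod.fst_add, Prod.smul_fst, smul_eq_mul]
    field_simp
    rw [hD]
    linear_combination (q.2 - p.2) * hz0
  · simp only [AffineMap.lineMap_apply_module, Prod.snd_add, Prod.smul_snd, smul_eq_mul]
    field_simp
    rw [hD]
    linear_combination -(q.1 - p.1) * hz0

/-- Near `c`, the points of the ray from `c` through `p` are on the segment. -/
theorem eventually_mem_segment_corner {p c q : ℝ × ℝ} (h : orient p c q ≠ 0) :
    ∀ᶠ z in 𝓝 c, orient p c z = 0 → 0 ≤ orient c q z / orient p c q → z ∈ segment ℝ p c := by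
  -- On the line through `p` and `c` this quotient is the parameter from `c`, with value `0`, to
  -- `p`, with value `1`.
  have hcont : Continuous fun z => orient c q z / orient p c q :=
    (continuous_orient c q).div_const _
  have h0 : orient c q c / orient p c q < 1 := by rw [orient_self_left, zero_div]; exact one_pos
  filter_upwards [hcont.continuousAt.eventually (gt_mem_nhds h0)] with z hz hz0 hz1
  rw [segment_symm, segment_eq_image_lineMap]
  refine ⟨_, ⟨hz1, hz.le⟩, ?_⟩
  ext
  · simp only [AffineMap.lineMap_apply_module, Prod.fst_add, Prod.smul_fst, smul_eq_mul]
    field_simp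
    simp only [orient] at hz0 ⊢
    linear_combination (c.1 - q.1) * hz0
  · simp only [AffineMap.lineMap_apply_module, Prod.snd_add, Prod.smul_snd, smul_eq_mul]
    field_simp
    simp only [orient] at hz0 ⊢
    linear_combination (c.2 - q.2) * hz0

theorem frequently_sector {ε : ℝ} {p c q : ℝ × ℝ} (h : 0 < ε * orient p c q) :
    ∃ᶠ z in 𝓝 c, z ∈ sector ε p c q := by
  have hcont : Continuous fun s : ℝ => c + s • ((p - c) + (q - c)) := by fun_prop
  have ht : Filter.Tendsto (fun s : ℝ => c + s • ((p - c) + (q - c))) (𝓝[>] 0) (𝓝 c) := by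
    have := hcont.tendsto 0
    rw [zero_smul, add_zero] at this
    exact this.mono_left nhdsWithin_le_nhds
  refine ht.frequently (Filter.Eventually.frequently ?_)
  filter_upwards [self_mem_nhdsWithin] with s hs
  have hs : (0 : ℝ) < s := hs
  rw [sector_of_pos h]
  have e1 : ε * orient p c (c + s • ((p - c) + (q - c))) = s * (ε * orient p c q) := by
    simp [orient]; ring
  have e2 : ε * orient c q (c + s • ((p - c) + (q - c))) = s * (ε * orient p c q) := by
    simp [orient]; ring
  refine ⟨?_, ?_⟩
  · rw [mem_ofPred_eq, e1]; positivity
  · rw [mem_ofPred_eq, e2]; positivity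

/-- A loop all of whose corners are genuine, with sides: near the boundary, the side `g` of the
edges is not in the outer set and the other side is. -/
structure IsSidedLoop (n : ℕ) (w : ℕ → ℝ × ℝ) (g : ℝ) : Prop extends IsPolyLoop n w where
  ne_zero : g ≠ 0
  turn : ∀ k, orient (w k) (w (k + 1)) (w (k + 2)) ≠ 0
  inner : ∀ k, SectorIn g (outerSet (loopBoundary w))ᶜ (w k) (w (k + 1)) (w (k + 2))
  outer : ∀ k, SectorIn (-g) (outerSet (loopBoundary w)) (w k) (w (k + 1)) (w (k + 2))

section Turns

variable {n : ℕ} {w : ℕ → ℝ × ℝ} {ε : ℝ}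

theorem SectorIn.not_compl {K B G : Set (ℝ × ℝ)} {p c q : ℝ × ℝ} (hK : IsOpen K) (hε : ε ≠ 0)
    (hc : IsChainCorner K B p c q) (he : IsOpenEdge K B p c) (hG : Saturated (K \ B) G)
    (h : SectorIn ε G p c q) : ¬ SectorIn ε Gᶜ p c q := by
  intro h'
  obtain ⟨b, hb⟩ := openSegment_nonempty p c
  exact Side.not_compl hε he.ne (orient_segment_eq_zero (openSegment_subset_segment _ _ _ hb))
    (h.side_left hK hε hc he hG hb) (h'.side_left hK hε hc he hG.compl hb)

theorem IsPolyLoop.sectorIn_all (h : IsPolyLoop n w) (hε : ε ≠ 0) {G : Set (ℝ × ℝ)}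
    (hG : Saturated (univ \ loopBoundary w) G)
    (ht : ∀ k, orient (w k) (w (k + 1)) (w (k + 2)) ≠ 0) {k : ℕ}
    (hk : SectorIn ε G (w k) (w (k + 1)) (w (k + 2))) (j : ℕ) :
    SectorIn ε G (w j) (w (j + 1)) (w (j + 2)) := by
  have key : ∀ m, SectorIn ε G (w (k + m)) (w (k + m + 1)) (w (k + m + 2)) := by
    intro m
    induction m with
    | zero => exact hk
    | succ m ih =>
      have he := h.isOpenEdge (K := univ) (k := k + m + 1) (fun _ _ => mem_univ _)
      obtain ⟨b, hb⟩ := openSegment_nonempty (w (k + m + 1)) (w (k + m + 2))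
      exact (h.isChainCorner (K := univ) (ht (k + m + 1)) (mem_univ _)).sectorIn_of_side_left
        isOpen_univ hε he hG hb
        (ih.side_right isOpen_univ hε (h.isChainCorner (ht (k + m)) (mem_univ _)) he hG hb)
  have hn := h.three_le
  -- The walk from `k` reaches larger indices only, so `j` is first moved up by `k` periods.
  have h1 := key (j + n * k - k)
  have h2 : k ≤ n * k := Nat.le_mul_of_pos_left k (by omega)
  rw [show k + (j + n * k - k) = j + n * k by omega, add_right_comm _ _ 1, add_right_comm _ _ 2] at h1
  simpa only [h.periodic_mul] using h1

/-- A vertex at which a linear functional is maximal lies outward. -/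
theorem IsPolyLoop.sectorIn_of_max (h : IsPolyLoop n w) {d : ℝ × ℝ} (hd : d ≠ 0) {k : ℕ}
    (ht : orient (w k) (w (k + 1)) (w (k + 2)) ≠ 0)
    (hmax : ∀ j, d.1 * (w j).1 + d.2 * (w j).2 ≤ d.1 * (w (k + 1)).1 + d.2 * (w (k + 1)).2) :
    SectorIn (-orient (w k) (w (k + 1)) (w (k + 2))) (outerSet (loopBoundary w))
      (w k) (w (k + 1)) (w (k + 2)) := by
  set τ := orient (w k) (w (k + 1)) (w (k + 2)) with hτ
  refine ((h.isChainCorner (K := univ) ht (mem_univ _)).sectorIn_or isOpen_univ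
    (neg_ne_zero.2 ht) (saturated_outerSet _)).resolve_right fun hcon => ?_
  have hcont : Continuous fun s : ℝ => w (k + 1) + s • d := by fun_prop
  have hlim : Filter.Tendsto (fun s : ℝ => w (k + 1) + s • d) (𝓝[>] 0) (𝓝 (w (k + 1))) := by
    have := hcont.tendsto 0
    rw [zero_smul, add_zero] at this
    exact this.mono_left nhdsWithin_le_nhds
  have hd2 : 0 < d.1 ^ 2 + d.2 ^ 2 := by
    by_contra! hle
    exact hd (Prod.ext (by rw [Prod.fst_zero]; nlinarith [sq_nonneg d.1, sq_nonneg d.2])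
      (by rw [Prod.snd_zero]; nlinarith [sq_nonneg d.1, sq_nonneg d.2]))
  obtain ⟨s, hs1, hs2⟩ := ((hlim.eventually hcon).and self_mem_nhdsWithin).exists
  have hs : (0 : ℝ) < s := hs2
  refine hs1 ?_ ?_
  · rw [sector_of_neg (by rw [← hτ]; have := mul_self_pos.2 ht; linarith)]
    -- A direction in neither half plane is a nonnegative combination of the directions to the two
    -- neighbours, along which the functional does not increase; but it increases along `d`. The
    -- identity `key` is this combination.
    by_contra hno
    simp only [mem_union, mem_ofPred_eq, not_or, not_lt] at hno
    obtain ⟨h1, h2⟩ := hno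
    have h3 := hmax k
    have h4 := hmax (k + 2)
    have key : τ * (τ * (s * (d.1 ^ 2 + d.2 ^ 2))) =
        (τ * orient (w (k + 1)) (w (k + 2)) (w (k + 1) + s • d)) *
          ((d.1 * (w k).1 + d.2 * (w k).2) - (d.1 * (w (k + 1)).1 + d.2 * (w (k + 1)).2)) +
        (τ * orient (w k) (w (k + 1)) (w (k + 1) + s • d)) *
          ((d.1 * (w (k + 2)).1 + d.2 * (w (k + 2)).2) -
            (d.1 * (w (k + 1)).1 + d.2 * (w (k + 1)).2)) := by
      simp only [hτ, orient, Prod.fst_add, Prod.snd_add, Prod.smul_fst, Prod.smul_snd, smul_eq_mul]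
      ring
    have h5 : 0 < τ * (τ * (s * (d.1 ^ 2 + d.2 ^ 2))) := by
      rw [← mul_assoc]
      exact mul_pos (mul_self_pos.2 ht) (mul_pos hs hd2)
    nlinarith
  -- Along the ray the functional exceeds its maximum over the boundary.
  · refine mem_outerSet_of_ray hd fun r hr hmem => ?_
    obtain ⟨j, hj⟩ := mem_iUnion.1 hmem
    obtain ⟨a, b, ha, hb, hab, he⟩ := hj
    have e1 := congrArg Prod.fst he
    have e2 := congrArg Prod.snd he
    simp only [Prod.fst_add, Prod.snd_add, Prod.smul_fst, Prod.smul_snd, smul_eq_mul] at e1 e2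
    have h1 := mul_le_mul_of_nonneg_left (hmax j) ha
    have h2 := mul_le_mul_of_nonneg_left (hmax (j + 1)) hb
    have h3 : 0 < (s + r) * (d.1 ^ 2 + d.2 ^ 2) := by positivity
    have h4 : (a + b) * (d.1 * (w (k + 1)).1 + d.2 * (w (k + 1)).2) =
      d.1 * (w (k + 1)).1 + d.2 * (w (k + 1)).2 := by rw [hab, one_mul]
    have : (0 : ℝ) < 0 := by
      linear_combination h1 + h2 + h3 - d.1 * e1 - d.2 * e2 + h4
    exact this.false

theorem IsPolyLoop.exists_max (h : IsPolyLoop n w) (d : ℝ × ℝ) : ∃ k, k < n ∧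
    ∀ j, d.1 * (w j).1 + d.2 * (w j).2 ≤ d.1 * (w k).1 + d.2 * (w k).2 := by
  have hn := h.three_le
  obtain ⟨k, hk, hmax⟩ := Finset.exists_max_image (Finset.range n)
    (fun k => d.1 * (w k).1 + d.2 * (w k).2) ⟨0, Finset.mem_range.2 (by omega)⟩
  refine ⟨k, Finset.mem_range.1 hk, fun j => ?_⟩
  rw [h.eq_of_mod_eq (Nat.mod_mod j n).symm]
  exact hmax _ (Finset.mem_range.2 (Nat.mod_lt _ (by omega)))

/-- With a turn against `g`, the inner sector would be the one that `IsPolyLoop.sectorIn_of_max`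
places outside. -/
theorem IsPolyLoop.pos_of_max (h : IsPolyLoop n w) {g : ℝ} (hg : g ≠ 0) {d : ℝ × ℝ} (hd : d ≠ 0)
    {k : ℕ} (ht : orient (w k) (w (k + 1)) (w (k + 2)) ≠ 0)
    (hin : SectorIn g (outerSet (loopBoundary w))ᶜ (w k) (w (k + 1)) (w (k + 2)))
    (hmax : ∀ j, d.1 * (w j).1 + d.2 * (w j).2 ≤ d.1 * (w (k + 1)).1 + d.2 * (w (k + 1)).2) :
    0 < g * orient (w k) (w (k + 1)) (w (k + 2)) := by
  by_contra! hle
  have hlt : 0 < -orient (w k) (w (k + 1)) (w (k + 2)) * g := by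
    have := lt_of_le_of_ne hle (mul_ne_zero hg ht)
    linarith
  have h1 := h.sectorIn_of_max hd ht hmax
  rw [SectorIn, sector_congr hlt] at h1
  exact SectorIn.not_compl isOpen_univ hg (h.isChainCorner (K := univ) ht (mem_univ _))
    (h.isOpenEdge fun _ _ => mem_univ _) (saturated_outerSet _) h1 hin

/-- If the wedge at one corner is not in the outer set, then all sides of a loop are determined. -/
theorem IsPolyLoop.isSidedLoop (h : IsPolyLoop n w)
    (ht : ∀ k, orient (w k) (w (k + 1)) (w (k + 2)) ≠ 0) {k : ℕ} {g : ℝ}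
    (hg : g = orient (w k) (w (k + 1)) (w (k + 2)))
    (hin : SectorIn g (outerSet (loopBoundary w))ᶜ (w k) (w (k + 1)) (w (k + 2))) :
    IsSidedLoop n w g := by
  have hg0 : g ≠ 0 := hg ▸ ht k
  have hn := h.three_le
  have hinner := h.sectorIn_all hg0 (saturated_outerSet _).compl ht hin
  refine ⟨h, hg0, ht, hinner, ?_⟩
  -- One corner known to have its other side in the outer set is enough; an extreme vertex in an
  -- arbitrary direction provides it.
  obtain ⟨i, -, hmax⟩ := h.exists_max (1, 0)
  have hd : ((1, 0) : ℝ × ℝ) ≠ 0 := by simp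
  -- Corners are indexed by the vertex before them; adding a period makes sure that there is one.
  obtain ⟨j, hj⟩ : ∃ j, i + n = j + 1 := ⟨i + n - 1, by omega⟩
  rw [← h.periodic i, hj] at hmax
  have h1 := h.sectorIn_of_max hd (ht j) hmax
  have h2 := h.pos_of_max hg0 hd (ht j) (hinner j) hmax
  rw [SectorIn, sector_congr (show 0 < -orient (w j) (w (j + 1)) (w (j + 2)) * -g by linarith)] at h1
  exact h.sectorIn_all (neg_ne_zero.2 hg0) (saturated_outerSet _) ht h1

/-- The wedge at a reflex vertex lies outside; if the turn had the sign of `g`, it would be the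
inner sector. -/
theorem IsSidedLoop.neg_of_reflex {g : ℝ} (h : IsSidedLoop n w g) {k : ℕ}
    (hr : SectorIn (orient (w k) (w (k + 1)) (w (k + 2))) (outerSet (loopBoundary w))
      (w k) (w (k + 1)) (w (k + 2))) : g * orient (w k) (w (k + 1)) (w (k + 2)) < 0 := by
  by_contra! hle
  have hlt : 0 < orient (w k) (w (k + 1)) (w (k + 2)) * g := by
    have := lt_of_le_of_ne hle (mul_ne_zero h.ne_zero (h.turn k)).symm
    linarith
  rw [SectorIn, sector_congr hlt] at hr
  exact SectorIn.not_compl isOpen_univ h.ne_zero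
    (h.isChainCorner (K := univ) (h.turn k) (mem_univ _))
    (h.isOpenEdge fun _ _ => mem_univ _) (saturated_outerSet _) hr (h.inner k)

theorem IsSidedLoop.pos_of_max {g : ℝ} (h : IsSidedLoop n w g) {d : ℝ × ℝ} (hd : d ≠ 0) {k : ℕ}
    (hmax : ∀ j, d.1 * (w j).1 + d.2 * (w j).2 ≤ d.1 * (w (k + 1)).1 + d.2 * (w (k + 1)).2) :
    0 < g * orient (w k) (w (k + 1)) (w (k + 2)) :=
  h.toIsPolyLoop.pos_of_max h.ne_zero hd (h.turn k) (h.inner k) hmax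

end Turns

/-! ## The chains of a funnel are convex -/

/-- The cyclic sequence of vertices of a funnel, with apex `w t`; `g` gives the orientation. -/
structure IsFunnelLoop (n t : ℕ) (w : ℕ → ℝ × ℝ) (g : ℝ) : Prop extends IsSidedLoop n w g where
  t_pos : 0 < t
  t_lt : t + 1 < n
  reflex : ∀ k, k + 1 ≠ t → k + 2 < n → g * orient (w k) (w (k + 1)) (w (k + 2)) < 0
  corner : 0 < g * orient (w (n - 1)) (w 0) (w 1)

/-- Near `c` the sector is connected, so it lies in a single component: the one to which the
convexity argument is applied. -/
theorem exists_sectorIn_component {W O : Set (ℝ × ℝ)} {ε : ℝ} {p c q : ℝ × ℝ}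
    (h : 0 < ε * orient p c q) (hW : SectorIn ε W p c q) (hO : SectorIn ε O p c q) :
    ∃ z, z ∈ W ∧ z ∈ O ∧ SectorIn ε (connectedComponentIn W z) p c q := by
  obtain ⟨r, hr, hball⟩ := Metric.eventually_nhds_iff_ball.1 (hW.and hO)
  obtain ⟨z, hz, hzr⟩ := ((frequently_sector h).and_eventually (Metric.ball_mem_nhds c hr)).exists
  refine ⟨z, (hball z hzr).1 hz, (hball z hzr).2 hz, ?_⟩
  filter_upwards [Metric.ball_mem_nhds c hr] with y hy hys
  exact (isPreconnected_sector_inter_ball h.ne' hr).subset_connectedComponentIn ⟨hz, hzr⟩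
    (fun x hx => (hball x hx.2).1 hx.1) ⟨hys, hy⟩

theorem continuous_mul_orient (g : ℝ) (p q : ℝ × ℝ) : Continuous fun z => g * orient p q z :=
  continuous_const.mul (continuous_orient p q)

namespace IsFunnelLoop

variable {n t : ℕ} {w : ℕ → ℝ × ℝ} {g : ℝ}

theorem w_n (h : IsFunnelLoop n t w g) : w n = w 0 := by
  have := h.periodic 0
  rwa [zero_add] at this

theorem not_max_of_reflex (h : IsFunnelLoop n t w g) {d : ℝ × ℝ} (hd : d ≠ 0) {r : ℕ} (h0 : 0 < r)
    (hr : r ≠ t) (hrn : r + 1 < n)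
    (hmax : ∀ j, d.1 * (w j).1 + d.2 * (w j).2 ≤ d.1 * (w r).1 + d.2 * (w r).2) : False := by
  obtain ⟨k, rfl⟩ : ∃ k, r = k + 1 := ⟨r - 1, by omega⟩
  exact (h.reflex k hr hrn).not_gt (h.pos_of_max hd hmax)

/-- The maximum of a linear functional over the vertices is attained at a convex vertex, and at no
reflex one. -/
theorem orient_lt_of_reflex (h : IsFunnelLoop n t w g) {κ c : ℝ} {P Q : ℝ × ℝ} (hκ : κ ≠ 0)
    (hPQ : P ≠ Q) (h1 : κ * orient P Q (w 0) ≤ c) (h2 : κ * orient P Q (w t) ≤ c)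
    (h3 : κ * orient P Q (w (n - 1)) ≤ c) {r : ℕ} (h0 : 0 < r)
    (hr : r ≠ t) (hrn : r + 1 < n) : κ * orient P Q (w r) < c := by
  -- The gradient of `κ * orient P Q`.
  set d : ℝ × ℝ := (-(κ * (Q.2 - P.2)), κ * (Q.1 - P.1)) with hd
  have hd0 : d ≠ 0 := by
    intro he
    rw [hd, Prod.mk_eq_zero, neg_eq_zero, mul_eq_zero, mul_eq_zero] at he
    exact hPQ (Prod.ext (by linarith [he.2.resolve_left hκ]) (by linarith [he.1.resolve_left hκ]))
  have key : ∀ z : ℝ × ℝ, d.1 * z.1 + d.2 * z.2 =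
      κ * orient P Q z + κ * ((Q.1 - P.1) * P.2 - (Q.2 - P.2) * P.1) := by
    intro z
    simp only [hd, orient]
    ring
  obtain ⟨k, hk, hmax⟩ := h.exists_max d
  have hle : κ * orient P Q (w k) ≤ c := by
    by_cases hk0 : k = 0
    · rwa [hk0]
    by_cases hkt : k = t
    · rwa [hkt]
    by_cases hkn : k + 1 = n
    · rwa [show k = n - 1 by omega]
    exact (h.not_max_of_reflex hd0 (by omega) hkt (by omega) hmax).elim
  by_contra! hge
  refine h.not_max_of_reflex hd0 h0 hr hrn fun j => (hmax j).trans ?_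
  rw [key, key]
  linarith

/-! ### Heights over the base -/

/-- The height over the base, up to a positive factor. -/
def height (n : ℕ) (w : ℕ → ℝ × ℝ) (g : ℝ) (z : ℝ × ℝ) : ℝ := g * orient (w (n - 1)) (w 0) z

theorem height_zero : height n w g (w 0) = 0 := by
  rw [height, orient_self_right, mul_zero]

theorem height_last : height n w g (w (n - 1)) = 0 := by
  rw [height, orient_self_left, mul_zero]

theorem w_last_ne (h : IsFunnelLoop n t w g) : w (n - 1) ≠ w 0 := by
  have := h.t_lt
  have h1 := h.ne_succ (n - 1)
  rwa [Nat.sub_add_cancel (by omega), h.w_n] at h1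

/-- Otherwise no convex vertex is above the base, so all reflex vertices, among them `w 1`, are
strictly below it, against the turn at `w 0`. If `w 1` is the apex, that turn is the claim itself.
-/
theorem height_apex_pos (h : IsFunnelLoop n t w g) : 0 < height n w g (w t) := by
  have h1 := h.t_lt
  by_cases ht : t = 1
  · rw [ht]; exact h.corner
  · by_contra! hle
    exact (h.orient_lt_of_reflex h.ne_zero h.w_last_ne height_zero.le hle height_last.le one_pos
      (Ne.symm ht) (by have := h.t_pos; omega)).not_gt h.corner

theorem height_pos (h : IsFunnelLoop n t w g) {r : ℕ} (h0 : 0 < r) (hrn : r + 1 < n) :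
    0 < height n w g (w r) := by
  by_cases hr : r = t
  · rw [hr]; exact h.height_apex_pos
  have h1 := h.height_apex_pos
  have h2 := height_zero (n := n) (w := w) (g := g)
  have h3 := height_last (n := n) (w := w) (g := g)
  have := h.orient_lt_of_reflex (neg_ne_zero.2 h.ne_zero) h.w_last_ne (c := 0)
    (by rw [height] at h2; linarith) (by rw [height] at h1; linarith)
    (by rw [height] at h3; linarith) h0 hr hrn
  rw [height]
  linarith

theorem height_lt_apex (h : IsFunnelLoop n t w g) {r : ℕ} (hr : r ≠ t) (hrn : r < n) :
    height n w g (w r) < height n w g (w t) := by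
  by_cases h0 : r = 0
  · rw [h0, height_zero]; exact h.height_apex_pos
  by_cases hn : r = n - 1
  · rw [hn, height_last]; exact h.height_apex_pos
  exact h.orient_lt_of_reflex h.ne_zero h.w_last_ne (height_zero.le.trans h.height_apex_pos.le)
    le_rfl (height_last.le.trans h.height_apex_pos.le) (by omega) hr (by omega)

/-! ### The exterior inside the triangle of the convex vertices -/

/-- The open triangle spanned by the convex vertices. -/
def openHull (n t : ℕ) (w : ℕ → ℝ × ℝ) (g : ℝ) : Set (ℝ × ℝ) :=
  {z | 0 < g * orient (w (n - 1)) (w 0) z} ∩ {z | 0 < g * orient (w 0) (w t) z} ∩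
    {z | 0 < g * orient (w t) (w (n - 1)) z}

theorem convex_openHull : Convex ℝ (openHull n t w g) :=
  ((convex_orient_pos _ _ _).inter (convex_orient_pos _ _ _)).inter (convex_orient_pos _ _ _)

theorem isOpen_openHull : IsOpen (openHull n t w g) :=
  ((isOpen_lt continuous_const (continuous_mul_orient _ _ _)).inter
    (isOpen_lt continuous_const (continuous_mul_orient _ _ _))).inter
    (isOpen_lt continuous_const (continuous_mul_orient _ _ _))

theorem apex_orient (h : IsFunnelLoop n t w g) : 0 < g * orient (w 0) (w t) (w (n - 1)) := by
  have := h.height_apex_pos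
  rwa [height, ← orient_rotate] at this

theorem apex_orient' (h : IsFunnelLoop n t w g) : 0 < g * orient (w t) (w (n - 1)) (w 0) := by
  have := h.apex_orient
  rwa [← orient_rotate] at this

theorem w_zero_ne_apex (h : IsFunnelLoop n t w g) : w 0 ≠ w t := by
  intro he
  have := h.height_apex_pos
  rw [← he, height_zero] at this
  exact this.false

theorem w_apex_ne_last (h : IsFunnelLoop n t w g) : w t ≠ w (n - 1) := by
  intro he
  have := h.height_apex_pos
  rw [he, height_last] at this
  exact this.false

theorem mem_openHull (h : IsFunnelLoop n t w g) {r : ℕ} (h0 : 0 < r) (hr : r ≠ t)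
    (hrn : r + 1 < n) : w r ∈ openHull n t w g := by
  have h1 := h.apex_orient
  have h2 := h.apex_orient'
  refine ⟨⟨h.height_pos h0 hrn, ?_⟩, ?_⟩
  · have := h.orient_lt_of_reflex (neg_ne_zero.2 h.ne_zero) h.w_zero_ne_apex (c := 0)
      (by rw [orient_self_left, mul_zero]) (by rw [orient_self_right, mul_zero]) (by linarith)
      h0 hr hrn
    rw [mem_ofPred_eq]; linarith
  · have := h.orient_lt_of_reflex (neg_ne_zero.2 h.ne_zero) h.w_apex_ne_last (c := 0)
      (by linarith) (by rw [orient_self_left, mul_zero]) (by rw [orient_self_right, mul_zero])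
      h0 hr hrn
    rw [mem_ofPred_eq]; linarith

theorem nonneg_openHull (h : IsFunnelLoop n t w g) {r : ℕ} (hrn : r < n) :
    0 ≤ g * orient (w (n - 1)) (w 0) (w r) ∧ 0 ≤ g * orient (w 0) (w t) (w r) ∧
      0 ≤ g * orient (w t) (w (n - 1)) (w r) := by
  by_cases h0 : r = 0
  · subst h0
    simp only [orient_self_left, orient_self_right, mul_zero, le_refl, true_and]
    exact h.apex_orient'.le
  by_cases ht : r = t
  · subst ht
    simp only [orient_self_left, orient_self_right, mul_zero, le_refl, and_true]
    exact h.height_apex_pos.le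
  by_cases hn : r = n - 1
  · subst hn
    simp only [orient_self_left, orient_self_right, mul_zero, le_refl, true_and, and_true]
    exact h.apex_orient.le
  have := h.mem_openHull (r := r) (by omega) ht (by omega)
  exact ⟨this.1.1.le, this.1.2.le, this.2.le⟩

theorem orient_pos_of_openSegment {P Q p q b : ℝ × ℝ} (hb : b ∈ openSegment ℝ p q)
    (hp : 0 ≤ g * orient P Q p) (hq : 0 ≤ g * orient P Q q)
    (hpq : 0 < g * orient P Q p ∨ 0 < g * orient P Q q) : 0 < g * orient P Q b := by
  obtain ⟨s, u, hs, hu, hsu, rfl⟩ := hb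
  rw [orient_combo _ _ _ _ hsu, mul_add, mul_left_comm, mul_left_comm g]
  rcases hpq with h | h
  · have := mul_pos hs h; have := mul_nonneg hu.le hq; linarith
  · have := mul_nonneg hs.le hp; have := mul_pos hu h; linarith

/-- One end in the open triangle is enough, the other one being in the closed triangle. -/
theorem openSegment_subset_openHull (h : IsFunnelLoop n t w g) {k : ℕ} (hk : k + 1 < n)
    (hr : 0 < k ∧ k ≠ t ∨ k + 2 < n ∧ k + 1 ≠ t) {b : ℝ × ℝ}
    (hb : b ∈ openSegment ℝ (w k) (w (k + 1))) : b ∈ openHull n t w g := by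
  obtain ⟨a1, a2, a3⟩ := h.nonneg_openHull (r := k) (by omega)
  obtain ⟨b1, b2, b3⟩ := h.nonneg_openHull (r := k + 1) hk
  rcases hr with hr | hr
  · have := h.mem_openHull hr.1 hr.2 hk
    exact ⟨⟨orient_pos_of_openSegment hb a1 b1 (Or.inl this.1.1),
      orient_pos_of_openSegment hb a2 b2 (Or.inl this.1.2)⟩,
      orient_pos_of_openSegment hb a3 b3 (Or.inl this.2)⟩
  · have := h.mem_openHull (Nat.succ_pos k) hr.2 hr.1
    exact ⟨⟨orient_pos_of_openSegment hb a1 b1 (Or.inr this.1.1),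
      orient_pos_of_openSegment hb a2 b2 (Or.inr this.1.2)⟩,
      orient_pos_of_openSegment hb a3 b3 (Or.inr this.2)⟩

/-- The components of the outer set inside the open hull are locally convex. -/
theorem locally_convex (h : IsFunnelLoop n t w g) {V : Set (ℝ × ℝ)}
    (hsat : Saturated (openHull n t w g \ loopBoundary w) V)
    (hVW : V ⊆ openHull n t w g \ loopBoundary w) (hVO : V ⊆ outerSet (loopBoundary w))
    {b : ℝ × ℝ} (hbK : b ∈ openHull n t w g) (hb : b ∈ closure V) (hbV : b ∉ V) :
    ∃ S : Set (ℝ × ℝ), Convex ℝ S ∧ ∀ᶠ z in 𝓝 b, (z ∈ V ↔ z ∈ S) := by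
  have hn := h.three_le
  have hg := h.ne_zero
  have hKo := isOpen_openHull (n := n) (t := t) (w := w) (g := g)
  have hfr : ∃ᶠ z in 𝓝 b, z ∈ V := mem_closure_iff_frequently.1 hb
  -- Off the boundary, a ball around `b` would belong to `V`.
  have hbB : b ∈ loopBoundary w := by
    by_contra hbB
    have hopen := h.isOpen_diff hKo
    obtain ⟨r, hr, hball⟩ := Metric.isOpen_iff.1 hopen b ⟨hbK, hbB⟩
    obtain ⟨z, hzV, hzr⟩ := (hfr.and_eventually (Metric.ball_mem_nhds b hr)).exists
    exact hbV (hsat _ (convex_ball b r).isPreconnected hball ⟨z, hzr, hzV⟩ (Metric.mem_ball_self hr))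
  rw [h.loopBoundary_eq] at hbB
  obtain ⟨k, hk, hbk⟩ := mem_iUnion₂.1 hbB
  rw [Finset.mem_range] at hk
  have hkn : k + 1 < n := by
    by_contra! hge
    obtain rfl : k = n - 1 := by omega
    rw [Nat.sub_add_cancel (by omega), h.w_n] at hbk
    have := hbK.1.1
    rw [mem_ofPred_eq, orient_segment_eq_zero hbk, mul_zero] at this
    exact this.false
  -- The three convex vertices are not in the open triangle, so `b` can only be a reflex vertex.
  have hvertex : ∀ r, r < n → b = w r → ∃ i, r = i + 1 ∧ i + 1 ≠ t ∧ i + 2 < n := by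
    rintro r hr rfl
    have hr0 : r ≠ 0 := by
      rintro rfl
      have := hbK.1.2
      rw [mem_ofPred_eq, orient_self_left, mul_zero] at this
      exact this.false
    have hrt : r ≠ t := by
      rintro rfl
      have := hbK.1.2
      rw [mem_ofPred_eq, orient_self_right, mul_zero] at this
      exact this.false
    have hrn : r ≠ n - 1 := by
      rintro rfl
      have := hbK.1.1
      rw [mem_ofPred_eq, orient_self_left, mul_zero] at this
      exact this.false
    exact ⟨r - 1, by omega, by omega, by omega⟩
  by_cases hends : b = w k ∨ b = w (k + 1)
  · obtain ⟨i, rfl, hit, hin⟩ : ∃ i, b = w (i + 1) ∧ i + 1 ≠ t ∧ i + 2 < n := by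
      rcases hends with hb | hb
      · obtain ⟨i, rfl, h1, h2⟩ := hvertex k hk hb
        exact ⟨i, hb, h1, h2⟩
      · obtain ⟨i, h0, h1, h2⟩ := hvertex (k + 1) hkn hb
        exact ⟨i, h0 ▸ hb, h1, h2⟩
    have hτ := h.reflex i hit hin
    have hτ' : 0 < -g * orient (w i) (w (i + 1)) (w (i + 2)) := by linarith
    refine ⟨sector (-g) (w i) (w (i + 1)) (w (i + 2)), convex_sector hτ', ?_⟩
    have hcorner := h.isChainCorner (h.turn i) hbK
    have hrot : orient (w (i + 2)) (w (i + 1)) (w i) = -orient (w i) (w (i + 1)) (w (i + 2)) := by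
      simp only [orient]; ring
    -- Points of `V` are not in the inner sector, and off the two edges only the outer sector
    -- remains; it is convex since the vertex is reflex.
    have hin : ∀ᶠ z in 𝓝 (w (i + 1)), z ∈ V →
        z ∈ sector (-g) (w i) (w (i + 1)) (w (i + 2)) := by
      filter_upwards [h.inner i, eventually_mem_segment_corner (h.turn i),
        eventually_mem_segment_corner (p := w (i + 2)) (c := w (i + 1)) (q := w i)
          (by rw [hrot]; exact neg_ne_zero.2 (h.turn i))] with z h1 h2 h3 hzV
      have h4 : z ∉ sector g (w i) (w (i + 1)) (w (i + 2)) := fun h4 => h1 h4 (hVO hzV)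
      rw [sector_of_neg hτ] at h4
      simp only [mem_union, mem_ofPred_eq, not_or, not_lt] at h4
      have hzB := (hVW hzV).2
      have hg2 : 0 < g ^ 2 := by positivity
      have hdiv : ∀ x : ℝ, g * x ≤ 0 → 0 ≤ x / orient (w i) (w (i + 1)) (w (i + 2)) := by
        intro x hx
        rw [← mul_div_mul_left _ _ hg]
        exact div_nonneg_of_nonpos hx hτ.le
      rw [sector_of_pos hτ']
      constructor
      · rw [mem_ofPred_eq]
        refine lt_of_le_of_ne (by linarith) fun h5 => hzB ?_
        have h6 : orient (w i) (w (i + 1)) z = 0 := by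
          rcases mul_eq_zero.1 h5.symm with h6 | h6
          · exact absurd h6 (neg_ne_zero.2 hg)
          · exact h6
        exact mem_iUnion.2 ⟨i, h2 h6 (hdiv _ h4.2)⟩
      · rw [mem_ofPred_eq]
        refine lt_of_le_of_ne (by linarith) fun h5 => hzB ?_
        have h6 : orient (w (i + 1)) (w (i + 2)) z = 0 := by
          rcases mul_eq_zero.1 h5.symm with h6 | h6
          · exact absurd h6 (neg_ne_zero.2 hg)
          · exact h6
        refine mem_iUnion.2 ⟨i + 1, ?_⟩
        rw [segment_symm]
        refine h3 (by rw [orient_swap, h6, neg_zero]) ?_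
        rw [hrot, orient_swap, neg_div_neg_eq]
        exact hdiv _ h4.1
    -- Near the vertex the outer sector is contained in `V` or misses it; the latter is impossible
    -- as `b` is in the closure of `V`.
    rcases hcorner.sectorIn_or hKo (neg_ne_zero.2 hg) hsat with hs | hs
    · filter_upwards [hin, hs] with z h1 h2
      exact ⟨h1, h2⟩
    · obtain ⟨z, hzV, h1, h2⟩ := (hfr.and_eventually (hin.and hs)).exists
      exact absurd hzV (h2 (h1 hzV))
  · push Not at hends
    have hbo : b ∈ openSegment ℝ (w k) (w (k + 1)) :=
      mem_openSegment_of_ne_left_right hends.1.symm hends.2.symm hbk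
    refine ⟨_, convex_orient_pos (-g) (w k) (w (k + 1)), ?_⟩
    have hside : Side g (outerSet (loopBoundary w))ᶜ (w k) (w (k + 1)) b :=
      (h.inner k).side_left isOpen_univ hg (h.isChainCorner (h.turn k) (mem_univ _))
        (h.isOpenEdge fun _ _ => mem_univ _) (saturated_outerSet _).compl hbo
    have hin : ∀ᶠ z in 𝓝 b, z ∈ V → 0 < -g * orient (w k) (w (k + 1)) z := by
      filter_upwards [hside, eventually_mem_segment (h.ne_succ k) hbo] with z h1 h2 hzV
      have h3 : ¬ 0 < g * orient (w k) (w (k + 1)) z := fun h3 => h1 h3 (hVO hzV)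
      refine lt_of_le_of_ne (by linarith) fun h5 => (hVW hzV).2 ?_
      rcases mul_eq_zero.1 h5.symm with h6 | h6
      · exact absurd h6 (neg_ne_zero.2 hg)
      · exact mem_iUnion.2 ⟨k, h2 h6⟩
    rcases hsat.dichotomy (S := {z | 0 < -g * orient (w k) (w (k + 1)) z}) (c := b)
      (fun r _ => ((convex_orient_pos _ _ _).inter (convex_ball b r)).isPreconnected) (by
        filter_upwards [h.eventually_edge hbo, hKo.mem_nhds hbK] with z h1 h2 h3
        refine ⟨h2, fun h4 => ?_⟩
        rw [orient_segment_eq_zero (h1 h4), mul_zero] at h3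
        exact h3.false) with hs | hs
    · filter_upwards [hin, hs] with z h1 h2
      exact ⟨h1, h2⟩
    · obtain ⟨z, hzV, h1, h2⟩ := (hfr.and_eventually (hin.and hs)).exists
      exact absurd hzV (h2 (h1 hzV))

/-- A reflex chain lies behind the lines through its edges. -/
theorem chain_nonpos (h : IsFunnelLoop n t w g) {a c : ℕ} (hcn : c < n)
    (hac : ∀ k, a < k → k < c → k ≠ t) {k j : ℕ} (hak : a ≤ k) (hkc : k < c) (haj : a ≤ j)
    (hjc : j ≤ c) : g * orient (w k) (w (k + 1)) (w j) ≤ 0 := by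
  have hg := h.ne_zero
  have hg' : -g ≠ 0 := neg_ne_zero.2 hg
  -- A single edge has no corner at which the component below could start.
  by_cases hc : c = a + 1
  · obtain rfl : k = a := by omega
    rcases (show j = k ∨ j = k + 1 by omega) with rfl | rfl
    · rw [orient_self_left, mul_zero]
    · rw [orient_self_right, mul_zero]
  have hKo := isOpen_openHull (n := n) (t := t) (w := w) (g := g)
  have hmemK : ∀ i, a ≤ i → i + 1 < c → w (i + 1) ∈ openHull n t w g :=
    fun i h1 h2 => h.mem_openHull (Nat.succ_pos i) (hac _ (by omega) h2) (by omega)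
  have hedge : ∀ i, a ≤ i → i < c → IsOpenEdge (openHull n t w g) (loopBoundary w)
      (w i) (w (i + 1)) := by
    intro i h1 h2
    refine h.isOpenEdge fun b hb => h.openSegment_subset_openHull (by omega) ?_ hb
    by_cases hi : i + 1 = c
    · exact Or.inl ⟨by omega, hac i (by omega) (by omega)⟩
    · exact Or.inr ⟨by omega, hac (i + 1) (by omega) (by omega)⟩
  have hcorner : ∀ i, a ≤ i → i + 1 < c → IsChainCorner (openHull n t w g) (loopBoundary w)
      (w i) (w (i + 1)) (w (i + 2)) :=
    fun i h1 h2 => h.isChainCorner (h.turn i) (hmemK i h1 h2)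
  have ha := h.reflex a (hac _ (by omega) (by omega)) (by omega)
  obtain ⟨z₀, hz₀, hz₀', hz₀V⟩ := exists_sectorIn_component (ε := -g)
    (W := openHull n t w g \ loopBoundary w) (by linarith) (by
      filter_upwards [h.outer a, hKo.mem_nhds (hmemK a le_rfl (by omega))] with z h1 h2 h3
      exact ⟨h2, (h1 h3).1⟩) (h.outer a)
  -- The part of the exterior within the open triangle that touches the chain at its first corner.
  set V := connectedComponentIn (openHull n t w g \ loopBoundary w) z₀ with hVdef
  have hsat : Saturated (openHull n t w g \ loopBoundary w) V :=
    saturated_connectedComponentIn _ _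
  have hVW : V ⊆ openHull n t w g \ loopBoundary w := connectedComponentIn_subset _ _
  have hVo : IsOpen V := (h.isOpen_diff hKo).connectedComponentIn
  have hVp : IsPreconnected V := isPreconnected_connectedComponentIn
  have hVO : V ⊆ outerSet (loopBoundary w) :=
    saturated_outerSet _ V hVp (fun z hz => ⟨mem_univ _, (hVW hz).2⟩)
      ⟨z₀, mem_connectedComponentIn hz₀, hz₀'⟩
  have hconv : Convex ℝ V := convex_of_locally_convex convex_openHull hVo hVp
    (fun z hz => (hVW hz).1) fun b hbK hb hbV => h.locally_convex hsat hVW hVO hbK hb hbV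
  -- From edge to corner and on, the same component touches the whole chain.
  have hsec : ∀ i, a ≤ i → i + 1 < c → SectorIn (-g) V (w i) (w (i + 1)) (w (i + 2)) := by
    intro i hi
    induction i, hi using Nat.le_induction with
    | base => exact fun _ => hz₀V
    | succ i hi ih =>
      intro hic
      obtain ⟨b, hb⟩ := openSegment_nonempty (w (i + 1)) (w (i + 2))
      exact (hcorner (i + 1) (by omega) hic).sectorIn_of_side_left hKo hg'
        (hedge (i + 1) (by omega) (by omega)) hsat hb
        ((ih (by omega)).side_right hKo hg' (hcorner i hi (by omega))
          (hedge (i + 1) (by omega) (by omega)) hsat hb)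
  have hside : ∀ i, a ≤ i → i < c → ∀ b ∈ openSegment ℝ (w i) (w (i + 1)),
      Side (-g) V (w i) (w (i + 1)) b := by
    intro i h1 h2 b hb
    by_cases hi : i + 1 < c
    · exact (hsec i h1 hi).side_left hKo hg' (hcorner i h1 hi) (hedge i h1 h2) hsat hb
    · obtain ⟨l, rfl⟩ : ∃ l, i = l + 1 := ⟨i - 1, by omega⟩
      exact (hsec l (by omega) h2).side_right hKo hg' (hcorner l (by omega) h2)
        (hedge (l + 1) h1 h2) hsat hb
  -- If `z` in `V` were on the positive side, continue the segment from `z` through a point `b` of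
  -- the edge slightly beyond `b`: the end point is in `V`, so by convexity `b` is, although it is
  -- on the boundary.
  have hVneg : ∀ z ∈ V, g * orient (w k) (w (k + 1)) z ≤ 0 := by
    intro z hz
    by_contra! hpos
    obtain ⟨b, hb⟩ := openSegment_nonempty (w k) (w (k + 1))
    have hb0 := orient_segment_eq_zero (openSegment_subset_segment ℝ _ _ hb)
    have hlim : Filter.Tendsto (fun s : ℝ => AffineMap.lineMap b z (-s)) (𝓝[>] 0) (𝓝 b) := by
      have hcont : Continuous fun s : ℝ => (AffineMap.lineMap b z (-s) : ℝ × ℝ) :=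
        AffineMap.lineMap_continuous.comp continuous_neg
      have := hcont.tendsto 0
      rw [neg_zero, AffineMap.lineMap_apply_zero] at this
      exact this.mono_left nhdsWithin_le_nhds
    obtain ⟨s, hs1, hs2⟩ :=
      ((hlim.eventually (hside k hak hkc b hb)).and self_mem_nhdsWithin).exists
    have hs2 : (0 : ℝ) < s := hs2
    have hs3 := hs1 (by
      rw [orient_lineMap, hb0]
      have := mul_pos hs2 hpos
      linarith)
    have hbV : b ∈ V := by
      refine hconv.segment_subset hs3 hz ⟨1 / (1 + s), s / (1 + s), by positivity, by positivity,
        by field_simp, ?_⟩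
      ext <;>
      · simp only [AffineMap.lineMap_apply_module, Prod.fst_add, Prod.snd_add, Prod.smul_fst,
          Prod.smul_snd, smul_eq_mul]
        field_simp
        ring
    exact (hVW hbV).2 (mem_iUnion.2 ⟨k, openSegment_subset_segment ℝ _ _ hb⟩)
  have hclos : ∀ z ∈ closure V, g * orient (w k) (w (k + 1)) z ≤ 0 := by
    intro z hz
    exact closure_minimal hVneg (isClosed_le (continuous_mul_orient _ _ _) continuous_const) hz
  apply hclos
  have hseg : ∀ i, a ≤ i → i < c → segment ℝ (w i) (w (i + 1)) ⊆ closure V := by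
    intro i h1 h2
    rw [← closure_openSegment]
    refine closure_minimal (fun b hb => ?_) isClosed_closure
    rw [mem_closure_iff_frequently]
    have hb0 := orient_segment_eq_zero (openSegment_subset_segment ℝ _ _ hb)
    exact ((frequently_orient_pos hg' (h.ne_succ i) hb0).and_eventually (hside i h1 h2 b hb)).mono
      fun z hz => hz.2 hz.1
  by_cases hj : j = c
  · obtain ⟨l, rfl⟩ : ∃ l, j = l + 1 := ⟨j - 1, by omega⟩
    exact hseg l (by omega) (by omega) (right_mem_segment _ _ _)
  · exact hseg j haj (by omega) (left_mem_segment _ _ _)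

/-- Cramer's rule for `x - c` in terms of `c - p` and `q - c`, under the functional `orient P Q`.
With the apex as `x`, it excludes turning points of the height inside a chain. -/
theorem height_identity (p c q x P Q : ℝ × ℝ) :
    orient p c q * (orient P Q x - orient P Q c) =
      -orient c q x * (orient P Q c - orient P Q p) +
        orient p c x * (orient P Q q - orient P Q c) := by
  simp only [orient]
  ring

/-- The first chain rises. -/
theorem height_lt_succ (h : IsFunnelLoop n t w g) {k : ℕ} (hk : k < t) :
    height n w g (w k) < height n w g (w (k + 1)) := by
  have htn := h.t_lt
  induction k with
  | zero => rw [height_zero]; exact h.height_pos (by omega) (by omega)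
  | succ k ih =>
    -- Suppose that the chain rises to `w (k + 1)` but not beyond. The apex is higher than this
    -- vertex and behind both edges there, so in the identity the left side is negative and the
    -- right side is not.
    by_contra! hle
    have h1 := ih (by omega)
    have h2 := h.reflex k (by omega) (by omega)
    have h3 := h.chain_nonpos (a := 0) (c := t) (k := k) (j := t) (by omega) (by omega) (by omega)
      (by omega) (by omega) le_rfl
    have h4 := h.chain_nonpos (a := 0) (c := t) (k := k + 1) (j := t) (by omega) (by omega)
      (by omega) (by omega) (by omega) le_rfl
    have h5 := h.height_lt_apex (r := k + 1) (by omega) (by omega)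
    have key := height_identity (w k) (w (k + 1)) (w (k + 2)) (w t) (w (n - 1)) (w 0)
    have key2 : g * orient (w k) (w (k + 1)) (w (k + 2)) *
        (height n w g (w t) - height n w g (w (k + 1))) =
        -(g * orient (w (k + 1)) (w (k + 2)) (w t)) *
          (height n w g (w (k + 1)) - height n w g (w k)) +
        (g * orient (w k) (w (k + 1)) (w t)) *
          (height n w g (w (k + 2)) - height n w g (w (k + 1))) := by
      simp only [height]
      linear_combination g ^ 2 * key
    have l1 := mul_neg_of_neg_of_pos h2 (sub_pos.2 h5)
    have l2 := mul_nonneg_of_nonpos_of_nonpos h3 (sub_nonpos.2 hle)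
    have l3 := mul_nonneg (neg_nonneg.2 h4) (sub_pos.2 h1).le
    linarith

/-- The second chain falls. -/
theorem height_succ_lt (h : IsFunnelLoop n t w g) {k : ℕ} (htk : t ≤ k) (hk : k + 1 < n) :
    height n w g (w (k + 1)) < height n w g (w k) := by
  have ht := h.t_pos
  -- Backward induction from the base; `m` counts the edges after the edge `k`.
  suffices key : ∀ m k, k + 2 + m = n → t ≤ k →
      height n w g (w (k + 1)) < height n w g (w k) from key (n - k - 2) k (by omega) htk
  intro m
  induction m with
  | zero =>
    intro k hkn htk
    rw [show k + 1 = n - 1 by omega, height_last]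
    exact h.height_pos (by omega) (by omega)
  | succ m ih =>
    intro k hkn htk
    by_contra! hle
    have h1 := ih (k + 1) (by omega) (by omega)
    have h2 := h.reflex k (by omega) (by omega)
    have h3 := h.chain_nonpos (a := t) (c := n - 1) (k := k) (j := t) (by omega) (by omega) htk
      (by omega) le_rfl (by omega)
    have h4 := h.chain_nonpos (a := t) (c := n - 1) (k := k + 1) (j := t) (by omega) (by omega)
      (by omega) (by omega) le_rfl (by omega)
    have h5 := h.height_lt_apex (r := k + 1) (by omega) (by omega)
    have key := height_identity (w k) (w (k + 1)) (w (k + 2)) (w t) (w (n - 1)) (w 0)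
    have key2 : g * orient (w k) (w (k + 1)) (w (k + 2)) *
        (height n w g (w t) - height n w g (w (k + 1))) =
        -(g * orient (w (k + 1)) (w (k + 2)) (w t)) *
          (height n w g (w (k + 1)) - height n w g (w k)) +
        (g * orient (w k) (w (k + 1)) (w t)) *
          (height n w g (w (k + 2)) - height n w g (w (k + 1))) := by
      simp only [height]
      linear_combination g ^ 2 * key
    have l1 := mul_neg_of_neg_of_pos h2 (sub_pos.2 h5)
    have l2 := mul_nonneg_of_nonpos_of_nonpos h3 (sub_nonpos.2 h1.le)
    have l3 := mul_nonneg (neg_nonneg.2 h4) (sub_nonneg.2 hle)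
    linarith

/-- The angle at the apex is convex. -/
theorem apex_pos (h : IsFunnelLoop n t w g) : 0 < g * orient (w (t - 1)) (w t) (w (t + 1)) := by
  have ht := h.t_pos
  obtain ⟨k, rfl⟩ : ∃ k, t = k + 1 := ⟨t - 1, by omega⟩
  -- This is the gradient of the height, which is maximal at the apex.
  have hd : ((-(g * ((w 0).2 - (w (n - 1)).2)), g * ((w 0).1 - (w (n - 1)).1)) : ℝ × ℝ) ≠ 0 := by
    intro he
    rw [Prod.mk_eq_zero, neg_eq_zero, mul_eq_zero, mul_eq_zero] at he
    exact h.w_last_ne (Prod.ext (by linarith [he.2.resolve_left h.ne_zero])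
      (by linarith [he.1.resolve_left h.ne_zero]))
  refine h.pos_of_max hd fun j => ?_
  have h1 : height n w g (w j) ≤ height n w g (w (k + 1)) := by
    have hn := h.three_le
    rw [h.eq_of_mod_eq (Nat.mod_mod j n).symm]
    by_cases hj : j % n = k + 1
    · rw [hj]
    · exact (h.height_lt_apex hj (Nat.mod_lt _ (by omega))).le
  simp only [height, orient] at h1
  simp only [Nat.add_sub_cancel]
  linarith

end IsFunnelLoop

/-! ## Triangles -/

/-- The three quotients are the barycentric coordinates of `z`. -/
theorem mem_triangle {p q r z : ℝ × ℝ} (hD : orient p q r ≠ 0)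
    (h1 : 0 ≤ orient q r z / orient p q r) (h2 : 0 ≤ orient r p z / orient p q r)
    (h3 : 0 ≤ orient p q z / orient p q r) : z ∈ convexHull ℝ ({p, q, r} : Set (ℝ × ℝ)) := by
  have hconv := convex_convexHull ℝ ({p, q, r} : Set (ℝ × ℝ))
  have hsub := subset_convexHull ℝ ({p, q, r} : Set (ℝ × ℝ))
  have hmem := hconv.sum_mem (t := Finset.univ)
    (w := ![orient q r z / orient p q r, orient r p z / orient p q r, orient p q z / orient p q r])
    (z := ![p, q, r])
    (by intro i _; fin_cases i <;> assumption)
    (by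
      simp only [Fin.sum_univ_three, Matrix.cons_val]
      rw [← add_div, ← add_div, div_eq_one_iff_eq hD]
      simp only [orient]
      ring)
    (by intro i _; fin_cases i <;> exact hsub (by simp))
  convert hmem using 1
  simp only [Fin.sum_univ_three, Matrix.cons_val]
  ext <;>
  · simp only [Prod.fst_add, Prod.snd_add, Prod.smul_fst, Prod.smul_snd, smul_eq_mul]
    field_simp
    simp only [orient]
    ring

/-- Near the corner `c`, the sector of the triangle `p c q` is in the interior of the triangle. -/
theorem eventually_sector_mem_interior {p c q : ℝ × ℝ} (h : orient p c q ≠ 0) :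
    ∀ᶠ z in 𝓝 c, z ∈ sector (orient p c q) p c q →
      z ∈ interior (convexHull ℝ ({p, c, q} : Set (ℝ × ℝ))) := by
  have hcont : ∀ P Q : ℝ × ℝ, Continuous fun z => orient P Q z / orient p c q :=
    fun P Q => (continuous_orient P Q).div_const _
  have hlt : ∀ P Q : ℝ × ℝ, IsOpen {z | 0 < orient P Q z / orient p c q} :=
    fun P Q => isOpen_lt continuous_const (hcont P Q)
  have hopen := ((hlt c q).inter (hlt q p)).inter (hlt p c)
  have hc : c ∈ {z | 0 < orient q p z / orient p c q} := by
    change 0 < orient q p c / orient p c q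
    rw [show orient q p c = orient p c q by simp only [orient]; ring, div_self h]
    exact one_pos
  filter_upwards [(hlt q p).mem_nhds hc] with z hz hzs
  refine interior_maximal (s := convexHull ℝ ({p, c, q} : Set (ℝ × ℝ)))
    (fun y hy => mem_triangle h hy.1.1.le hy.1.2.le hy.2.le) hopen ?_
  rw [sector_of_pos (mul_self_pos.2 h)] at hzs
  have key : ∀ x : ℝ, 0 < orient p c q * x → 0 < x / orient p c q := by
    intro x hx
    rw [← mul_div_mul_left _ _ h]
    exact div_pos hx (mul_self_pos.2 h)
  exact ⟨⟨key _ hzs.2, hz⟩, key _ hzs.1⟩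

/-! ## From funnels to cyclic sequences -/

/-- The periodic sequence of the vertices. -/
def cyc {n : ℕ} (hn : 0 < n) (v : Fin n → ℝ × ℝ) (k : ℕ) : ℝ × ℝ := v ⟨k % n, Nat.mod_lt _ hn⟩

section Cyc

variable {n : ℕ} (hn : 0 < n) (v : Fin n → ℝ × ℝ)

theorem cyc_of_lt {k : ℕ} (hk : k < n) : cyc hn v k = v ⟨k, hk⟩ := by
  simp only [cyc, Nat.mod_eq_of_lt hk]

theorem finRotate_mod (k : ℕ) :
    finRotate n ⟨k % n, Nat.mod_lt _ hn⟩ = ⟨(k + 1) % n, Nat.mod_lt _ hn⟩ := by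
  obtain ⟨m, rfl⟩ : ∃ m, n = m + 1 := ⟨n - 1, by omega⟩
  rw [finRotate_apply]
  ext
  simp [Fin.val_add]

theorem finRotate_symm_mod (k : ℕ) :
    (finRotate n).symm ⟨(k + 1) % n, Nat.mod_lt _ hn⟩ = ⟨k % n, Nat.mod_lt _ hn⟩ := by
  rw [Equiv.symm_apply_eq, finRotate_mod hn]

theorem polyEdge_mod (k : ℕ) :
    polyEdge v ⟨k % n, Nat.mod_lt _ hn⟩ = segment ℝ (cyc hn v k) (cyc hn v (k + 1)) := by
  rw [polyEdge, finRotate_mod hn]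
  rfl

theorem loopBoundary_cyc : loopBoundary (cyc hn v) = polyBoundary v := by
  refine subset_antisymm (iUnion_subset fun k => ?_) (iUnion_subset fun i => ?_)
  · rw [← polyEdge_mod]
    exact subset_iUnion (polyEdge v) _
  · have := polyEdge_mod hn v i
    simp only [Nat.mod_eq_of_lt i.isLt, Fin.eta] at this
    rw [this]
    exact subset_iUnion (fun k => segment ℝ (cyc hn v k) (cyc hn v (k + 1))) i

theorem polyRegion_eq_compl : polyRegion v = (outerSet (loopBoundary (cyc hn v)))ᶜ := by
  rw [loopBoundary_cyc]
  ext z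
  simp only [polyRegion, outerSet, mem_union, mem_ofPred_eq, mem_compl_iff, not_and, not_not]
  tauto

variable {v}

theorem IsSimplePolygon.isPolyLoop (h : IsSimplePolygon v) : IsPolyLoop n (cyc hn v) where
  three_le := h.three_le
  periodic k := by simp [cyc]
  injective i j hij := by simpa using h.injective hij
  consecutive k := by
    have := h.consecutive ⟨k % n, Nat.mod_lt _ hn⟩
    rwa [finRotate_mod hn, polyEdge_mod, polyEdge_mod] at this
  nonconsecutive i j h1 h2 h3 := by
    rw [← polyEdge_mod, ← polyEdge_mod]
    apply h.nonconsecutive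
    · simpa using h1
    · rw [finRotate_mod hn]; simpa using h2
    · rw [finRotate_mod hn]; simpa using h3

theorem IsConvexVertex.turn {k : ℕ} (h : IsConvexVertex v ⟨(k + 1) % n, Nat.mod_lt _ hn⟩) :
    orient (cyc hn v k) (cyc hn v (k + 1)) (cyc hn v (k + 2)) ≠ 0 := by
  have := h.1
  rwa [finRotate_symm_mod hn, finRotate_mod hn] at this

theorem IsReflexVertex.turn {k : ℕ} (h : IsReflexVertex v ⟨(k + 1) % n, Nat.mod_lt _ hn⟩) :
    orient (cyc hn v k) (cyc hn v (k + 1)) (cyc hn v (k + 2)) ≠ 0 := by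
  have := h.1
  rwa [finRotate_symm_mod hn, finRotate_mod hn] at this

theorem cornerTriangle_mod (k : ℕ) : cornerTriangle v ⟨(k + 1) % n, Nat.mod_lt _ hn⟩ =
    convexHull ℝ {cyc hn v k, cyc hn v (k + 1), cyc hn v (k + 2)} := by
  rw [cornerTriangle, finRotate_symm_mod hn, finRotate_mod hn]
  rfl

theorem IsConvexVertex.sectorIn {k : ℕ} (h : IsConvexVertex v ⟨(k + 1) % n, Nat.mod_lt _ hn⟩) :
    SectorIn (orient (cyc hn v k) (cyc hn v (k + 1)) (cyc hn v (k + 2)))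
      (outerSet (loopBoundary (cyc hn v)))ᶜ (cyc hn v k) (cyc hn v (k + 1)) (cyc hn v (k + 2)) := by
  obtain ⟨U, hU, hsub⟩ := h.2
  rw [cornerTriangle_mod hn, polyRegion_eq_compl hn] at hsub
  filter_upwards [hU, eventually_sector_mem_interior (h.turn hn)] with z h1 h2 h3
  exact hsub ⟨h1, interior_subset (h2 h3)⟩

theorem IsReflexVertex.sectorIn {k : ℕ} (h : IsReflexVertex v ⟨(k + 1) % n, Nat.mod_lt _ hn⟩) :
    SectorIn (orient (cyc hn v k) (cyc hn v (k + 1)) (cyc hn v (k + 2)))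
      (outerSet (loopBoundary (cyc hn v))) (cyc hn v k) (cyc hn v (k + 1)) (cyc hn v (k + 2)) := by
  obtain ⟨U, hU, hdisj⟩ := h.2
  rw [cornerTriangle_mod hn, polyRegion_eq_compl hn, disjoint_compl_right_iff_subset] at hdisj
  filter_upwards [hU, eventually_sector_mem_interior (h.turn hn)] with z h1 h2 h3
  exact hdisj ⟨h1, h2 h3⟩

/-- The orientation `g` is the turn at the first vertex. This vertex being convex, its wedge is
inside; by `IsPolyLoop.isSidedLoop` one such corner fixes the sides everywhere, and reflex vertices
then turn against `g`. -/
theorem IsFunnel.exists_loop (h : IsFunnel v) : ∃ t, IsFunnelLoop n t (cyc hn v)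
    (orient (cyc hn v (n - 1)) (cyc hn v 0) (cyc hn v 1)) := by
  obtain ⟨hs, a, t, b, ha, hb, hat, htb, hca, hct, hcb, hr⟩ := h
  have hloop := hs.isPolyLoop hn
  have h3 := hs.three_le
  have hat' : a.val < t.val := hat
  have htb' : t.val < b.val := htb
  have hturn : ∀ k, orient (cyc hn v k) (cyc hn v (k + 1)) (cyc hn v (k + 2)) ≠ 0 := by
    intro k
    by_cases h1 : (⟨(k + 1) % n, Nat.mod_lt _ hn⟩ : Fin n) = a
    · exact IsConvexVertex.turn hn (h1 ▸ hca)
    by_cases h2 : (⟨(k + 1) % n, Nat.mod_lt _ hn⟩ : Fin n) = t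
    · exact IsConvexVertex.turn hn (h2 ▸ hct)
    by_cases h3 : (⟨(k + 1) % n, Nat.mod_lt _ hn⟩ : Fin n) = b
    · exact IsConvexVertex.turn hn (h3 ▸ hcb)
    exact IsReflexVertex.turn hn (hr _ h1 h2 h3)
  have e0 : cyc hn v (n - 1 + 1) = cyc hn v 0 := by
    rw [Nat.sub_add_cancel hn]; simp [cyc]
  have e1 : cyc hn v (n - 1 + 2) = cyc hn v 1 := by
    rw [show n - 1 + 2 = 1 + n by omega]; simp [cyc]
  have hg := hturn (n - 1)
  have hsec : SectorIn (orient (cyc hn v (n - 1)) (cyc hn v (n - 1 + 1)) (cyc hn v (n - 1 + 2)))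
      (outerSet (loopBoundary (cyc hn v)))ᶜ (cyc hn v (n - 1)) (cyc hn v (n - 1 + 1))
      (cyc hn v (n - 1 + 2)) := by
    refine IsConvexVertex.sectorIn hn ?_
    convert hca
    rw [ha, Nat.sub_add_cancel hn, Nat.mod_self]
  have hsided := hloop.isSidedLoop hturn rfl hsec
  rw [e0, e1] at hsided hg
  refine ⟨t.val, hsided, by omega, by omega, fun k hk hkn => ?_, mul_self_pos.2 hg⟩
  refine hsided.neg_of_reflex (IsReflexVertex.sectorIn hn (hr _ ?_ ?_ ?_)) <;>
  · rw [Ne, Fin.ext_iff]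
    simp only [Nat.mod_eq_of_lt (show k + 1 < n by omega)]
    omega

end Cyc

/-! ## The chart of a funnel -/

namespace FunnelChart

variable {C : FunnelChart}

theorem lineMap_mem_region {i : ℕ} (hi : i < C.p) {s : ℝ} (h0 : 0 ≤ s) (h1 : s ≤ 1) :
    AffineMap.lineMap (C.a i) (C.a (i + 1)) s ∈ C.region := by
  have hp := C.p_pos
  have hq := C.q_pos
  have y0 : 0 ≤ C.y (C.a i) := y_a_nonneg hi.le
  have y1 : 0 ≤ C.y (C.a (i + 1)) := y_a_nonneg hi
  have l0 : C.y (C.a i) ≤ C.y (C.a C.p) := y_a_le hi.le le_rfl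
  have l1 : C.y (C.a (i + 1)) ≤ C.y (C.a C.p) := y_a_le hi le_rfl
  refine ⟨?_, ⟨i, hi, ?_⟩, C.q - 1, by omega, C.symm.A_last_nonneg ?_ ?_⟩
  · rw [C.y_line]
    nlinarith
  · rw [A_line, A_left hi, A_right hi]
    linarith
  · change C.y _ ≤ C.y (C.b C.q)
    rw [← C.apex, C.y_line]
    nlinarith
  · change C.A (C.p - 1) _ ≤ 0
    have h2 := A_vertex_nonpos (C := C) (i := C.p - 1) (k := i) (by omega) hi.le
    have h3 := A_vertex_nonpos (C := C) (i := C.p - 1) (k := i + 1) (by omega) hi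
    rw [A_line]
    nlinarith

theorem A_lineMap_nonpos {i k : ℕ} (hi : i < C.p) (hk : k < C.p) {s : ℝ} (h0 : 0 ≤ s)
    (h1 : s ≤ 1) : C.A k (AffineMap.lineMap (C.a i) (C.a (i + 1)) s) ≤ 0 := by
  have h2 := A_vertex_nonpos (C := C) hk hi.le
  have h3 := A_vertex_nonpos (C := C) hk (show i + 1 ≤ C.p from hi)
  rw [A_line]
  nlinarith

/-- One of the upper ends of the two lowest edges is not behind the other edge. The sum is
nonnegative there, and it decreases with height. -/
theorem base_pos {z : ℝ × ℝ} (hz : C.y z = 0) : 0 < C.A 0 z + C.B 0 z := by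
  have h1 := add_strictAnti (C := C) (z := z) (w := C.a 1) C.p_pos C.q_pos
    (by rw [hz, ← C.y_a_zero]; exact C.y_a_succ 0 C.p_pos)
  have h2 := add_strictAnti (C := C) (z := z) (w := C.b 1) C.p_pos C.q_pos
    (by rw [hz, ← C.y_b_zero]; exact C.y_b_succ 0 C.q_pos)
  have h3 := A_right (C := C) C.p_pos
  have h4 := B_right (C := C) C.q_pos
  simp only [zero_add] at h3 h4
  by_cases h : C.A 0 (C.b 1) < 0
  · have := B_nonneg_of_A_neg C.p_pos C.q_pos h
    simp only [zero_add] at this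
    linarith
  · linarith

theorem A_b_zero_pos : 0 < C.A 0 (C.b 0) := by
  have h1 := base_pos (C := C) C.y_b_zero
  have h2 := B_left (C := C) C.q_pos
  linarith

theorem A_le_zero_of_y {i : ℕ} (hi : i < C.p) {z : ℝ × ℝ} (hz : C.y z = 0) :
    C.A i z ≤ C.A 0 z := by
  refine A_anti (Nat.zero_le i) hi ?_
  rw [hz, ← C.y_a_zero]
  exact (C.y_a_succ 0 C.p_pos).le

theorem base_mem_region {s : ℝ} (h0 : 0 ≤ s) (h1 : s ≤ 1) :
    AffineMap.lineMap (C.b 0) (C.a 0) s ∈ C.region := by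
  refine ⟨?_, ⟨0, C.p_pos, ?_⟩, 0, C.q_pos, ?_⟩
  · rw [C.y_line, C.y_a_zero, C.y_b_zero]
    linarith
  · rw [A_line, A_left C.p_pos]
    have := A_b_zero_pos (C := C)
    nlinarith
  · change 0 ≤ C.symm.A 0 _
    rw [A_line]
    have h2 : 0 < C.symm.A 0 (C.a 0) := A_b_zero_pos (C := C.symm)
    have h3 : C.symm.A 0 (C.b 0) = 0 := B_left (C := C) C.q_pos
    rw [h3]
    nlinarith

/-- A point of the region in front of no edge of the first chain is on that chain. -/
theorem exists_A_pos {z : ℝ × ℝ} (hz : z ∈ C.region) : (∃ i < C.p, 0 < C.A i z) ∨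
    ∃ i < C.p, C.A i z = 0 ∧ C.y (C.a i) ≤ C.y z ∧ C.y z ≤ C.y (C.a (i + 1)) := by
  by_contra! hno
  obtain ⟨h1, h2⟩ := hno
  obtain ⟨hy, ⟨i, hi, hA⟩, j, hj, hB⟩ := hz
  have hA0 : C.A i z = 0 := le_antisymm (h1 i hi) hA
  -- Below `a i` the previous edge function would be positive, above `a (i + 1)` the next one. At
  -- the two ends of the chain, the base and the second chain exclude these cases.
  have hlow : C.y (C.a i) ≤ C.y z := by
    by_contra! hlt
    rcases Nat.eq_zero_or_pos i with rfl | hpos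
    · rw [C.y_a_zero] at hlt
      linarith
    · obtain ⟨l, rfl⟩ : ∃ l, i = l + 1 := ⟨i - 1, by omega⟩
      have := A_strictAnti (C := C) (Nat.lt_succ_self l) hi hlt
      have := h1 l (by omega)
      linarith
  have hhigh := h2 i hi hA0 hlow
  by_cases hip : i + 1 < C.p
  · have := A_strictMono (C := C) (Nat.lt_succ_self i) hip hhigh
    have := h1 (i + 1) hip
    linarith
  · rw [show i + 1 = C.p by omega] at hhigh
    have := add_strictAnti (C := C) hi hj hhigh
    have l1 := A_vertex_nonpos (C := C) hi (le_refl C.p)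
    have l2 : C.B j (C.b C.q) ≤ 0 := C.symm.A_vertex_nonpos hj le_rfl
    rw [← C.apex] at l2
    linarith

end FunnelChart

/-! ### Coordinates along and above the base -/

namespace IsFunnelLoop

variable {n t : ℕ} {w : ℕ → ℝ × ℝ} {g : ℝ}

/-- The coordinate along the base. -/
def along (n : ℕ) (w : ℕ → ℝ × ℝ) (z : ℝ × ℝ) : ℝ :=
  ((w 0).1 - (w (n - 1)).1) * z.1 + ((w 0).2 - (w (n - 1)).2) * z.2

/-- The squared length of the base. -/
def baseSq (n : ℕ) (w : ℕ → ℝ × ℝ) : ℝ :=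
  ((w 0).1 - (w (n - 1)).1) ^ 2 + ((w 0).2 - (w (n - 1)).2) ^ 2

theorem baseSq_pos (h : IsFunnelLoop n t w g) : 0 < baseSq n w := by
  by_contra! hle
  rw [baseSq] at hle
  have h1 : (w 0).1 - (w (n - 1)).1 = 0 := by
    nlinarith [sq_nonneg ((w 0).1 - (w (n - 1)).1), sq_nonneg ((w 0).2 - (w (n - 1)).2)]
  have h2 : (w 0).2 - (w (n - 1)).2 = 0 := by
    nlinarith [sq_nonneg ((w 0).1 - (w (n - 1)).1), sq_nonneg ((w 0).2 - (w (n - 1)).2)]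
  exact h.w_last_ne (Prod.ext (by linarith) (by linarith))

/-- The change to the coordinates along and above the base is affine with determinant `g * baseSq`,
and multiplies orientations by it. -/
theorem orient_eq (p q z : ℝ × ℝ) : baseSq n w * (g * orient p q z) =
    (along n w q - along n w p) * (height n w g z - height n w g p) -
      (height n w g q - height n w g p) * (along n w z - along n w p) := by
  simp only [baseSq, along, height, orient]
  ring

theorem along_lineMap (u v : ℝ × ℝ) (s : ℝ) :
    along n w (AffineMap.lineMap u v s) = (1 - s) * along n w u + s * along n w v := by
  simp only [along, AffineMap.lineMap_apply_module, Prod.fst_add, Prod.snd_add, Prod.smul_fst,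
    Prod.smul_snd, smul_eq_mul]
  ring

theorem height_lineMap (u v : ℝ × ℝ) (s : ℝ) :
    height n w g (AffineMap.lineMap u v s) = (1 - s) * height n w g u + s * height n w g v := by
  simp only [height, orient_lineMap]
  ring

theorem eq_of_coords (h : IsFunnelLoop n t w g) {z z' : ℝ × ℝ} (h1 : along n w z = along n w z')
    (h2 : height n w g z = height n w g z') : z = z' := by
  have hb := h.baseSq_pos.ne'
  have hg := h.ne_zero
  have h3 : orient (w (n - 1)) (w 0) z = orient (w (n - 1)) (w 0) z' := mul_left_cancel₀ hg h2
  simp only [along] at h1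
  simp only [orient] at h3
  ext
  · refine mul_left_cancel₀ hb ?_
    rw [baseSq]
    linear_combination ((w 0).1 - (w (n - 1)).1) * h1 - ((w 0).2 - (w (n - 1)).2) * h3
  · refine mul_left_cancel₀ hb ?_
    rw [baseSq]
    linear_combination ((w 0).2 - (w (n - 1)).2) * h1 + ((w 0).1 - (w (n - 1)).1) * h3

/-- The slope of an edge, measured along the base. -/
noncomputable def slope (n : ℕ) (w : ℕ → ℝ × ℝ) (g : ℝ) (k : ℕ) : ℝ :=
  (along n w (w (k + 1)) - along n w (w k)) / (height n w g (w (k + 1)) - height n w g (w k))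

theorem height_sub_ne (h : IsFunnelLoop n t w g) {k : ℕ} (hk : k + 1 < n) :
    height n w g (w (k + 1)) - height n w g (w k) ≠ 0 := by
  rcases lt_or_ge k t with hkt | hkt
  · exact (sub_pos.2 (h.height_lt_succ hkt)).ne'
  · exact (sub_neg.2 (h.height_succ_lt hkt hk)).ne

theorem slope_mul (h : IsFunnelLoop n t w g) {k : ℕ} (hk : k + 1 < n) :
    slope n w g k * (height n w g (w (k + 1)) - height n w g (w k)) =
      along n w (w (k + 1)) - along n w (w k) :=
  div_mul_cancel₀ _ (h.height_sub_ne hk)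

/-- Inside a chain the turn is negative and the two height differences have the same sign; at the
apex both signs change. So the slopes increase through the apex as well, which gives `m_lt`, `m'_lt`
and `m_add` of the chart at once. -/
theorem slope_lt_succ (h : IsFunnelLoop n t w g) {k : ℕ} (hk : k + 2 < n) :
    slope n w g k < slope n w g (k + 1) := by
  have key := orient_eq (n := n) (w := w) (g := g) (w k) (w (k + 1)) (w (k + 2))
  have hb := h.baseSq_pos
  have s0 := h.slope_mul (show k + 1 < n by omega)
  have s1 : slope n w g (k + 1) * (height n w g (w (k + 2)) - height n w g (w (k + 1))) =
    along n w (w (k + 2)) - along n w (w (k + 1)) := h.slope_mul (show k + 1 + 1 < n by omega)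
  have key2 : baseSq n w * (g * orient (w k) (w (k + 1)) (w (k + 2))) =
      (slope n w g k - slope n w g (k + 1)) *
        ((height n w g (w (k + 1)) - height n w g (w k)) *
          (height n w g (w (k + 2)) - height n w g (w (k + 1)))) := by
    linear_combination key -
      (height n w g (w (k + 2)) - height n w g (w (k + 1))) * s0 +
      (height n w g (w (k + 1)) - height n w g (w k)) * s1
  rcases lt_trichotomy (k + 1) t with hkt | hkt | hkt
  · have h1 := mul_neg_of_pos_of_neg hb (h.reflex k hkt.ne hk)
    have h2 := mul_pos (sub_pos.2 (h.height_lt_succ (show k < t by omega)))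
      (sub_pos.2 (h.height_lt_succ hkt))
    rw [key2] at h1
    exact sub_neg.1 (neg_of_mul_neg_left h1 h2.le)
  · have h1 := h.apex_pos
    rw [← hkt, Nat.add_sub_cancel] at h1
    have h1 := mul_pos hb h1
    have h2 := mul_neg_of_pos_of_neg (sub_pos.2 (h.height_lt_succ (show k < t by omega)))
      (sub_neg.2 (h.height_succ_lt hkt.ge hk))
    rw [show k + 1 + 1 = k + 2 from rfl, key2] at *
    by_contra! hle
    exact absurd (mul_nonpos_of_nonneg_of_nonpos (sub_nonneg.2 hle) h2.le) (not_le.2 h1)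
  · have h1 := mul_neg_of_pos_of_neg hb (h.reflex k hkt.ne' hk)
    have h2 := mul_pos_of_neg_of_neg (sub_neg.2 (h.height_succ_lt (show t ≤ k by omega)
      (show k + 1 < n by omega))) (sub_neg.2 (h.height_succ_lt (show t ≤ k + 1 by omega) hk))
    rw [key2] at h1
    exact sub_neg.1 (neg_of_mul_neg_left h1 h2.le)

theorem slope_lt (h : IsFunnelLoop n t w g) {i k : ℕ} (hik : i < k) (hk : k + 1 < n) :
    slope n w g i < slope n w g k := by
  induction k, hik using Nat.le_induction with
  | base => exact h.slope_lt_succ hk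
  | succ k hk' ih => exact (ih (by omega)).trans (h.slope_lt_succ hk)

/-- The chart of a funnel. -/
noncomputable def chart (h : IsFunnelLoop n t w g) : FunnelChart where
  p := t
  q := n - 1 - t
  a := w
  b j := w (n - 1 - j)
  x := along n w
  x' z := -along n w z
  y := height n w g
  c i := along n w (w i) - slope n w g i * height n w g (w i)
  m := slope n w g
  c' j := -(along n w (w (n - 1 - j)) - slope n w g (n - 2 - j) * height n w g (w (n - 1 - j)))
  m' j := -slope n w g (n - 2 - j)
  p_pos := h.t_pos
  q_pos := by have := h.t_lt; omega
  x_add z := add_neg_cancel _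
  x_line := along_lineMap
  y_line := height_lineMap
  m_lt i hi := by have := h.t_lt; exact h.slope_lt_succ (by omega)
  m'_lt j hj := neg_lt_neg (h.slope_lt (by omega) (by omega))
  m_add i j hi hj := by
    have := h.t_lt
    have := h.slope_lt (i := i) (k := n - 2 - j) (by omega) (by omega)
    linarith
  y_a_succ i hi := h.height_lt_succ hi
  y_b_succ j hj := by
    have := h.height_succ_lt (k := n - 2 - j) (by omega) (by omega)
    rwa [show n - 2 - j + 1 = n - 1 - j by omega, show n - 2 - j = n - 1 - (j + 1) by omega] at this
  y_a_zero := height_zero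
  y_b_zero := height_last
  apex := by have := h.t_lt; rw [show n - 1 - (n - 1 - t) = t by omega]
  a_left i hi := by ring
  a_right i hi := by
    have := h.t_lt
    linear_combination -h.slope_mul (k := i) (by omega)
  b_left j hj := by ring
  b_right j hj := by
    have := h.slope_mul (k := n - 2 - j) (by omega)
    rw [show n - 2 - j + 1 = n - 1 - j by omega] at this
    rw [show n - 1 - (j + 1) = n - 2 - j by omega]
    linear_combination -this

theorem chart_A_mul (h : IsFunnelLoop n t w g) {i : ℕ} (hi : i < t) (z : ℝ × ℝ) :
    h.chart.A i z * (height n w g (w (i + 1)) - height n w g (w i)) =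
      baseSq n w * (g * orient (w i) (w (i + 1)) z) := by
  have := h.t_lt
  have h1 := h.slope_mul (k := i) (by omega)
  simp only [FunnelChart.A, chart]
  linear_combination (height n w g z - height n w g (w i)) * h1 -
    orient_eq (n := n) (w := w) (g := g) (w i) (w (i + 1)) z

theorem chart_B_mul (h : IsFunnelLoop n t w g) {j k : ℕ} (hjk : j + k + 2 = n) (z : ℝ × ℝ) :
    h.chart.B j z * (height n w g (w k) - height n w g (w (k + 1))) =
      baseSq n w * (g * orient (w k) (w (k + 1)) z) := by
  have h1 := h.slope_mul (k := k) (by omega)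
  simp only [FunnelChart.B, chart]
  rw [show n - 2 - j = k by omega, show n - 1 - j = k + 1 by omega]
  linear_combination (height n w g z - height n w g (w (k + 1))) * h1 -
    orient_eq (n := n) (w := w) (g := g) (w k) (w (k + 1)) z

theorem neg_iff_of_mul_eq {a b c d : ℝ} (hb : 0 < b) (hc : 0 < c) (h : a * b = c * d) :
    a < 0 ↔ d < 0 := by
  constructor <;> intro hlt <;> by_contra! hle <;> nlinarith

theorem chart_A_neg_iff (h : IsFunnelLoop n t w g) {i : ℕ} (hi : i < t) (z : ℝ × ℝ) :
    h.chart.A i z < 0 ↔ g * orient (w i) (w (i + 1)) z < 0 := by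
  have h1 := sub_pos.2 (h.height_lt_succ hi)
  exact neg_iff_of_mul_eq h1 h.baseSq_pos (h.chart_A_mul hi z)

theorem chart_B_neg_iff (h : IsFunnelLoop n t w g) {j k : ℕ} (hk : t ≤ k) (hjk : j + k + 2 = n)
    (z : ℝ × ℝ) : h.chart.B j z < 0 ↔ g * orient (w k) (w (k + 1)) z < 0 := by
  have h1 := sub_pos.2 (h.height_succ_lt hk (by omega))
  exact neg_iff_of_mul_eq h1 h.baseSq_pos (h.chart_B_mul hjk z)

/-! ### The region of the chart is the polygon -/

/-- The three kinds of edges. -/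
theorem mem_boundary_cases (h : IsFunnelLoop n t w g) {z : ℝ × ℝ} (hz : z ∈ loopBoundary w) :
    ∃ s : ℝ, 0 ≤ s ∧ s ≤ 1 ∧ ((∃ i < t, z = AffineMap.lineMap (w i) (w (i + 1)) s) ∨
      (∃ j < h.chart.q, z = AffineMap.lineMap (h.chart.b j) (h.chart.b (j + 1)) s) ∨
      z = AffineMap.lineMap (h.chart.b 0) (w 0) s) := by
  have ht := h.t_lt
  rw [h.loopBoundary_eq] at hz
  obtain ⟨k, hk, hz⟩ := mem_iUnion₂.1 hz
  rw [Finset.mem_range] at hk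
  rcases lt_or_ge k t with hkt | hkt
  · rw [segment_eq_image_lineMap] at hz
    obtain ⟨s, hs, rfl⟩ := hz
    exact ⟨s, hs.1, hs.2, Or.inl ⟨k, hkt, rfl⟩⟩
  by_cases hkn : k + 1 = n
  · rw [hkn, h.w_n, segment_eq_image_lineMap] at hz
    obtain ⟨s, hs, rfl⟩ := hz
    refine ⟨s, hs.1, hs.2, Or.inr (Or.inr ?_)⟩
    simp only [chart]
    rw [show n - 1 - 0 = k by omega]
  · rw [segment_symm, segment_eq_image_lineMap] at hz
    obtain ⟨s, hs, rfl⟩ := hz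
    refine ⟨s, hs.1, hs.2, Or.inr (Or.inl ⟨n - 2 - k, ?_, ?_⟩)⟩
    · simp only [chart]; omega
    · simp only [chart]
      rw [show n - 1 - (n - 2 - k) = k + 1 by omega, show n - 1 - (n - 2 - k + 1) = k by omega]

theorem boundary_subset_region (h : IsFunnelLoop n t w g) : loopBoundary w ⊆ h.chart.region := by
  intro z hz
  obtain ⟨s, h0, h1, ⟨i, hi, rfl⟩ | ⟨j, hj, rfl⟩ | rfl⟩ := h.mem_boundary_cases hz
  · exact FunnelChart.lineMap_mem_region (C := h.chart) hi h0 h1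
  · rw [← h.chart.symm_region]
    exact FunnelChart.lineMap_mem_region (C := h.chart.symm) hj h0 h1
  · exact FunnelChart.base_mem_region (C := h.chart) h0 h1

theorem height_add_base (z : ℝ × ℝ) (s : ℝ) :
    height n w g (z + s • (w 0 - w (n - 1))) = height n w g z := by
  simp only [height, orient, Prod.fst_add, Prod.snd_add, Prod.smul_fst, Prod.smul_snd, smul_eq_mul,
    Prod.fst_sub, Prod.snd_sub]
  ring

theorem along_add_base (z : ℝ × ℝ) (s : ℝ) :
    along n w (z + s • (w 0 - w (n - 1))) = along n w z + s * baseSq n w := by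
  simp only [along, baseSq, Prod.fst_add, Prod.snd_add, Prod.smul_fst, Prod.smul_snd, smul_eq_mul,
    Prod.fst_sub, Prod.snd_sub]
  ring

/-- The condition that fails at `z` keeps failing along a ray parallel to the base: one direction
decreases all `A i`, the other all `B j`, and the height stays constant. Such a ray misses the
boundary. -/
theorem compl_region_subset (h : IsFunnelLoop n t w g) :
    (h.chart.region)ᶜ ⊆ outerSet (loopBoundary w) := by
  intro z hz
  have hd : w 0 - w (n - 1) ≠ 0 := sub_ne_zero.2 h.w_last_ne.symm
  have hb := h.baseSq_pos
  by_cases h1 : 0 ≤ h.chart.y z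
  · by_cases h2 : ∃ i < h.chart.p, 0 ≤ h.chart.A i z
    · have h3 : ∀ j < h.chart.q, h.chart.B j z < 0 := by
        by_contra! h3
        exact hz ⟨h1, h2, h3⟩
      refine mem_outerSet_of_ray (neg_ne_zero.2 hd) fun s hs hmem => ?_
      obtain ⟨-, -, j, hj, hj'⟩ := h.boundary_subset_region hmem
      have h4 := h3 j hj
      rw [smul_neg, ← neg_smul] at hj'
      simp only [FunnelChart.B, chart] at h4 hj'
      rw [height_add_base, along_add_base] at hj'
      nlinarith
    · push Not at h2
      refine mem_outerSet_of_ray hd fun s hs hmem => ?_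
      obtain ⟨-, ⟨i, hi, hi'⟩, -⟩ := h.boundary_subset_region hmem
      have h4 := h2 i hi
      simp only [FunnelChart.A, chart] at h4 hi'
      rw [height_add_base, along_add_base] at hi'
      nlinarith
  · refine mem_outerSet_of_ray hd fun s hs hmem => ?_
    have h3 : 0 ≤ height n w g (z + s • (w 0 - w (n - 1))) := (h.boundary_subset_region hmem).1
    rw [height_add_base] at h3
    exact h1 h3

theorem mem_boundary_of_A (h : IsFunnelLoop n t w g) {i : ℕ} (hi : i < t) {z : ℝ × ℝ}
    (hz : h.chart.A i z = 0) (h1 : height n w g (w i) ≤ height n w g z)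
    (h2 : height n w g z ≤ height n w g (w (i + 1))) : z ∈ segment ℝ (w i) (w (i + 1)) := by
  have hlt := h.height_lt_succ hi
  have hd := sub_pos.2 hlt
  have ht := h.t_lt
  rw [segment_eq_image_lineMap]
  refine ⟨(height n w g z - height n w g (w i)) /
    (height n w g (w (i + 1)) - height n w g (w i)),
    ⟨div_nonneg (sub_nonneg.2 h1) hd.le, (div_le_one hd).2 (by linarith)⟩, ?_⟩
  refine h.eq_of_coords ?_ ?_
  · rw [along_lineMap]
    have h3 := h.slope_mul (k := i) (by omega)
    simp only [FunnelChart.A, chart] at hz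
    field_simp
    linear_combination -(height n w g z - height n w g (w i)) * h3 + (height n w g (w (i + 1)) - height n w g (w i)) * hz
  · rw [height_lineMap]
    field_simp
    ring

theorem mem_boundary_of_B (h : IsFunnelLoop n t w g) {j : ℕ} (hj : j < h.chart.q) {z : ℝ × ℝ}
    (hz : h.chart.B j z = 0) (h1 : height n w g (h.chart.b j) ≤ height n w g z)
    (h2 : height n w g z ≤ height n w g (h.chart.b (j + 1))) : z ∈ loopBoundary w := by
  have hj' : j < n - 1 - t := hj
  obtain ⟨k, hk⟩ : ∃ k, j + k + 2 = n := ⟨n - 2 - j, by omega⟩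
  have e1 : h.chart.b j = w (k + 1) := by
    simp only [chart]; rw [show n - 1 - j = k + 1 by omega]
  have e2 : h.chart.b (j + 1) = w k := by
    simp only [chart]; rw [show n - 1 - (j + 1) = k by omega]
  rw [e1] at h1
  rw [e2] at h2
  have hlt := h.height_succ_lt (k := k) (by omega) (by omega)
  have hd := sub_pos.2 hlt
  refine mem_iUnion.2 ⟨k, ?_⟩
  rw [segment_symm, segment_eq_image_lineMap]
  refine ⟨(height n w g z - height n w g (w (k + 1))) /
    (height n w g (w k) - height n w g (w (k + 1))),
    ⟨div_nonneg (sub_nonneg.2 h1) hd.le, (div_le_one hd).2 (by linarith)⟩, ?_⟩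
  refine h.eq_of_coords ?_ ?_
  · rw [along_lineMap]
    have h3 := h.slope_mul (k := k) (by omega)
    simp only [FunnelChart.B, chart] at hz
    rw [show n - 2 - j = k by omega, show n - 1 - j = k + 1 by omega] at hz
    field_simp
    linear_combination (height n w g z - height n w g (w (k + 1))) * h3 -
      (height n w g (w k) - height n w g (w (k + 1))) * hz
  · rw [height_lineMap]
    field_simp
    ring

/-- The base seen from the coordinates. -/
theorem mem_base (h : IsFunnelLoop n t w g) {z : ℝ × ℝ} (hy : height n w g z = 0) {s : ℝ}
    (hs : s * (along n w (w 0) - along n w (w (n - 1))) = along n w z - along n w (w (n - 1))) :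
    z = AffineMap.lineMap (w (n - 1)) (w 0) s := by
  refine h.eq_of_coords ?_ ?_
  · rw [along_lineMap]; linear_combination -hs
  · rw [height_lineMap, hy, height_zero, height_last]; ring

theorem along_base_pos (h : IsFunnelLoop n t w g) :
    0 < along n w (w 0) - along n w (w (n - 1)) := by
  have := h.baseSq_pos
  simp only [baseSq, along] at *
  linarith

/-- A point off the boundary satisfies its three inequalities strictly, so it is in an open triangle
`T`. This triangle is connected, misses the boundary and reaches down to the base, next to which the
side `g` is not outer. -/
theorem region_subset (h : IsFunnelLoop n t w g) :
    h.chart.region ⊆ (outerSet (loopBoundary w))ᶜ := by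
  intro z hz
  by_cases hzB : z ∈ loopBoundary w
  · exact fun hout => hout.1 hzB
  have hn := h.three_le
  have ht := h.t_lt
  have hb := h.along_base_pos
  have hchart0 : h.chart.b 0 = w (n - 1) := rfl
  obtain ⟨i, hi, hA⟩ : ∃ i < h.chart.p, 0 < h.chart.A i z := by
    refine (FunnelChart.exists_A_pos hz).resolve_right ?_
    rintro ⟨i, hi, h1, h2, h3⟩
    exact hzB (mem_iUnion.2 ⟨i, h.mem_boundary_of_A hi h1 h2 h3⟩)
  obtain ⟨j, hj, hB⟩ : ∃ j < h.chart.q, 0 < h.chart.B j z := by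
    refine (FunnelChart.exists_A_pos (C := h.chart.symm) (by rwa [h.chart.symm_region])).resolve_right
      ?_
    rintro ⟨j, hj, h1, h2, h3⟩
    exact hzB (h.mem_boundary_of_B hj h1 h2 h3)
  -- At height zero, comparison with the lowest edges would put the point between the two ends of
  -- the base.
  have hy : 0 < height n w g z := by
    refine lt_of_le_of_ne hz.1 fun hy => hzB ?_
    have h1 := FunnelChart.A_le_zero_of_y (C := h.chart) hi hy.symm
    have h2 : h.chart.B j z ≤ h.chart.B 0 z :=
      FunnelChart.A_le_zero_of_y (C := h.chart.symm) hj hy.symm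
    have h3 := FunnelChart.A_left (C := h.chart) h.chart.p_pos
    have h4 := FunnelChart.B_left (C := h.chart) h.chart.q_pos
    simp only [FunnelChart.A, FunnelChart.B, chart, Nat.sub_zero] at hA hB h1 h2 h3 h4
    rw [← hy] at hA hB h1 h2
    rw [height_zero] at h1 h3
    rw [height_last] at h2 h4
    refine mem_iUnion.2 ⟨n - 1, ?_⟩
    rw [Nat.sub_add_cancel (by omega), h.w_n, segment_eq_image_lineMap]
    refine ⟨(along n w z - along n w (w (n - 1))) / (along n w (w 0) - along n w (w (n - 1))),
      ⟨div_nonneg (by linarith) hb.le, (div_le_one hb).2 (by linarith)⟩,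
      (h.mem_base hy.symm (div_mul_cancel₀ _ hb.ne')).symm⟩
  set T : Set (ℝ × ℝ) := {y | 0 < height n w g y ∧ 0 < h.chart.A i y ∧ 0 < h.chart.B j y} with hT
  have hTconv : Convex ℝ T := by
    rw [convex_iff_segment_subset]
    rintro u ⟨u1, u2, u3⟩ v ⟨v1, v2, v3⟩ y hy
    rw [segment_eq_image_lineMap] at hy
    obtain ⟨s, hs, rfl⟩ := hy
    have key : ∀ a b : ℝ, 0 < a → 0 < b → 0 < (1 - s) * a + s * b := by
      intro a b ha hb
      rcases hs.1.eq_or_lt with h0 | h0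
      · rw [← h0]; linarith
      · have := mul_pos h0 hb
        have := mul_nonneg (sub_nonneg.2 hs.2) ha.le
        linarith
    refine ⟨?_, ?_, ?_⟩
    · rw [height_lineMap]; exact key _ _ u1 v1
    · rw [FunnelChart.A_line]; exact key _ _ u2 v2
    · change 0 < h.chart.symm.A j _
      rw [FunnelChart.A_line]; exact key _ _ u3 v3
  have hTB : T ⊆ univ \ loopBoundary w := by
    rintro y ⟨y1, y2, y3⟩
    refine ⟨mem_univ _, fun hyB => ?_⟩
    obtain ⟨s, h0, h1, ⟨i', hi', rfl⟩ | ⟨j', hj', rfl⟩ | rfl⟩ := h.mem_boundary_cases hyB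
    · exact absurd y2 (not_lt.2 (FunnelChart.A_lineMap_nonpos (C := h.chart) hi' hi h0 h1))
    · exact absurd y3 (not_lt.2 (FunnelChart.A_lineMap_nonpos (C := h.chart.symm) hj' hj h0 h1))
    · rw [height_lineMap, hchart0, height_zero, height_last] at y1
      simp at y1
  refine (saturated_outerSet _).compl T hTconv.isPreconnected hTB ?_ ⟨hy, hA, hB⟩
  -- a point of the base below the open triangle
  set X : ℝ := (h.chart.c i - h.chart.c' j) / 2 with hX
  set s : ℝ := (X - along n w (w (n - 1))) / (along n w (w 0) - along n w (w (n - 1))) with hs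
  have hsmul : s * (along n w (w 0) - along n w (w (n - 1))) = X - along n w (w (n - 1)) :=
    div_mul_cancel₀ _ hb.ne'
  set b₀ : ℝ × ℝ := AffineMap.lineMap (w (n - 1)) (w 0) s with hb₀
  have hb₀y : height n w g b₀ = 0 := by
    rw [hb₀, height_lineMap, height_zero, height_last]; ring
  have hb₀x : along n w b₀ = X := by
    rw [hb₀, along_lineMap]; linear_combination hsmul
  -- This is the length, in the coordinate along the base, of the bottom side of the triangle; its
  -- midpoint has coordinate `X`.
  have hsum : 0 < h.chart.c i + h.chart.c' j := by
    have h1 := FunnelChart.add_strictAnti (C := h.chart) hi hj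
      (show height n w g b₀ < height n w g z by rw [hb₀y]; exact hy)
    have h2 := h.chart.x_add b₀
    have h3 : h.chart.y b₀ = 0 := hb₀y
    have h4 : h.chart.A i b₀ + h.chart.B j b₀ = h.chart.c i + h.chart.c' j := by
      simp only [FunnelChart.A, FunnelChart.B, h3]
      linear_combination -h2
    linarith
  have hA₀ : 0 < h.chart.A i b₀ := by
    have h3 : h.chart.y b₀ = 0 := hb₀y
    have h4 : h.chart.x b₀ = X := hb₀x
    rw [FunnelChart.A, h3, h4, hX]
    linarith
  have hB₀ : 0 < h.chart.B j b₀ := by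
    have h3 : h.chart.y b₀ = 0 := hb₀y
    have h4 : h.chart.x' b₀ = -X := congrArg Neg.neg hb₀x
    rw [FunnelChart.B, h3, h4, hX]
    linarith
  have hs0 : 0 < s := by
    refine div_pos ?_ hb
    have h1 : h.chart.B j (h.chart.b 0) ≤ 0 :=
      FunnelChart.A_vertex_nonpos (C := h.chart.symm) hj (Nat.zero_le _)
    rw [FunnelChart.B, h.chart.y_b_zero] at h1
    have h2 : h.chart.x' (h.chart.b 0) = -along n w (w (n - 1)) := rfl
    linarith
  have hs1 : s < 1 := by
    rw [hs, div_lt_one hb]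
    have h1 : h.chart.A i (h.chart.a 0) ≤ 0 :=
      FunnelChart.A_vertex_nonpos (C := h.chart) hi (Nat.zero_le _)
    rw [FunnelChart.A, h.chart.y_a_zero] at h1
    have h2 : h.chart.x (h.chart.a 0) = along n w (w 0) := rfl
    linarith
  have hbo : b₀ ∈ openSegment ℝ (w (n - 1)) (w (n - 1 + 1)) := by
    rw [Nat.sub_add_cancel (by omega), h.w_n, openSegment_eq_image_lineMap]
    exact ⟨s, ⟨hs0, hs1⟩, rfl⟩
  have hside : Side g (outerSet (loopBoundary w))ᶜ (w (n - 1)) (w (n - 1 + 1)) b₀ :=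
    (h.inner (n - 1)).side_left isOpen_univ h.ne_zero (h.isChainCorner (h.turn _) (mem_univ _))
      (h.isOpenEdge fun _ _ => mem_univ _) (saturated_outerSet _).compl hbo
  have hb00 := orient_segment_eq_zero (openSegment_subset_segment ℝ _ _ hbo)
  have hfreq := frequently_orient_pos h.ne_zero (h.ne_succ (n - 1)) hb00
  rw [Nat.sub_add_cancel (by omega), h.w_n] at hside hfreq
  have hcy : Continuous (height n w g) := continuous_mul_orient _ _ _
  have hcx : Continuous (along n w) := by unfold along; fun_prop
  have hcA : Continuous (h.chart.A i) := by
    have : h.chart.A i = fun z => h.chart.c i + h.chart.m i * height n w g z - along n w z := rfl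
    rw [this]; fun_prop
  have hcB : Continuous (h.chart.B j) := by
    have : h.chart.B j = fun z => h.chart.c' j + h.chart.m' j * height n w g z - -along n w z := rfl
    rw [this]; fun_prop
  obtain ⟨y, y1, y2, y3, y4⟩ := (hfreq.and_eventually (hside.and
    ((hcA.continuousAt.eventually (lt_mem_nhds hA₀)).and
      (hcB.continuousAt.eventually (lt_mem_nhds hB₀))))).exists
  exact ⟨y, ⟨y1, y3, y4⟩, y2 y1⟩

theorem region_eq (h : IsFunnelLoop n t w g) : h.chart.region = (outerSet (loopBoundary w))ᶜ :=
  subset_antisymm h.region_subset (compl_subset_comm.1 h.compl_region_subset)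

end IsFunnelLoop

/-! ## The greedy path -/

namespace FunnelChart

variable (C : FunnelChart)

open Classical in
/-- One step of the greedy matching of the edges of the two chains. -/
noncomputable def step (s : ℕ × ℕ) : ℕ × ℕ :=
  (if C.B s.2 (C.a (s.1 + 1)) < 0 then s.1 else s.1 + 1,
    if C.A s.1 (C.b (s.2 + 1)) < 0 then s.2 else s.2 + 1)

/-- The greedy matching. -/
noncomputable def path (k : ℕ) : ℕ × ℕ := C.step^[k] (0, 0)

theorem path_succ (k : ℕ) : C.path (k + 1) = C.step (C.path k) :=
  Function.iterate_succ_apply' _ _ _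

variable {C}

theorem step_sum {s : ℕ × ℕ} (hi : s.1 < C.p) (hj : s.2 < C.q) :
    s.1 + s.2 + 1 ≤ (C.step s).1 + (C.step s).2 := by
  simp only [step]
  by_cases h : C.A s.1 (C.b (s.2 + 1)) < 0
  · rw [if_neg (not_lt.2 (B_nonneg_of_A_neg hi hj h))]
    split <;> omega
  · rw [if_neg h]
    split <;> omega

/-- No vertex of the other chain is behind the last edge of a chain, while the apex is behind every
earlier edge. So a chain at its last edge waits for the other one, and both end together. -/
theorem step_cases {s : ℕ × ℕ} (hi : s.1 < C.p) (hj : s.2 < C.q) :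
    (C.step s).1 < C.p ∧ (C.step s).2 < C.q ∨ (C.step s).1 = C.p ∧ (C.step s).2 = C.q := by
  obtain ⟨i, j⟩ := s
  simp only [step] at hi hj ⊢
  have hA : i + 1 = C.p → ¬ C.A i (C.b (j + 1)) < 0 := by
    intro hp
    obtain rfl : i = C.p - 1 := by omega
    exact not_lt.2 (A_last_vertex_nonneg hj)
  have hB : j + 1 = C.q → ¬ C.B j (C.a (i + 1)) < 0 := by
    intro hq
    obtain rfl : j = C.q - 1 := by omega
    exact not_lt.2 (C.symm.A_last_vertex_nonneg hi)
  have hA' : j + 1 = C.q → i + 1 < C.p → C.A i (C.b (j + 1)) < 0 := by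
    intro hq hip
    rw [hq, ← C.apex]
    exact A_apex_neg hip
  have hB' : i + 1 = C.p → j + 1 < C.q → C.B j (C.a (i + 1)) < 0 := by
    intro hp hjq
    rw [hp, C.apex]
    exact C.symm.A_apex_neg hjq
  by_cases hp : i + 1 = C.p <;> by_cases hq : j + 1 = C.q
  · rw [if_neg (hA hp), if_neg (hB hq)]
    exact Or.inr ⟨hp, hq⟩
  · rw [if_neg (hA hp), if_pos (hB' hp (by omega))]
    exact Or.inl ⟨hi, by omega⟩
  · rw [if_neg (hB hq), if_pos (hA' hq (by omega))]
    exact Or.inl ⟨by omega, hj⟩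
  · left
    constructor <;> split <;> omega

/-- Each step advances at least one index, so the edges of both chains together bound the number of
steps. -/
theorem exists_trace (C : FunnelChart) : ∃ N ≤ C.p + C.q,
    C.Trace N (fun k => (C.path k).1) (fun k => (C.path k).2)
      (fun k => C.A (C.path k).1 (C.b ((C.path k).2 + 1)) < 0)
      (fun k => C.B (C.path k).2 (C.a ((C.path k).1 + 1)) < 0) := by
  classical
  have hp := C.p_pos
  have hq := C.q_pos
  have hex : ∃ N, C.p ≤ (C.path N).1 := by
    by_contra! hno
    have key : ∀ k, (C.path k).2 < C.q ∧ k ≤ (C.path k).1 + (C.path k).2 := by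
      intro k
      induction k with
      | zero => exact ⟨hq, Nat.zero_le _⟩
      | succ k ih =>
        have h1 := step_cases (hno k) ih.1
        have h2 := step_sum (hno k) ih.1
        have h3 := hno (k + 1)
        rw [path_succ] at h3 ⊢
        omega
    have h1 := key (C.p + C.q)
    have h2 := hno (C.p + C.q)
    omega
  have hlt : ∀ k < Nat.find hex, (C.path k).1 < C.p := fun k hk => not_le.1 (Nat.find_min hex hk)
  have key : ∀ k ≤ Nat.find hex, k ≤ (C.path k).1 + (C.path k).2 ∧
      ((C.path k).1 < C.p ∧ (C.path k).2 < C.q ∨ (C.path k).1 = C.p ∧ (C.path k).2 = C.q) := by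
    intro k
    induction k with
    | zero => exact fun _ => ⟨Nat.zero_le _, Or.inl ⟨hp, hq⟩⟩
    | succ k ih =>
      intro hk
      have h0 := hlt k (by omega)
      obtain ⟨h1, h2⟩ := ih (by omega)
      have h3 : (C.path k).2 < C.q := by omega
      have h4 := step_sum h0 h3
      rw [path_succ]
      exact ⟨by omega, step_cases h0 h3⟩
  have hend := key _ le_rfl
  have hN := Nat.find_spec hex
  refine ⟨Nat.find hex, by omega, ⟨rfl, rfl, hlt, fun k hk => ?_, fun k _ => ?_, fun k _ => ?_,
    fun _ _ => Iff.rfl, fun _ _ => Iff.rfl, by omega, by omega⟩⟩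
  · have := key k hk.le
    have := hlt k hk
    omega
  · simp only [path_succ, step]
    exact ⟨fun h => if_pos h, fun h => if_neg h⟩
  · simp only [path_succ, step]
    exact ⟨fun h => if_pos h, fun h => if_neg h⟩

/-- The vertices of the triangle cut out of the half plane above the base by the edges `i` and `j`
of the two chains. -/
structure Corners (C : FunnelChart) (i j : ℕ) (P Q R : ℝ × ℝ) : Prop where
  y_P : C.y P = 0
  A_P : C.A i P = 0
  y_Q : C.y Q = 0
  B_Q : C.B j Q = 0
  A_R : C.A i R = 0
  B_R : C.B j R = 0

end FunnelChart

/-! ### The triangles of the matching -/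

namespace IsFunnelLoop

variable {n t : ℕ} {w : ℕ → ℝ × ℝ} {g : ℝ}

/-- The triangle of a node. -/
def triangle (h : IsFunnelLoop n t w g) (i j : ℕ) : Set (ℝ × ℝ) :=
  {z | 0 ≤ height n w g z ∧ 0 ≤ h.chart.A i z ∧ 0 ≤ h.chart.B j z}

theorem convex_triangle (h : IsFunnelLoop n t w g) (i j : ℕ) : Convex ℝ (h.triangle i j) := by
  rw [convex_iff_segment_subset]
  rintro u ⟨u1, u2, u3⟩ v ⟨v1, v2, v3⟩ y hy
  rw [segment_eq_image_lineMap] at hy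
  obtain ⟨s, hs, rfl⟩ := hy
  have key : ∀ a b : ℝ, 0 ≤ a → 0 ≤ b → 0 ≤ (1 - s) * a + s * b := fun a b ha hb =>
    add_nonneg (mul_nonneg (sub_nonneg.2 hs.2) ha) (mul_nonneg hs.1 hb)
  refine ⟨?_, ?_, ?_⟩
  · rw [height_lineMap]; exact key _ _ u1 v1
  · rw [FunnelChart.A_line]; exact key _ _ u2 v2
  · change 0 ≤ h.chart.symm.A j _
    rw [FunnelChart.A_line]; exact key _ _ u3 v3

/-- By `o1`, `o2` and `o3`, the barycentric coordinates are positive multiples of the height and of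
the two edge functions. The hypothesis `hpos` makes the bottom side nondegenerate and puts `R`
strictly above it. -/
theorem corners_hull (h : IsFunnelLoop n t w g) {i j : ℕ} {P Q R : ℝ × ℝ} (hi : i < t)
    (hj : j < n - 1 - t) (hc : h.chart.Corners i j P Q R)
    (hpos : ∀ z, height n w g z = 0 → 0 < h.chart.A i z + h.chart.B j z) :
    orient P Q R ≠ 0 ∧ convexHull ℝ {P, Q, R} = h.triangle i j := by
  have hb := h.baseSq_pos
  have hg := h.ne_zero
  have hyR : 0 < height n w g R := by
    by_contra! hle
    have h1 := FunnelChart.add_anti (C := h.chart) hi hj (z := R) (w := P)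
      (by rw [hc.y_P]; exact hle)
    have h2 := hpos P hc.y_P
    have h3 := hc.A_R
    have h4 := hc.B_R
    linarith
  have eP := hpos P hc.y_P
  have eQ := hpos Q hc.y_Q
  have y_P : height n w g P = 0 := hc.y_P
  have y_Q : height n w g Q = 0 := hc.y_Q
  have aP := hc.A_P
  have bQ := hc.B_Q
  have aR := hc.A_R
  have bR := hc.B_R
  rw [aP, zero_add] at eP
  rw [bQ, add_zero] at eQ
  have hAd : ∀ z, h.chart.A i z = h.chart.c i + h.chart.m i * height n w g z - along n w z :=
    fun z => rfl
  have hBd : ∀ z, h.chart.B j z = h.chart.c' j + h.chart.m' j * height n w g z + along n w z :=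
    fun z => sub_neg_eq_add _ _
  have o1 : ∀ z, baseSq n w * (g * orient P Q z) =
      -(h.chart.B j P * height n w g z) := by
    intro z
    rw [orient_eq, y_P, y_Q]
    rw [hBd, y_P]
    rw [hBd, y_Q] at bQ
    linear_combination height n w g z * bQ
  have o2 : ∀ z, baseSq n w * (g * orient Q R z) = -(height n w g R * h.chart.B j z) := by
    intro z
    rw [orient_eq, y_Q, hBd]
    rw [hBd, y_Q] at bQ
    rw [hBd] at bR
    linear_combination (height n w g R - height n w g z) * bQ + height n w g z * bR
  have o3 : ∀ z, baseSq n w * (g * orient R P z) = -(height n w g R * h.chart.A i z) := by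
    intro z
    rw [orient_eq, y_P, hAd]
    rw [hAd, y_P] at aP
    rw [hAd] at aR
    linear_combination (height n w g R - height n w g z) * aP + height n w g z * aR
  have hD := o1 R
  have hDneg : baseSq n w * (g * orient P Q R) < 0 := by
    rw [hD]
    exact neg_neg_of_pos (mul_pos eP hyR)
  have hD0 : orient P Q R ≠ 0 := by
    intro h0
    rw [h0, mul_zero, mul_zero] at hDneg
    exact lt_irrefl _ hDneg
  refine ⟨hD0, subset_antisymm ?_ ?_⟩
  · refine convexHull_min ?_ (h.convex_triangle i j)
    rintro z (rfl | rfl | rfl)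
    · exact ⟨y_P.ge, aP.ge, eP.le⟩
    · exact ⟨y_Q.ge, eQ.le, bQ.ge⟩
    · exact ⟨hyR.le, aR.ge, bR.ge⟩
  · rintro z ⟨z1, z2, z3⟩
    have key : ∀ X : ℝ, baseSq n w * (g * X) ≤ 0 → 0 ≤ X / orient P Q R := by
      intro X hX
      have hbg : baseSq n w * g ≠ 0 := mul_ne_zero hb.ne' hg
      rw [← mul_div_mul_left X _ hbg, mul_assoc, mul_assoc]
      exact div_nonneg_of_nonpos hX hDneg.le
    refine mem_triangle hD0 (key _ ?_) (key _ ?_) (key _ ?_)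
    · rw [o2]
      exact neg_nonpos_of_nonneg (mul_nonneg hyR.le z3)
    · rw [o3]
      exact neg_nonpos_of_nonneg (mul_nonneg hyR.le z2)
    · rw [o1]
      exact neg_nonpos_of_nonneg (mul_nonneg eP.le z1)

end IsFunnelLoop

/-! ### Placing a point near the upper end of an edge -/

/-- The position on an edge of a point in its interior that is strictly on the negative side of a
line, given the values of an affine function at the two ends, if the second one is negative. -/
noncomputable def hideParam (e f : ℝ) : ℝ :=
  if 0 ≤ f then 1 / 2 else 1 - f * f / (2 * (f * f + (e - f) * (e - f)))

theorem hideParam_mem (e f : ℝ) : 0 < hideParam e f ∧ hideParam e f < 1 := by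
  unfold hideParam
  split_ifs with h
  · norm_num
  · have hf : 0 < f * f := mul_pos_of_neg_of_neg (not_le.1 h) (not_le.1 h)
    have hd := mul_self_nonneg (e - f)
    have h1 : 0 < f * f / (2 * (f * f + (e - f) * (e - f))) := by positivity
    have h2 : f * f / (2 * (f * f + (e - f) * (e - f))) < 1 := by
      rw [div_lt_one (by positivity)]
      linarith
    constructor <;> linarith

/-- With `r = 1 - hideParam e f` the value is `f + r * (e - f)`, and `r` is chosen such that `r * |e
- f|` is less than `|f|` whatever `e` is, by field operations only. -/
theorem hideParam_neg {e f : ℝ} (h : f < 0) :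
    (1 - hideParam e f) * e + hideParam e f * f < 0 := by
  have hf : 0 < f * f := mul_pos_of_neg_of_neg h h
  have hd := mul_self_nonneg (e - f)
  have hD : 0 < 2 * (f * f + (e - f) * (e - f)) := by positivity
  rw [hideParam, if_neg (not_le.2 h)]
  set X : ℝ := f * f + (e - f) * (e - f) with hX
  have : (1 - (1 - f * f / (2 * X))) * e + (1 - f * f / (2 * X)) * f =
      f * (2 * X + f * (e - f)) / (2 * X) := by
    have : X ≠ 0 := ne_of_gt (by linarith)
    field_simp
    ring
  rw [this]
  refine div_neg_of_neg_of_pos (mul_neg_of_neg_of_pos h ?_) hD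
  nlinarith [sq_nonneg (f + (e - f))]

/-! ## The program -/

namespace RealRAM

/-- Expressions for points. -/
abbrev PExp := RExp × RExp

namespace PExp

/-- The value of a point expression. -/
noncomputable def eval (s : State) (e : PExp) : ℝ × ℝ := (e.1.eval s, e.2.eval s)

/-- No division by zero occurs in the evaluation. -/
def Defined (s : State) (e : PExp) : Prop := e.1.Defined s ∧ e.2.Defined s

/-- The point stored at the address in the register `a`, plus `off`. -/
def cell (a off : ℕ) : PExp := (.ld a off, .ld a (off + 1))

/-- Twice the signed area of a triangle. -/
def area (p q r : PExp) : RExp :=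
  .sub (.mul (.sub q.1 p.1) (.sub r.2 p.2)) (.mul (.sub q.2 p.2) (.sub r.1 p.1))

/-- The point that divides the segment `p q` in the ratio given by `r`. -/
def line (p q : PExp) (r : RExp) : PExp :=
  (.add (.mul r (.sub q.1 p.1)) p.1, .add (.mul r (.sub q.2 p.2)) p.2)

/-- The point of the line `p q` on the line `a b`. -/
def meet (a b p q : PExp) : PExp :=
  line p q (.div (area a b p) (.sub (area a b p) (area a b q)))

/-- Expression for `hideParam`. -/
def hide (e f : RExp) : RExp :=
  .sel f (.const (1 / 2)) (.sub (.const 1) (.div (.mul f f)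
    (.mul (.const 2) (.add (.mul f f) (.mul (.sub e f) (.sub e f))))))

variable {s : State}

theorem eval_cell (a off : ℕ) : (PExp.cell a off).eval s = s.pointAt (s.ireg a + off) := rfl

theorem defined_cell (a off : ℕ) : (PExp.cell a off).Defined s := ⟨trivial, trivial⟩

theorem eval_area (p q r : PExp) :
    (area p q r).eval s = orient (p.eval s) (q.eval s) (r.eval s) := rfl

theorem defined_area {p q r : PExp} (hp : p.Defined s) (hq : q.Defined s) (hr : r.Defined s) :
    (area p q r).Defined s :=
  ⟨⟨⟨hq.1, hp.1⟩, hr.2, hp.2⟩, ⟨hq.2, hp.2⟩, hr.1, hp.1⟩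

theorem eval_line (p q : PExp) (r : RExp) :
    (line p q r).eval s = AffineMap.lineMap (p.eval s) (q.eval s) (r.eval s) := by
  rw [AffineMap.lineMap_apply]
  rfl

theorem defined_line {p q : PExp} {r : RExp} (hp : p.Defined s) (hq : q.Defined s)
    (hr : r.Defined s) : (line p q r).Defined s :=
  ⟨⟨⟨hr, hq.1, hp.1⟩, hp.1⟩, ⟨hr, hq.2, hp.2⟩, hp.2⟩

theorem eval_meet (a b p q : PExp) : (meet a b p q).eval s =
    AffineMap.lineMap (p.eval s) (q.eval s)
      (orient (a.eval s) (b.eval s) (p.eval s) /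
        (orient (a.eval s) (b.eval s) (p.eval s) -
          orient (a.eval s) (b.eval s) (q.eval s))) :=
  eval_line _ _ _

theorem defined_meet {a b p q : PExp} (ha : a.Defined s) (hb : b.Defined s) (hp : p.Defined s)
    (hq : q.Defined s) (hne : orient (a.eval s) (b.eval s) (p.eval s) -
      orient (a.eval s) (b.eval s) (q.eval s) ≠ 0) : (meet a b p q).Defined s :=
  defined_line hp hq ⟨defined_area ha hb hp, ⟨defined_area ha hb hp, defined_area ha hb hq⟩,
    hne⟩

theorem eval_hide (e f : RExp) : (hide e f).eval s = hideParam (e.eval s) (f.eval s) := by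
  simp [hide, RExp.eval, hideParam]

theorem defined_hide {e f : RExp} (he : e.Defined s) (hf : f.Defined s) :
    (hide e f).Defined s := by
  refine ⟨hf, fun _ => trivial, fun h => ⟨trivial, ⟨hf, hf⟩,
    ⟨trivial, ⟨hf, hf⟩, ⟨he, hf⟩, he, hf⟩, ?_⟩⟩
  have h1 : 0 < f.eval s * f.eval s := mul_pos_of_neg_of_neg h h
  have h2 := mul_self_nonneg (e.eval s - f.eval s)
  simp only [RExp.eval, Rat.cast_ofNat]
  positivity

end PExp

/-- The lower vertex of the edge `i`. In the expressions for the vertices next to the current edges `i`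
and `j`, register `5` holds `2 * i`, register `6`
twice the number of the upper vertex of the edge `j` of the second chain, register `7` the address of
the vertex before `i`; registers `20` and `21` point to the two ends of the base. -/
def pa : PExp := .cell 5 0
/-- The upper vertex of the edge `i`. -/
def pa' : PExp := .cell 5 2
/-- The lower vertex of the edge `j`. -/
def pb : PExp := .cell 6 2
/-- The upper vertex of the edge `j`. -/
def pb' : PExp := .cell 6 0
/-- The vertex before the edge `i`. -/
def paPrev : PExp := .cell 7 0
/-- The vertex before the edge `j`. -/
def pbPrev : PExp := .cell 6 4
/-- The first vertex. -/
def pFirst : PExp := .cell 20 0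
/-- The last vertex. -/
def pLast : PExp := .cell 21 0

/-- The orientation of the polygon. -/
def turn : RExp := PExp.area pLast pFirst (.cell 20 2)

/-- The point of the base on the line through the edge `i`. -/
def corner₁ : PExp := .meet pLast pFirst pa pa'
/-- The point of the base on the line through the edge `j`. -/
def corner₂ : PExp := .meet pLast pFirst pb pb'
/-- The point on the lines through both edges. -/
def corner₃ : PExp := .meet pa pa' pb pb'
/-- The candidate on the edge `i`. -/
def candA : PExp := .line pa pa' (PExp.hide (.mul turn (PExp.area pb pbPrev pa))
  (.mul turn (PExp.area pb pbPrev pa')))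
/-- The candidate on the edge `j`. -/
def candB : PExp := .line pb pb' (PExp.hide (.mul turn (PExp.area paPrev pa pb))
  (.mul turn (PExp.area paPrev pa pb')))

/-- Computing the address of the vertex before `i`. -/
def prep : Cmd := .seq (.sum 7 5 20) (.dec 7 2)

/-- The choice of the next edges. -/
def advance : Cmd :=
  .iteNonneg (.mul turn (PExp.area pa pa' pb'))
    (.iteNonneg (.mul turn (PExp.area pb' pb pa'))
      (.seq (.set 13 0) (.seq (.inc 5 2) (.dec 6 2)))
      (.seq (.set 13 2) (.dec 6 2)))
    (.seq (.set 13 1) (.inc 5 2))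

/-- Bookkeeping at the end of a round. -/
def record : Cmd :=
  .seq (.put 11 12) (.seq (.put 10 13) (.seq (.inc 8 6) (.seq (.inc 9 4) (.seq (.inc 10 1)
    (.seq (.inc 11 1) (.inc 12 3))))))

/-- Writing the triangle and the two candidates. -/
def output : Cmd :=
  .seq (.store 8 [corner₁.1, corner₁.2, corner₂.1, corner₂.2, corner₃.1, corner₃.2])
    (.store 9 [candA.1, candA.2, candB.1, candB.2])

/-- The round of the main loop. -/
def round : Cmd := .seq prep (.seq output (.seq advance record))

/-- The initialization. -/
def init : Cmd :=
  -- Registers `8` and `9` get `2 * n` and `8 * n`, where triangles and candidates will go; `10` and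
  -- `11` are the addresses for flags and offsets. Register `20` remains `0` throughout and is also
  -- the address of the first vertex.
  .seq (.set 20 0) (.seq (.sum 21 0 0) (.seq (.dec 21 2) (.seq (.set 5 0) (.seq (.sum 6 0 0)
    (.seq (.dec 6 4) (.seq (.sum 8 0 0) (.seq (.sum 9 8 8) (.seq (.sum 9 9 9) (.seq (.set 10 0)
      (.seq (.sum 11 0 20) (.set 12 0)))))))))))

/-- Between the two loops: the address of the hidden set is computed. -/
def between : Cmd :=
  -- The first instruction closes the offset table with `3 * N`. Register `22`, the side attributed
  -- to the step after the last, is `1` by default. Register `16` is built up to `12 * n` and then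
  -- moved past the last point.
  .seq (.put 11 12) (.seq (.set 14 1) (.seq (.set 22 1) (.seq (.sum 16 0 0) (.seq (.sum 16 16 0)
    (.seq (.sum 16 16 16) (.seq (.sum 16 16 16) (.seq (.sum 1 16 20) (.seq (.sum 16 16 10)
      (.seq (.sum 16 16 10) (.sum 2 10 20))))))))))

/-- The round of the second loop, which goes backwards and selects one of the two candidates. -/
def choose : Cmd :=
  .seq (.dec 10 1) (.seq (.dec 9 4) (.seq (.dec 16 2) (.seq (.load 23 10)
    -- Register `14` holds `1`, so a nonzero flag becomes the new side; `inc 22 0` does nothing and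
    -- keeps the side of the following step.
    (.seq (.iteLe 14 23 (.sum 22 23 20) (.inc 22 0))
      (.iteLe 22 14 (.store 16 [.ld 9 0, .ld 9 1]) (.store 16 [.ld 9 2, .ld 9 3]))))))

/-- The final registers. -/
def final : Cmd := .seq (.sum 3 0 20) (.seq (.sum 4 0 0) (.sum 0 2 20))

/-- The algorithm. -/
def funnelProgram : Program :=
  -- The first guard compares `i` with `n - 2 - j`. While edges remain, `i < t ≤ n - 2 - j`; at the
  -- end `i = t` and `n - 2 - j = t - 1`.
  .seq init.code (.seq (.while (.natLe 5 6) round.code) (.seq between.code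
    (.seq (.while (.natLe 14 10) choose.code) final.code)))

theorem wf_all : init.wf = true ∧ round.wf = true ∧ between.wf = true ∧ choose.wf = true ∧
    final.wf = true := by decide

end RealRAM

namespace FunnelChart

/-- A point on the edge `i` of the first chain that is behind the edge before `j` of the second chain
whenever the upper end of `i` is. -/
structure GoodA (C : FunnelChart) (i j : ℕ) (u : ℝ × ℝ) : Prop where
  onA : C.OnA i u
  neg : ∀ k, j = k + 1 → C.B k (C.a (i + 1)) < 0 → C.B k u < 0

/-- A point on the edge `j` of the second chain that is behind the edge before `i` of the first chain
whenever the upper end of `j` is. -/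
abbrev GoodB (C : FunnelChart) (i j : ℕ) (u : ℝ × ℝ) : Prop := C.symm.GoodA j i u

open Classical in
/-- Which chains advance: `1` for only the first one, `2` for only the second one, `0` for both. -/
noncomputable def flag (C : FunnelChart) (s : ℕ × ℕ) : ℕ :=
  if C.A s.1 (C.b (s.2 + 1)) < 0 then 1 else if C.B s.2 (C.a (s.1 + 1)) < 0 then 2 else 0

end FunnelChart

/-! ### Reading the memory -/

namespace RealRAM

theorem writeBlock_of_lt {M : ℕ → ℝ} {b m : ℕ} {val : ℕ → ℝ} {x : ℕ} (h : x < b) :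
    writeBlock M b m val x = M x := if_neg (by omega)

theorem writeBlock_of_ge {M : ℕ → ℝ} {b m : ℕ} {val : ℕ → ℝ} {x : ℕ} (h : b + m ≤ x) :
    writeBlock M b m val x = M x := if_neg (by omega)

theorem writeBlock_add {M : ℕ → ℝ} {b m : ℕ} {val : ℕ → ℝ} {x : ℕ} (h : x < m) :
    writeBlock M b m val (b + x) = val x := by
  rw [writeBlock, if_pos (by omega), Nat.add_sub_cancel_left]

theorem pointAt_store_of_lt {s : State} {a : ℕ} {es : List RExp} {x : ℕ} (h : x + 1 < s.ireg a) :
    ((Cmd.store a es).eval s).pointAt x = s.pointAt x := by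
  simp only [Cmd.eval, State.pointAt]
  rw [writeBlock_of_lt (by omega), writeBlock_of_lt h]

theorem pointAt_store_of_ge {s : State} {a : ℕ} {es : List RExp} {x : ℕ}
    (h : s.ireg a + es.length ≤ x) : ((Cmd.store a es).eval s).pointAt x = s.pointAt x := by
  simp only [Cmd.eval, State.pointAt]
  rw [writeBlock_of_ge h, writeBlock_of_ge (by omega)]

theorem pointAt_store {s : State} {a : ℕ} {es : List RExp} {x o : ℕ} (hx : x = s.ireg a + o)
    (ho : o + 1 < es.length) : ((Cmd.store a es).eval s).pointAt x =
      ((es[o]'(by omega)).eval s, es[o + 1].eval s) := by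
  subst hx
  simp only [Cmd.eval, State.pointAt]
  rw [writeBlock_add (by omega), Nat.add_assoc, writeBlock_add ho, List.getD_eq_getElem _ _ (by simp; omega),
    List.getD_eq_getElem _ _ (by simpa using ho), List.getElem_map, List.getElem_map]

/-- The configuration is at the edges `i` and `j`. -/
structure AtEdges (n : ℕ) (w : ℕ → ℝ × ℝ) (i j : ℕ) (s : State) : Prop where
  reg5 : s.ireg 5 = 2 * i
  reg6 : s.ireg 6 = 2 * (n - 2 - j)
  reg20 : s.ireg 20 = 0
  reg21 : s.ireg 21 = 2 * n - 2
  verts : ∀ l < n, s.pointAt (2 * l) = w l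

namespace AtEdges

variable {n i j : ℕ} {w : ℕ → ℝ × ℝ} {s : State}

theorem store (h : AtEdges n w i j s) {a : ℕ} {es : List RExp} (ha : 2 * n ≤ s.ireg a) :
    AtEdges n w i j ((Cmd.store a es).eval s) where
  reg5 := h.reg5
  reg6 := h.reg6
  reg20 := h.reg20
  reg21 := h.reg21
  verts l hl := by rw [pointAt_store_of_lt (by omega), h.verts l hl]

theorem eval_pa (h : AtEdges n w i j s) (hi : i < n) : pa.eval s = w i := by
  rw [pa, PExp.eval_cell, h.reg5, ← h.verts i hi, Nat.add_zero]

theorem eval_pa' (h : AtEdges n w i j s) (hi : i + 1 < n) : pa'.eval s = w (i + 1) := by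
  rw [pa', PExp.eval_cell, h.reg5, ← h.verts _ hi]
  rfl

theorem eval_pb' (h : AtEdges n w i j s) (hn : 0 < n) : pb'.eval s = w (n - 2 - j) := by
  rw [pb', PExp.eval_cell, h.reg6, ← h.verts _ (by omega), Nat.add_zero]

theorem eval_pb (h : AtEdges n w i j s) (hj : j + 2 ≤ n) : pb.eval s = w (n - 1 - j) := by
  rw [pb, PExp.eval_cell, h.reg6, ← h.verts _ (by omega), show 2 * (n - 2 - j) + 2 = 2 * (n - 1 - j) by omega]

theorem eval_pbPrev (h : AtEdges n w i (j + 1) s) (hj : j + 3 ≤ n) :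
    pbPrev.eval s = w (n - 1 - j) := by
  rw [pbPrev, PExp.eval_cell, h.reg6, ← h.verts _ (by omega),
    show 2 * (n - 2 - (j + 1)) + 4 = 2 * (n - 1 - j) by omega]

theorem eval_paPrev (h : AtEdges n w (i + 1) j s) (hi : i < n) (h7 : s.ireg 7 = 2 * (i + 1) - 2) :
    paPrev.eval s = w i := by
  rw [paPrev, PExp.eval_cell, h7, ← h.verts _ hi, show 2 * (i + 1) - 2 + 0 = 2 * i by omega]

theorem eval_pFirst (h : AtEdges n w i j s) (hn : 0 < n) : pFirst.eval s = w 0 := by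
  rw [pFirst, PExp.eval_cell, h.reg20, ← h.verts _ hn]

theorem eval_pLast (h : AtEdges n w i j s) (hn : 0 < n) : pLast.eval s = w (n - 1) := by
  rw [pLast, PExp.eval_cell, h.reg21, ← h.verts _ (by omega),
    show 2 * n - 2 + 0 = 2 * (n - 1) by omega]

theorem eval_turn (h : AtEdges n w i j s) (hn : 1 < n) :
    turn.eval s = orient (w (n - 1)) (w 0) (w 1) := by
  rw [turn, PExp.eval_area, h.eval_pFirst (by omega), h.eval_pLast (by omega), PExp.eval_cell,
    h.reg20, ← h.verts 1 hn]

end AtEdges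

/-- The quotient that occurs in `PExp.meet` gives the zero of an affine function. -/
theorem meet_zero {u v : ℝ} (h : u - v ≠ 0) : (1 - u / (u - v)) * u + u / (u - v) * v = 0 := by
  field_simp
  ring

/-! ### The expressions of the program in terms of the chart -/

section Nodes

variable {n t : ℕ} {w : ℕ → ℝ × ℝ} {s : State} {i j : ℕ}

theorem chart_b_succ (h : IsFunnelLoop n t w (orient (w (n - 1)) (w 0) (w 1))) (j : ℕ) :
    h.chart.b (j + 1) = w (n - 2 - j) := by
  change w (n - 1 - (j + 1)) = _
  congr 1
  omega

/-- The corners are well defined, and they are the corners of the triangle. -/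
theorem corners_spec (h : IsFunnelLoop n t w (orient (w (n - 1)) (w 0) (w 1)))
    (hs : AtEdges n w i j s) (hi : i < t) (hj : j < n - 1 - t) :
    (corner₁.Defined s ∧ corner₂.Defined s ∧ corner₃.Defined s) ∧
      h.chart.Corners i j (corner₁.eval s) (corner₂.eval s) (corner₃.eval s) := by
  have ht := h.t_lt
  have hg := h.ne_zero
  have e1 := hs.eval_pa (by omega)
  have e2 := hs.eval_pa' (by omega)
  have e3 := hs.eval_pb (by omega)
  have e4 := hs.eval_pb' (by omega)
  have e5 := hs.eval_pFirst (by omega)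
  have e6 := hs.eval_pLast (by omega)
  have d : ∀ a o, (PExp.cell a o).Defined s := PExp.defined_cell
  have hb := chart_b_succ h j
  have hya : h.chart.y (w i) < h.chart.y (w (i + 1)) := h.chart.y_a_succ i hi
  have hyb : h.chart.y (w (n - 1 - j)) < h.chart.y (w (n - 2 - j)) := by
    rw [← hb]; exact h.chart.y_b_succ j hj
  have bl : h.chart.B j (w (n - 1 - j)) = 0 := FunnelChart.B_left hj
  have br : h.chart.B j (w (n - 2 - j)) = 0 := by rw [← hb]; exact FunnelChart.B_right hj
  have al : h.chart.A i (w i) = 0 := FunnelChart.A_left hi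
  have ar : h.chart.A i (w (i + 1)) = 0 := FunnelChart.A_right hi
  have n1 : orient (w (n - 1)) (w 0) (w i) - orient (w (n - 1)) (w 0) (w (i + 1)) ≠ 0 :=
    sub_ne_zero.2 fun he => hya.ne (congrArg (orient (w (n - 1)) (w 0) (w 1) * ·) he)
  have n2 : orient (w (n - 1)) (w 0) (w (n - 1 - j)) -
      orient (w (n - 1)) (w 0) (w (n - 2 - j)) ≠ 0 :=
    sub_ne_zero.2 fun he => hyb.ne (congrArg (orient (w (n - 1)) (w 0) (w 1) * ·) he)
  -- The edge `j` is not parallel to the line of `i`: along it `B j` vanishes, while `A i + B j`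
  -- falls strictly.
  have n3 : orient (w i) (w (i + 1)) (w (n - 1 - j)) -
      orient (w i) (w (i + 1)) (w (n - 2 - j)) ≠ 0 := by
    intro he
    have m1 := h.chart_A_mul hi (w (n - 1 - j))
    have m2 := h.chart_A_mul hi (w (n - 2 - j))
    rw [← sub_eq_zero.1 he, ← m1] at m2
    have m3 := mul_right_cancel₀ (sub_pos.2 hya).ne' m2
    have m4 := FunnelChart.add_strictAnti (C := h.chart) hi hj hyb
    linarith
  have z1 := meet_zero n1
  have z2 := meet_zero n2
  have z3 := meet_zero n3
  rw [← orient_lineMap] at z1 z2 z3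
  refine ⟨⟨PExp.defined_meet (d _ _) (d _ _) (d _ _) (d _ _) (by rwa [e1, e2, e5, e6]),
    PExp.defined_meet (d _ _) (d _ _) (d _ _) (d _ _) (by rwa [e3, e4, e5, e6]),
    PExp.defined_meet (d _ _) (d _ _) (d _ _) (d _ _) (by rwa [e1, e2, e3, e4])⟩, ?_⟩
  rw [corner₁, corner₂, corner₃, PExp.eval_meet, PExp.eval_meet, PExp.eval_meet, e1, e2, e3, e4, e5,
    e6]
  refine ⟨mul_eq_zero_of_right _ z1, ?_, mul_eq_zero_of_right _ z2, ?_, ?_, ?_⟩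
  · rw [FunnelChart.A_line, al, ar, mul_zero, mul_zero, add_zero]
  · change h.chart.symm.A j _ = 0
    rw [FunnelChart.A_line]
    change _ * h.chart.B j _ + _ * h.chart.B j _ = 0
    rw [bl, br, mul_zero, mul_zero, add_zero]
  · have m := h.chart_A_mul hi (AffineMap.lineMap (w (n - 1 - j)) (w (n - 2 - j))
      (orient (w i) (w (i + 1)) (w (n - 1 - j)) / (orient (w i) (w (i + 1)) (w (n - 1 - j)) -
        orient (w i) (w (i + 1)) (w (n - 2 - j)))))
    rw [z3, mul_zero, mul_zero] at m
    exact (mul_eq_zero.1 m).resolve_right (sub_pos.2 hya).ne'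
  · change h.chart.symm.A j _ = 0
    rw [FunnelChart.A_line]
    change _ * h.chart.B j _ + _ * h.chart.B j _ = 0
    rw [bl, br, mul_zero, mul_zero, add_zero]

/-- If `i` or `j` is `0` there is no previous edge; the expression then reads an irrelevant cell but
stays defined, the point is on the open edge anyway, and nothing more is required of it. -/
theorem cand_spec (h : IsFunnelLoop n t w (orient (w (n - 1)) (w 0) (w 1)))
    (hs : AtEdges n w i j s) (h7 : s.ireg 7 = 2 * i - 2) (hi : i < t) (hj : j < n - 1 - t) :
    (candA.Defined s ∧ candB.Defined s) ∧ h.chart.GoodA i j (candA.eval s) ∧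
      h.chart.GoodB i j (candB.eval s) := by
  have ht := h.t_lt
  have e0 := hs.eval_turn (by omega)
  have e1 := hs.eval_pa (by omega)
  have e2 := hs.eval_pa' (by omega)
  have e3 := hs.eval_pb (by omega)
  have e4 := hs.eval_pb' (by omega)
  have d : ∀ a o, (PExp.cell a o).Defined s := PExp.defined_cell
  have dt : turn.Defined s := PExp.defined_area (d _ _) (d _ _) (d _ _)
  have da : ∀ {p q r : PExp}, p.Defined s → q.Defined s → r.Defined s →
    (RExp.mul turn (PExp.area p q r)).Defined s := fun hp hq hr =>
      ⟨dt, PExp.defined_area hp hq hr⟩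
  have ev : ∀ p q r : PExp, (RExp.mul turn (PExp.area p q r)).eval s =
      orient (w (n - 1)) (w 0) (w 1) * orient (p.eval s) (q.eval s) (r.eval s) := by
    intro p q r
    rw [RExp.eval, e0, PExp.eval_area]
  have hb := chart_b_succ h j
  refine ⟨⟨PExp.defined_line (d _ _) (d _ _)
    (PExp.defined_hide (da (d _ _) (d _ _) (d _ _)) (da (d _ _) (d _ _) (d _ _))),
    PExp.defined_line (d _ _) (d _ _)
    (PExp.defined_hide (da (d _ _) (d _ _) (d _ _)) (da (d _ _) (d _ _) (d _ _)))⟩, ⟨?_, ?_⟩, ?_, ?_⟩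
  · rw [candA, PExp.eval_line, PExp.eval_hide, e1, e2]
    exact FunnelChart.onA_lineMap (C := h.chart) hi (hideParam_mem _ _).1 (hideParam_mem _ _).2
  · rintro k rfl hneg
    have hk := h.chart_B_neg_iff (j := k) (k := n - 2 - k) (by omega) (by omega)
    rw [hk] at hneg ⊢
    rw [candA, PExp.eval_line, PExp.eval_hide, ev, ev, e1, e2, e3, hs.eval_pbPrev (by omega),
      orient_lineMap, show n - 1 - (k + 1) = n - 2 - k by omega,
      show n - 1 - k = n - 2 - k + 1 by omega]
    have := hideParam_neg (e := orient (w (n - 1)) (w 0) (w 1) *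
      orient (w (n - 2 - k)) (w (n - 2 - k + 1)) (w i)) hneg
    rw [mul_add, mul_left_comm, mul_left_comm (orient (w (n - 1)) (w 0) (w 1)) (hideParam _ _)]
    exact this
  · rw [candB, PExp.eval_line, PExp.eval_hide, e3, e4, ← hb]
    exact FunnelChart.onA_lineMap (C := h.chart.symm) hj (hideParam_mem _ _).1
      (hideParam_mem _ _).2
  · rintro k rfl hneg
    change h.chart.A k (h.chart.b (j + 1)) < 0 at hneg
    change h.chart.A k _ < 0
    have hk := h.chart_A_neg_iff (i := k) (by omega)
    rw [hk, hb] at hneg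
    rw [hk, candB, PExp.eval_line, PExp.eval_hide, ev, ev, e1, e3, e4,
      hs.eval_paPrev (by omega) h7, orient_lineMap]
    have := hideParam_neg (e := orient (w (n - 1)) (w 0) (w 1) *
      orient (w k) (w (k + 1)) (w (n - 1 - j))) hneg
    rw [mul_add, mul_left_comm, mul_left_comm (orient (w (n - 1)) (w 0) (w 1)) (hideParam _ _)]
    exact this

theorem advance_spec (h : IsFunnelLoop n t w (orient (w (n - 1)) (w 0) (w 1)))
    (hs : AtEdges n w i j s) (hi : i < t) (hj : j < n - 1 - t) :
    advance.Defined s ∧ AtEdges n w (h.chart.step (i, j)).1 (h.chart.step (i, j)).2 (advance.eval s) ∧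
      (advance.eval s).imem = s.imem ∧ (advance.eval s).rmem = s.rmem ∧
      (advance.eval s).ireg 13 = h.chart.flag (i, j) ∧
      ∀ a, a ≠ 5 → a ≠ 6 → a ≠ 13 → (advance.eval s).ireg a = s.ireg a := by
  have ht := h.t_lt
  have e0 := hs.eval_turn (by omega)
  have e1 := hs.eval_pa (by omega)
  have e2 := hs.eval_pa' (by omega)
  have e3 := hs.eval_pb (by omega)
  have e4 := hs.eval_pb' (by omega)
  have d : ∀ a o, (PExp.cell a o).Defined s := PExp.defined_cell
  have dt : turn.Defined s := PExp.defined_area (d _ _) (d _ _) (d _ _)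
  have ev : ∀ p q r : PExp, (RExp.mul turn (PExp.area p q r)).eval s =
      orient (w (n - 1)) (w 0) (w 1) * orient (p.eval s) (q.eval s) (r.eval s) := by
    intro p q r
    rw [RExp.eval, e0, PExp.eval_area]
  have hb := chart_b_succ h j
  have h1 := h.chart_A_neg_iff hi (w (n - 2 - j))
  have h2 := h.chart_B_neg_iff (j := j) (k := n - 2 - j) (by omega) (by omega) (w (i + 1))
  rw [← hb] at h1
  rw [show n - 2 - j + 1 = n - 1 - j by omega] at h2
  -- The factor `turn` makes the tests independent of the direction in which the vertices are
  -- listed.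
  have g1 : 0 ≤ (RExp.mul turn (PExp.area pa pa' pb')).eval s ↔
      ¬ h.chart.A i (h.chart.b (j + 1)) < 0 := by
    rw [ev, e1, e2, e4, h1, not_lt, hb]
  have g2 : 0 ≤ (RExp.mul turn (PExp.area pb' pb pa')).eval s ↔
      ¬ h.chart.B j (h.chart.a (i + 1)) < 0 := by
    rw [ev, e2, e3, e4]
    change _ ↔ ¬ h.chart.B j (w (i + 1)) < 0
    rw [h2, not_lt]
  have r5 := hs.reg5
  have r6 := hs.reg6
  refine ⟨⟨⟨dt, PExp.defined_area (d _ _) (d _ _) (d _ _)⟩, fun _ =>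
    ⟨⟨dt, PExp.defined_area (d _ _) (d _ _) (d _ _)⟩, fun _ => ⟨trivial, trivial, trivial⟩,
      fun _ => ⟨trivial, trivial⟩⟩, fun _ => ⟨trivial, trivial⟩⟩, ?_⟩
  by_cases c1 : h.chart.A i (h.chart.b (j + 1)) < 0
  · have c2 := not_lt.2 (FunnelChart.B_nonneg_of_A_neg hi hj c1)
    have hst : h.chart.step (i, j) = (i + 1, j) := by simp [FunnelChart.step, c1, c2]
    have hfl : h.chart.flag (i, j) = 1 := by simp [FunnelChart.flag, c1]
    have hev : advance.eval s = (Cmd.seq (.set 13 1) (.inc 5 2)).eval s := by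
      rw [advance, Cmd.eval, if_neg (by rw [g1]; exact not_not.2 c1)]
    rw [hev, hst, hfl]
    refine ⟨⟨?_, ?_, hs.reg20, hs.reg21, hs.verts⟩, rfl, rfl, rfl, fun a h1 h2 h3 => ?_⟩
    · simp [Cmd.eval, r5]; ring
    · simp [Cmd.eval, r6]
    · simp [Cmd.eval, h1, h3]
  · by_cases c2 : h.chart.B j (h.chart.a (i + 1)) < 0
    · have hst : h.chart.step (i, j) = (i, j + 1) := by simp [FunnelChart.step, c1, c2]
      have hfl : h.chart.flag (i, j) = 2 := by simp [FunnelChart.flag, c1, c2]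
      have hev : advance.eval s = (Cmd.seq (.set 13 2) (.dec 6 2)).eval s := by
        rw [advance, Cmd.eval, if_pos (g1.2 c1), Cmd.eval, if_neg (by rw [g2]; exact not_not.2 c2)]
      rw [hev, hst, hfl]
      refine ⟨⟨?_, ?_, hs.reg20, hs.reg21, hs.verts⟩, rfl, rfl, rfl, fun a h1 h2 h3 => ?_⟩
      · simp [Cmd.eval, r5]
      · simp [Cmd.eval, r6]; omega
      · simp [Cmd.eval, h2, h3]
    · have hst : h.chart.step (i, j) = (i + 1, j + 1) := by simp [FunnelChart.step, c1, c2]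
      have hfl : h.chart.flag (i, j) = 0 := by simp [FunnelChart.flag, c1, c2]
      have hev : advance.eval s =
          (Cmd.seq (.set 13 0) (.seq (.inc 5 2) (.dec 6 2))).eval s := by
        rw [advance, Cmd.eval, if_pos (g1.2 c1), Cmd.eval, if_pos (g2.2 c2)]
      rw [hev, hst, hfl]
      refine ⟨⟨?_, ?_, hs.reg20, hs.reg21, hs.verts⟩, rfl, rfl, rfl, fun a h1 h2 h3 => ?_⟩
      · simp [Cmd.eval, r5]; ring
      · simp [Cmd.eval, r6]; omega
      · simp [Cmd.eval, h1, h2, h3]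

end Nodes

end RealRAM

/-! ### The main loop -/

namespace RealRAM

variable {n t : ℕ} {w : ℕ → ℝ × ℝ}

/-- The memory holds the data of the step `l` of the greedy matching. -/
structure Recorded (C : FunnelChart) (n l : ℕ) (s : State) : Prop where
  -- Integer memory: flags from `0`, offsets from `n`. Real memory: vertices from `0`, triangles
  -- from `2 * n`, pairs of candidates from `8 * n`, chosen points from `12 * n`. Fewer than `n`
  -- rounds keep the blocks apart.
  flag : s.imem l = C.flag (C.path l)
  offset : s.imem (n + l) = 3 * l
  corners : C.Corners (C.path l).1 (C.path l).2 (s.pointAt (2 * n + 6 * l))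
    (s.pointAt (2 * n + 6 * l + 2)) (s.pointAt (2 * n + 6 * l + 4))
  candA : C.GoodA (C.path l).1 (C.path l).2 (s.pointAt (8 * n + 4 * l))
  candB : C.GoodB (C.path l).1 (C.path l).2 (s.pointAt (8 * n + 4 * l + 2))

/-- The invariant of the main loop after `k` rounds. -/
structure MainInv (h : IsFunnelLoop n t w (orient (w (n - 1)) (w 0) (w 1))) (k : ℕ)
    (s : State) : Prop where
  edges : AtEdges n w (h.chart.path k).1 (h.chart.path k).2 s
  reg0 : s.ireg 0 = n
  reg8 : s.ireg 8 = 2 * n + 6 * k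
  reg9 : s.ireg 9 = 8 * n + 4 * k
  reg10 : s.ireg 10 = k
  reg11 : s.ireg 11 = n + k
  reg12 : s.ireg 12 = 3 * k
  node : ∀ l < k, Recorded h.chart n l s

variable {h : IsFunnelLoop n t w (orient (w (n - 1)) (w 0) (w 1))} {k : ℕ} {s : State}

theorem Recorded.congr {C : FunnelChart} {l : ℕ} {s s' : State} (hr : Recorded C n l s)
    (h1 : s'.imem l = s.imem l) (h2 : s'.imem (n + l) = s.imem (n + l))
    (h3 : ∀ o, o = 0 ∨ o = 2 ∨ o = 4 → s'.pointAt (2 * n + 6 * l + o) = s.pointAt (2 * n + 6 * l + o))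
    (h4 : ∀ o, o = 0 ∨ o = 2 → s'.pointAt (8 * n + 4 * l + o) = s.pointAt (8 * n + 4 * l + o)) :
    Recorded C n l s' where
  flag := h1.trans hr.flag
  offset := h2.trans hr.offset
  corners := by
    rw [h3 2 (by simp), h3 4 (by simp)]
    have := h3 0 (by simp)
    rw [Nat.add_zero] at this
    rw [this]
    exact hr.corners
  candA := by
    have := h4 0 (by simp)
    rw [Nat.add_zero] at this
    rw [this]
    exact hr.candA
  candB := by
    rw [h4 2 (by simp)]
    exact hr.candB

theorem MainInv.step (hm : MainInv h k s) (hk : k + 1 < n) (hi : (h.chart.path k).1 < t)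
    (hj : (h.chart.path k).2 < n - 1 - t) :
    round.Defined s ∧ MainInv h (k + 1) (round.eval s) := by
  obtain ⟨i, j, hij⟩ : ∃ i j, h.chart.path k = (i, j) := ⟨_, _, rfl⟩
  have hedge := hm.edges
  rw [hij] at hi hj hedge
  simp only at hi hj hedge
  set s₁ := prep.eval s with hs₁
  have a₁ : AtEdges n w i j s₁ := ⟨hedge.reg5, hedge.reg6, hedge.reg20, hedge.reg21, hedge.verts⟩
  have r7 : s₁.ireg 7 = 2 * i - 2 := by
    simp [hs₁, prep, Cmd.eval, hedge.reg5, hedge.reg20]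
  have r8 : s₁.ireg 8 = 2 * n + 6 * k := hm.reg8
  have r9 : s₁.ireg 9 = 8 * n + 4 * k := hm.reg9
  set s₂ := (Cmd.store 8 [corner₁.1, corner₁.2, corner₂.1, corner₂.2, corner₃.1, corner₃.2]).eval s₁
    with hs₂
  -- The candidates are evaluated after the triangle has been written; the vertices are intact since
  -- all writes are at `2 * n` or beyond.
  have a₂ : AtEdges n w i j s₂ := a₁.store (by omega)
  have r7' : s₂.ireg 7 = 2 * i - 2 := r7
  have r9' : s₂.ireg 9 = 8 * n + 4 * k := r9
  set s₃ := (Cmd.store 9 [candA.1, candA.2, candB.1, candB.2]).eval s₂ with hs₃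
  have a₃ : AtEdges n w i j s₃ := a₂.store (by omega)
  obtain ⟨⟨d1, d2, d3⟩, hc⟩ := corners_spec h a₁ hi hj
  obtain ⟨⟨d4, d5⟩, gA, gB⟩ := cand_spec h a₂ r7' hi hj
  obtain ⟨d6, a₄, im, rm, r13, hreg⟩ := advance_spec h a₃ hi hj
  set s₄ := advance.eval s₃ with hs₄
  have hround : round.eval s = record.eval s₄ := rfl
  have e0 := hreg 0 (by omega) (by omega) (by omega)
  have e8 := hreg 8 (by omega) (by omega) (by omega)
  have e9 := hreg 9 (by omega) (by omega) (by omega)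
  have e10 := hreg 10 (by omega) (by omega) (by omega)
  have e11 := hreg 11 (by omega) (by omega) (by omega)
  have e12 := hreg 12 (by omega) (by omega) (by omega)
  have e0' : s₃.ireg 0 = n := hm.reg0
  have e10' : s₃.ireg 10 = k := hm.reg10
  have e11' : s₃.ireg 11 = n + k := hm.reg11
  have e12' : s₃.ireg 12 = 3 * k := hm.reg12
  have e8' : s₃.ireg 8 = 2 * n + 6 * k := r8
  have e9' : s₃.ireg 9 = 8 * n + 4 * k := r9
  have hmem : (record.eval s₄).imem =
      Function.update (Function.update s.imem (n + k) (3 * k)) k (h.chart.flag (i, j)) := by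
    have : (record.eval s₄).imem = Function.update (Function.update s₄.imem (s₄.ireg 11)
      (s₄.ireg 12)) (s₄.ireg 10) (s₄.ireg 13) := rfl
    rw [this, e10, e11, e12, r13, im, e10', e11', e12']
    rfl
  have hpt : ∀ x, (record.eval s₄).pointAt x = s₃.pointAt x := by
    intro x
    change (s₄.rmem x, s₄.rmem (x + 1)) = _
    rw [rm]
    rfl
  have hold : ∀ x, x + 1 < 2 * n + 6 * k → s₃.pointAt x = s.pointAt x := by
    intro x hx
    rw [hs₃, pointAt_store_of_lt (by omega), hs₂, pointAt_store_of_lt (by omega)]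
    rfl
  have hold' : ∀ x, 8 * n ≤ x → x + 1 < 8 * n + 4 * k → s₃.pointAt x = s.pointAt x := by
    intro x hx hx'
    rw [hs₃, pointAt_store_of_lt (by omega), hs₂, pointAt_store_of_ge (by simp; omega)]
    rfl
  have hcor : ∀ o (ho : o + 1 < 6), s₃.pointAt (2 * n + 6 * k + o) = s₂.pointAt (2 * n + 6 * k + o) := by
    intro o ho
    rw [hs₃, pointAt_store_of_lt (by omega)]
  refine ⟨⟨⟨trivial, trivial⟩, ⟨?_, ?_⟩, d6, by simp [record, Cmd.Defined]⟩, ?_⟩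
  · intro e he
    simp only [List.mem_cons, List.not_mem_nil, or_false] at he
    rcases he with rfl | rfl | rfl | rfl | rfl | rfl
    exacts [d1.1, d1.2, d2.1, d2.2, d3.1, d3.2]
  · intro e he
    simp only [List.mem_cons, List.not_mem_nil, or_false] at he
    rcases he with rfl | rfl | rfl | rfl
    exacts [d4.1, d4.2, d5.1, d5.2]
  rw [hround]
  refine ⟨?_, ?_, ?_, ?_, ?_, ?_, ?_, ?_⟩
  · rw [FunnelChart.path_succ, hij]
    exact ⟨a₄.reg5, a₄.reg6, a₄.reg20, a₄.reg21, a₄.verts⟩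
  · exact e0.trans e0'
  · change s₄.ireg 8 + 6 = _
    omega
  · change s₄.ireg 9 + 4 = _
    omega
  · change s₄.ireg 10 + 1 = _
    omega
  · change s₄.ireg 11 + 1 = _
    omega
  · change s₄.ireg 12 + 3 = _
    omega
  · intro l hl
    rcases Nat.lt_succ_iff_lt_or_eq.1 hl with hl | rfl
    · refine (hm.node l hl).congr ?_ ?_ (fun o ho => ?_) (fun o ho => ?_)
      · rw [hmem, Function.update_of_ne (by omega), Function.update_of_ne (by omega)]
      · rw [hmem, Function.update_of_ne (by omega), Function.update_of_ne (by omega)]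
      · rw [hpt, hold _ (by omega)]
      · rw [hpt, hold' _ (by omega) (by omega)]
    · refine ⟨?_, ?_, ?_, ?_, ?_⟩
      · rw [hmem, hij, Function.update_self]
      · rw [hmem, Function.update_of_ne (by omega), Function.update_self]
      · rw [hij, hpt, hpt, hpt, hcor 2 (by omega), hcor 4 (by omega)]
        have c0 := hcor 0 (by omega)
        rw [Nat.add_zero] at c0
        rw [c0, hs₂, pointAt_store (o := 0) (by omega) (by simp),
          pointAt_store (o := 2) (by omega) (by simp), pointAt_store (o := 4) (by omega) (by simp)]
        exact hc
      · rw [hij, hpt, hs₃, pointAt_store (o := 0) (by omega) (by simp)]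
        exact gA
      · rw [hij, hpt, hs₃, pointAt_store (o := 2) (by omega) (by simp)]
        exact gB

theorem MainInv.iterate (hm : MainInv h 0 s) {N : ℕ} (hN : N + 1 ≤ n)
    (hlt : ∀ k < N, (h.chart.path k).1 < t ∧ (h.chart.path k).2 < n - 1 - t) :
    ∀ k ≤ N, MainInv h k (round.eval^[k] s) := by
  intro k hk
  induction k with
  | zero => exact hm
  | succ k ih =>
    rw [Function.iterate_succ_apply']
    exact ((ih (by omega)).step (by omega) (hlt k hk).1 (hlt k hk).2).2

theorem mainInv_init (hs0 : s.ireg 0 = n) (hv : ∀ l < n, s.pointAt (2 * l) = w l) :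
    MainInv h 0 (init.eval s) where
  edges := by
    have := h.t_lt
    refine ⟨?_, ?_, ?_, ?_, hv⟩
    · simp [init, Cmd.eval, FunnelChart.path]
    · simp [init, Cmd.eval, FunnelChart.path, hs0]; omega
    · simp [init, Cmd.eval]
    · simp [init, Cmd.eval, hs0]; omega
  reg0 := hs0
  reg8 := by simp [init, Cmd.eval, hs0]; omega
  reg9 := by simp [init, Cmd.eval, hs0]; omega
  reg10 := by simp [init, Cmd.eval]
  reg11 := by simp [init, Cmd.eval, hs0]
  reg12 := by simp [init, Cmd.eval]
  node l hl := absurd hl (Nat.not_lt_zero l)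

/-! ### The backward pass -/

/-- The chain on which step `l` takes its point, `1` or `2`: its flag, or, if that is `0`, the chain
of the next step; `r` steps are left. -/
def side (f : ℕ → ℕ) (N : ℕ) : ℕ → ℕ
  | 0 => 1
  | r + 1 => if 1 ≤ f (N - (r + 1)) then f (N - (r + 1)) else side f N r

/-- The invariant of the second loop, when `r` steps have been treated. -/
structure BackInv (h : IsFunnelLoop n t w (orient (w (n - 1)) (w 0) (w 1))) (N r : ℕ)
    (s : State) : Prop where
  reg0 : s.ireg 0 = n
  reg1 : s.ireg 1 = 12 * n
  reg2 : s.ireg 2 = N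
  reg9 : s.ireg 9 = 8 * n + 4 * (N - r)
  reg10 : s.ireg 10 = N - r
  reg14 : s.ireg 14 = 1
  reg16 : s.ireg 16 = 12 * n + 2 * (N - r)
  reg20 : s.ireg 20 = 0
  reg22 : s.ireg 22 = side (fun l => h.chart.flag (h.chart.path l)) N r
  last : s.imem (n + N) = 3 * N
  node : ∀ l < N, Recorded h.chart n l s
  pts : ∀ q < r, s.pointAt (12 * n + 2 * (N - (q + 1))) =
    s.pointAt (8 * n + 4 * (N - (q + 1)) +
      if side (fun l => h.chart.flag (h.chart.path l)) N (q + 1) ≤ 1 then 0 else 2)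

theorem MainInv.between {N : ℕ} (hm : MainInv h N s) :
    between.Defined s ∧ BackInv h N 0 (between.eval s) := by
  have r0 := hm.reg0
  have r10 := hm.reg10
  have r20 := hm.edges.reg20
  have hmem : (RealRAM.between.eval s).imem = Function.update s.imem (n + N) (3 * N) := by
    rw [← hm.reg11, ← hm.reg12]
    rfl
  refine ⟨by simp [RealRAM.between, Cmd.Defined], ⟨r0, ?_, ?_, ?_, ?_, rfl, ?_, r20, rfl, ?_,
    fun l hl => ?_, fun q hq => absurd hq (Nat.not_lt_zero q)⟩⟩
  · simp [RealRAM.between, Cmd.eval, r0, r20]; omega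
  · simp [RealRAM.between, Cmd.eval, r10, r20]
  · exact hm.reg9
  · exact r10
  · simp [RealRAM.between, Cmd.eval, r0, r10]; omega
  · rw [hmem, Function.update_self]
  · refine (hm.node l hl).congr ?_ ?_ (fun _ _ => rfl) (fun _ _ => rfl)
    · rw [hmem, Function.update_of_ne (by omega)]
    · rw [hmem, Function.update_of_ne (by omega)]

theorem BackInv.step {N r : ℕ} (hb : BackInv h N r s) (hN : N + 1 ≤ n) (hr : r < N) :
    choose.Defined s ∧ BackInv h N (r + 1) (choose.eval s) := by
  set f : ℕ → ℕ := fun l => h.chart.flag (h.chart.path l) with hf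
  set s₁ := (Cmd.seq (.dec 10 1) (.seq (.dec 9 4) (.seq (.dec 16 2) (.seq (.load 23 10)
    (.iteLe 14 23 (.sum 22 23 20) (.inc 22 0)))))).eval s with hs₁
  have h23 : s.imem (N - (r + 1)) = f (N - (r + 1)) := (hb.node _ (by omega)).flag
  have r14 := hb.reg14
  have r20 := hb.reg20
  have r22 : s.ireg 22 = side f N r := hb.reg22
  have r9 := hb.reg9
  have r10 := hb.reg10
  have r16 := hb.reg16
  have e10 : s.ireg 10 - 1 = N - (r + 1) := by omega
  have hs₁' : s₁ = { s with ireg := Function.update (Function.update (Function.update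
      (Function.update (Function.update s.ireg 10 (N - (r + 1))) 9 (8 * n + 4 * (N - (r + 1))))
      16 (12 * n + 2 * (N - (r + 1)))) 23 (f (N - (r + 1)))) 22 (side f N (r + 1)) } := by
    have e9 : s.ireg 9 - 4 = 8 * n + 4 * (N - (r + 1)) := by omega
    have e16 : s.ireg 16 - 2 = 12 * n + 2 * (N - (r + 1)) := by omega
    simp only [hs₁, Cmd.eval, side]
    by_cases hc : 1 ≤ f (N - (r + 1))
    · simp [e10, e9, e16, h23, r14, r20, hc]
    · simp [e10, e9, e16, h23, r14, r22, hc]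
  -- The offset of the chosen candidate within its pair.
  set o : ℕ := if side f N (r + 1) ≤ 1 then 0 else 2 with ho
  have ho' : o = 0 ∨ o = 2 := by rw [ho]; split <;> simp
  have hch : choose.eval s = (Cmd.store 16 [.ld 9 o, .ld 9 (o + 1)]).eval s₁ := by
    have : choose.eval s = (Cmd.iteLe 22 14 (.store 16 [.ld 9 0, .ld 9 1])
      (.store 16 [.ld 9 2, .ld 9 3])).eval s₁ := rfl
    have hite : ∀ c d, (Cmd.iteLe 22 14 c d).eval s₁ =
      if s₁.ireg 22 ≤ s₁.ireg 14 then c.eval s₁ else d.eval s₁ := fun _ _ => rfl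
    rw [this, hite, show s₁.ireg 22 = side f N (r + 1) by rw [hs₁']; simp,
      show s₁.ireg 14 = 1 by rw [hs₁']; simp [r14], ho]
    split_ifs <;> rfl
  have c9 : s₁.ireg 9 = 8 * n + 4 * (N - (r + 1)) := by rw [hs₁']; simp
  have c16 : s₁.ireg 16 = 12 * n + 2 * (N - (r + 1)) := by rw [hs₁']; simp
  have hpt₁ : ∀ x, s₁.pointAt x = s.pointAt x := fun x => by rw [hs₁']; rfl
  have hlow : ∀ x, x + 1 < 12 * n → (choose.eval s).pointAt x = s.pointAt x := by
    intro x hx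
    rw [hch, pointAt_store_of_lt (by omega), hpt₁]
  have him : (choose.eval s).imem = s.imem := by
    rw [hch, hs₁']
    rfl
  have hreg : ∀ a, (choose.eval s).ireg a = s₁.ireg a := by
    intro a
    rw [hch]
    rfl
  refine ⟨⟨trivial, trivial, trivial, trivial, ⟨fun _ => trivial, fun _ => trivial⟩,
    fun _ => ?_, fun _ => ?_⟩, ⟨?_, ?_, ?_, ?_, ?_, ?_, ?_, ?_, ?_, ?_, fun l hl => ?_,
    fun q hq => ?_⟩⟩
  · simp [Cmd.Defined, RExp.Defined]
  · simp [Cmd.Defined, RExp.Defined]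
  · rw [hreg, hs₁']; simp [hb.reg0]
  · rw [hreg, hs₁']; simp [hb.reg1]
  · rw [hreg, hs₁']; simp [hb.reg2]
  · rw [hreg, c9]
  · rw [hreg, hs₁']; simp
  · rw [hreg, hs₁']; simp [r14]
  · rw [hreg, c16]
  · rw [hreg, hs₁']; simp [r20]
  · rw [hreg, hs₁']
    simp [hf]
  · rw [him, hb.last]
  · exact (hb.node l hl).congr (by rw [him]) (by rw [him]) (fun o ho => hlow _ (by omega))
      (fun o ho => hlow _ (by omega))
  · rcases Nat.lt_succ_iff_lt_or_eq.1 hq with hq | rfl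
    -- Points chosen in earlier rounds are at higher addresses than the one written now.
    · rw [hlow (8 * n + 4 * (N - (q + 1)) + _) (by split <;> omega), ← hb.pts q hq, hch,
        pointAt_store_of_ge (by rw [c16, List.length_cons, List.length_singleton]; omega), hpt₁]
    · rw [hlow (8 * n + 4 * (N - (q + 1)) + _) (by split <;> omega), hch,
        pointAt_store (o := 0) (by omega) (by simp), ← hpt₁, ← hf, ← ho, ← c9]
      rfl

theorem BackInv.iterate {N : ℕ} (hb : BackInv h N 0 s) (hN : N + 1 ≤ n) :
    ∀ r ≤ N, BackInv h N r (choose.eval^[r] s) := by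
  intro r hr
  induction r with
  | zero => exact hb
  | succ r ih =>
    rw [Function.iterate_succ_apply']
    exact ((ih (by omega)).step hN hr).2

/-! ### Output and running time -/

/-- What the algorithm computes. -/
structure Result (h : IsFunnelLoop n t w (orient (w (n - 1)) (w 0) (w 1))) (N : ℕ)
    (s : State) : Prop where
  reg0 : s.ireg 0 = N
  reg1 : s.ireg 1 = 12 * n
  reg2 : s.ireg 2 = N
  reg3 : s.ireg 3 = n
  reg4 : s.ireg 4 = 2 * n
  offset : ∀ l ≤ N, s.imem (n + l) = 3 * l
  corners : ∀ l < N, h.chart.Corners (h.chart.path l).1 (h.chart.path l).2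
    (s.pointAt (2 * n + 6 * l)) (s.pointAt (2 * n + 6 * l + 2)) (s.pointAt (2 * n + 6 * l + 4))
  good : ∀ l < N,
    (side (fun l => h.chart.flag (h.chart.path l)) N (N - l) ≤ 1 ∧
      h.chart.GoodA (h.chart.path l).1 (h.chart.path l).2 (s.pointAt (12 * n + 2 * l))) ∨
    (¬ side (fun l => h.chart.flag (h.chart.path l)) N (N - l) ≤ 1 ∧
      h.chart.GoodB (h.chart.path l).1 (h.chart.path l).2 (s.pointAt (12 * n + 2 * l)))

theorem BackInv.final {N : ℕ} (hb : BackInv h N N s) :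
    final.Defined s ∧ Result h N (final.eval s) := by
  have r0 := hb.reg0
  have r2 := hb.reg2
  have r20 := hb.reg20
  refine ⟨by simp [RealRAM.final, Cmd.Defined], ⟨?_, ?_, ?_, ?_, ?_, fun l hl => ?_,
    fun l hl => (hb.node l hl).corners, fun l hl => ?_⟩⟩
  · simp [RealRAM.final, Cmd.eval, r2, r20]
  · simp [RealRAM.final, Cmd.eval, hb.reg1]
  · simp [RealRAM.final, Cmd.eval, r2]
  · simp [RealRAM.final, Cmd.eval, r0, r20]
  · simp [RealRAM.final, Cmd.eval, r0]; omega
  · rcases hl.lt_or_eq with hl | rfl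
    · exact (hb.node l hl).offset
    · exact hb.last
  · have hp := hb.pts (N - l - 1) (by omega)
    rw [show N - (N - l - 1 + 1) = l by omega, show N - l - 1 + 1 = N - l by omega] at hp
    change (_ ∧ h.chart.GoodA _ _ (s.pointAt (12 * n + 2 * l))) ∨
      (_ ∧ h.chart.GoodB _ _ (s.pointAt (12 * n + 2 * l)))
    rw [hp]
    by_cases hs : side (fun l => h.chart.flag (h.chart.path l)) N (N - l) ≤ 1
    · rw [if_pos hs]
      exact Or.inl ⟨hs, (hb.node l hl).candA⟩
    · rw [if_neg hs]
      exact Or.inr ⟨hs, (hb.node l hl).candB⟩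

/-- The factor in the linear bound of the running time. -/
def timeFactor : ℕ := init.cost + round.cost + between.cost + choose.cost + final.cost + 3

theorem exec_funnelProgram {N : ℕ} (hN : N + 1 ≤ n)
    (T : h.chart.Trace N (fun k => (h.chart.path k).1) (fun k => (h.chart.path k).2)
      (fun k => h.chart.A (h.chart.path k).1 (h.chart.b ((h.chart.path k).2 + 1)) < 0)
      (fun k => h.chart.B (h.chart.path k).2 (h.chart.a ((h.chart.path k).1 + 1)) < 0))
    (hs0 : s.ireg 0 = n) (hv : ∀ l < n, s.pointAt (2 * l) = w l) :
    ∃ k ≤ timeFactor * n, ∃ s', Exec funnelProgram s k s' ∧ Result h N s' := by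
  have ht := h.t_lt
  have hm := (mainInv_init (h := h) hs0 hv).iterate hN fun k hk => ⟨T.ii_lt k hk, T.jj_lt k hk⟩
  set s₁ := init.eval s
  have hmN := hm N le_rfl
  set s₂ := round.eval^[N] s₁
  obtain ⟨d3, hb⟩ := hmN.between
  set s₃ := between.eval s₂
  have hb' := hb.iterate hN
  have hbN := hb' N le_rfl
  set s₄ := choose.eval^[N] s₃
  obtain ⟨d5, hr⟩ := hbN.final
  have d1 : init.Defined s := by simp [init, Cmd.Defined]
  have w := wf_all
  have u1 := Cmd.runs init w.1 d1
  have u2 : Runs _ s₁ _ s₂ := Cmd.runs_while (a := 5) (b := 6) (by omega) (by omega) w.2.1 N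
    (s := s₁) (fun k hk => by
      have hk' := hm k hk.le
      have l1 : (h.chart.path k).1 < t := T.ii_lt k hk
      have l2 : (h.chart.path k).2 < n - 1 - t := T.jj_lt k hk
      refine ⟨?_, (hk'.step (by omega) l1 l2).1⟩
      rw [hk'.edges.reg5, hk'.edges.reg6]
      omega) (by
      have l1 : (h.chart.path N).1 = t := T.ii_end
      have l2 : (h.chart.path N).2 = n - 1 - t := T.jj_end
      have := h.t_pos
      rw [hmN.edges.reg5, hmN.edges.reg6, l1, l2]
      omega)
  have u3 : Runs _ s₂ _ s₃ := Cmd.runs between w.2.2.1 d3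
  have u4 : Runs _ s₃ _ s₄ := Cmd.runs_while (a := 14) (b := 10) (by omega) (by omega) w.2.2.2.1 N
    (s := s₃) (fun k hk => by
      have hk' := hb' k hk.le
      refine ⟨?_, (hk'.step hN hk).1⟩
      rw [hk'.reg14, hk'.reg10]
      omega) (by
      rw [hbN.reg14, hbN.reg10]
      omega)
  have u5 := Cmd.runs final w.2.2.2.2 d5
  obtain ⟨k, hk, s', he, hs'⟩ := (u1.seq (u2.seq (u3.seq (u4.seq u5)))) s
    ⟨fun _ _ => rfl, rfl, rfl⟩
  refine ⟨k, hk.trans ?_, s', he, ?_⟩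
  · have e1 : timeFactor * n = init.cost * n + round.cost * n + between.cost * n + choose.cost * n +
        final.cost * n + 3 * n := by rw [timeFactor]; ring
    have e2 : N * (round.cost + 1) ≤ n * (round.cost + 1) := Nat.mul_le_mul_right _ (by omega)
    have e3 : N * (choose.cost + 1) ≤ n * (choose.cost + 1) := Nat.mul_le_mul_right _ (by omega)
    have e4 := Nat.le_mul_of_pos_right init.cost (show 0 < n by omega)
    have e5 := Nat.le_mul_of_pos_right between.cost (show 0 < n by omega)
    have e6 := Nat.le_mul_of_pos_right final.cost (show 0 < n by omega)
    rw [e1]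
    have e7 : n * (round.cost + 1) = round.cost * n + n := by ring
    have e8 : n * (choose.cost + 1) = choose.cost * n + n := by ring
    omega
  · have hp : ∀ x, s'.pointAt x = (final.eval s₄).pointAt x := by
      intro x
      simp only [State.pointAt, hs'.rmem]
    refine ⟨?_, ?_, ?_, ?_, ?_, fun l hl => ?_, fun l hl => ?_, fun l hl => ?_⟩
    · rw [hs'.ireg 0 (by omega), hr.reg0]
    · rw [hs'.ireg 1 (by omega), hr.reg1]
    · rw [hs'.ireg 2 (by omega), hr.reg2]
    · rw [hs'.ireg 3 (by omega), hr.reg3]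
    · rw [hs'.ireg 4 (by omega), hr.reg4]
    · rw [hs'.imem, hr.offset l hl]
    · rw [hp, hp, hp]
      exact hr.corners l hl
    · rw [hp]
      exact hr.good l hl

end RealRAM

/-! ## Optimality -/

/-- A hidden set has at most as many points as a convex cover has pieces. -/
theorem IsHiddenSet.encard_le {P H : Set (ℝ × ℝ)} {C : Set (Set (ℝ × ℝ))} (hH : IsHiddenSet P H)
    (hC : IsConvexCover P C) : H.encard ≤ C.encard := by
  -- Send each point to a piece that contains it; two points in the same piece would see each other
  -- by convexity.
  have hex : ∀ x ∈ H, ∃ Q ∈ C, x ∈ Q := fun x hx => by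
    have := hH.1 hx
    rwa [← hC.2, mem_sUnion] at this
  choose! f hf hxf using hex
  refine encard_le_encard_of_injOn (f := f) hf fun x hx y hy hxy => ?_
  by_contra hne
  refine hH.2 hx hy hne ?_
  obtain ⟨m, v, -, hv⟩ := hC.1 _ (hf x hx)
  have hconv : Convex ℝ (f x) := by
    rw [hv]
    exact convex_convexHull ℝ _
  refine (hconv.segment_subset (hxf x hx) (hxy ▸ hxf y hy)).trans ?_
  rw [← hC.2]
  exact subset_sUnion_of_mem (hf x hx)

theorem eq_hiddenSetNumber {P H : Set (ℝ × ℝ)} {C : Set (Set (ℝ × ℝ))} (hH : IsHiddenSet P H)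
    (hC : IsConvexCover P C) (h : H.encard = C.encard) : H.encard = hiddenSetNumber P :=
  le_antisymm (le_iSup₂_of_le H hH le_rfl)
    (iSup₂_le fun _ hH' => h ▸ hH'.encard_le hC)

theorem eq_convexCoverNumber {P H : Set (ℝ × ℝ)} {C : Set (Set (ℝ × ℝ))} (hH : IsHiddenSet P H)
    (hC : IsConvexCover P C) (h : H.encard = C.encard) : C.encard = convexCoverNumber P :=
  le_antisymm (le_iInf₂ fun _ hC' => h ▸ hH.encard_le hC') (iInf₂_le_of_le C hC le_rfl)

/-! ## Triangles as convex polygons -/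

theorem isConvexVertexList_three {m : ℕ} (hm : m = 3) {F : ℕ → ℝ × ℝ}
    (h : orient (F 0) (F 1) (F 2) ≠ 0) : IsConvexVertexList fun i : Fin m => F i := by
  subst hm
  refine ⟨le_rfl, ?_⟩
  have key : ∀ i j k : Fin 3, i < j → j < k → i.val = 0 ∧ j.val = 1 ∧ k.val = 2 := by
    intro i j k hij hjk
    have h1 : i.val < j.val := hij
    have h2 : j.val < k.val := hjk
    omega
  rcases h.lt_or_gt with h | h
  · refine Or.inr fun i j k hij hjk => ?_
    obtain ⟨h1, h2, h3⟩ := key i j k hij hjk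
    beta_reduce
    rwa [h1, h2, h3]
  · refine Or.inl fun i j k hij hjk => ?_
    obtain ⟨h1, h2, h3⟩ := key i j k hij hjk
    beta_reduce
    rwa [h1, h2, h3]

theorem range_three {m : ℕ} (hm : m = 3) (F : ℕ → ℝ × ℝ) :
    range (fun i : Fin m => F i) = {F 0, F 1, F 2} := by
  subst hm
  ext z
  simp only [mem_range, mem_insert_iff, mem_singleton_iff]
  constructor
  · rintro ⟨i, rfl⟩
    fin_cases i <;> simp
  · rintro (rfl | rfl | rfl)
    exacts [⟨0, rfl⟩, ⟨1, rfl⟩, ⟨2, rfl⟩]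

/-! ## The result of the algorithm -/

namespace RealRAM

/-- Nonzero flags are the sides themselves, and a step with flag `0` inherits the side of its
successor: exactly the rule of the backward recursion. -/
theorem sides_side (C : FunnelChart) {N : ℕ}
    (T : C.Trace N (fun k => (C.path k).1) (fun k => (C.path k).2)
      (fun k => C.A (C.path k).1 (C.b ((C.path k).2 + 1)) < 0)
      (fun k => C.B (C.path k).2 (C.a ((C.path k).1 + 1)) < 0)) :
    FunnelChart.Trace.Sides N
      (fun k => C.A (C.path k).1 (C.b ((C.path k).2 + 1)) < 0)
      (fun k => C.B (C.path k).2 (C.a ((C.path k).1 + 1)) < 0)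
      (fun k => side (fun l => C.flag (C.path l)) N (N - k) ≤ 1) := by
  have hside : ∀ k < N, side (fun l => C.flag (C.path l)) N (N - k) =
      if 1 ≤ C.flag (C.path k) then C.flag (C.path k)
      else side (fun l => C.flag (C.path l)) N (N - (k + 1)) := by
    intro k hk
    obtain ⟨r, hr⟩ : ∃ r, N - k = r + 1 := ⟨N - (k + 1), by omega⟩
    rw [hr, side, show N - (r + 1) = k by omega, show N - (k + 1) = r by omega]
  refine ⟨fun k hk h => ?_, fun k hk h => ?_, fun k hk h1 h2 => ?_⟩
  · have hf : C.flag (C.path k) = 1 := if_pos h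
    rw [hside k hk, hf]
    simp
  · have hf : C.flag (C.path k) = 2 := by
      have := T.symm.not_sb hk h
      rw [FunnelChart.flag, if_neg this, if_pos h]
    rw [hside k hk, hf]
    simp
  · have hf : C.flag (C.path k) = 0 := by
      rw [FunnelChart.flag, if_neg h1, if_neg h2]
    rw [hside k (by omega), hf]
    simp

variable {n t : ℕ} {w : ℕ → ℝ × ℝ} {h : IsFunnelLoop n t w (orient (w (n - 1)) (w 0) (w 1))}
  {N : ℕ} {s : State}

/-- The point emitted at step `k`. -/
def hidden (n : ℕ) (s : State) (k : ℕ) : ℝ × ℝ := s.pointAt (12 * n + 2 * k)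

theorem Result.mem_region (R : Result h N s) {k : ℕ} (hk : k < N) :
    hidden n s k ∈ h.chart.region := by
  rcases R.good k hk with ⟨-, hg⟩ | ⟨-, hg⟩
  · exact hg.onA.mem_region
  · exact FunnelChart.OnB.mem_region hg.onA

theorem Result.not_sees (R : Result h N s)
    (T : h.chart.Trace N (fun k => (h.chart.path k).1) (fun k => (h.chart.path k).2)
      (fun k => h.chart.A (h.chart.path k).1 (h.chart.b ((h.chart.path k).2 + 1)) < 0)
      (fun k => h.chart.B (h.chart.path k).2 (h.chart.a ((h.chart.path k).1 + 1)) < 0))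
    {k l : ℕ} (hkl : k ≠ l) (hk : k < N) (hl : l < N) :
    ¬ Sees h.chart.region (hidden n s k) (hidden n s l) := by
  have key : ∀ {k l : ℕ}, k < l → l < N →
      ¬ Sees h.chart.region (hidden n s k) (hidden n s l) := by
    intro k l hkl hl
    refine T.not_sees (sides_side _ T) (pt := hidden n s) (fun k hk hta => ?_)
      (fun k hk hta => ?_) hkl hl
    · rcases R.good k hk with ⟨-, hg⟩ | ⟨hs, -⟩
      · exact ⟨hg.onA, hg.neg⟩
      · exact absurd hta hs
    · rcases R.good k hk with ⟨hs, -⟩ | ⟨-, hg⟩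
      · exact absurd hs hta
      · exact ⟨hg.onA, hg.neg⟩
  rcases hkl.lt_or_gt with hlt | hlt
  · exact key hlt hl
  · have := key hlt hk
    rwa [Sees, segment_symm] at this

theorem Result.piece_eq (R : Result h N s) (k : ℕ) : s.piece k =
    fun i : Fin (s.imem (s.ireg 3 + k + 1) - s.imem (s.ireg 3 + k)) =>
      (fun x => s.pointAt (2 * n + 2 * (s.imem (s.ireg 3 + k) + x))) i.val := by
  rw [← R.reg4]
  rfl

theorem Result.piece_spec (R : Result h N s)
    (T : h.chart.Trace N (fun k => (h.chart.path k).1) (fun k => (h.chart.path k).2)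
      (fun k => h.chart.A (h.chart.path k).1 (h.chart.b ((h.chart.path k).2 + 1)) < 0)
      (fun k => h.chart.B (h.chart.path k).2 (h.chart.a ((h.chart.path k).1 + 1)) < 0))
    {k : ℕ} (hk : k < N) : IsConvexVertexList (s.piece k) ∧
      convexHull ℝ (range (s.piece k)) = h.triangle (h.chart.path k).1 (h.chart.path k).2 := by
  obtain ⟨h1, h2⟩ := h.corners_hull (T.ii_lt k hk) (T.jj_lt k hk) (R.corners k hk)
    fun z hz => T.add_pos hk hz
  have o1 : s.imem (s.ireg 3 + k) = 3 * k := by rw [R.reg3, R.offset k hk.le]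
  have o2 : s.imem (s.ireg 3 + k + 1) = 3 * k + 3 := by
    rw [R.reg3, Nat.add_assoc, R.offset (k + 1) hk, Nat.mul_succ]
  have hm : s.imem (s.ireg 3 + k + 1) - s.imem (s.ireg 3 + k) = 3 := by omega
  have e0 : 2 * n + 2 * (3 * k + 0) = 2 * n + 6 * k := by ring
  have e1 : 2 * n + 2 * (3 * k + 1) = 2 * n + 6 * k + 2 := by ring
  have e2 : 2 * n + 2 * (3 * k + 2) = 2 * n + 6 * k + 4 := by ring
  rw [R.piece_eq]
  constructor
  · refine isConvexVertexList_three (F := fun x => s.pointAt (2 * n + 2 *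
      (s.imem (s.ireg 3 + k) + x))) hm ?_
    simp only [o1, e0, e1, e2]
    exact h1
  · rw [range_three (F := fun x => s.pointAt (2 * n + 2 * (s.imem (s.ireg 3 + k) + x))) hm, ← h2]
    simp only [o1, e0, e1, e2]

theorem Result.optimal (R : Result h N s)
    (T : h.chart.Trace N (fun k => (h.chart.path k).1) (fun k => (h.chart.path k).2)
      (fun k => h.chart.A (h.chart.path k).1 (h.chart.b ((h.chart.path k).2 + 1)) < 0)
      (fun k => h.chart.B (h.chart.path k).2 (h.chart.a ((h.chart.path k).1 + 1)) < 0)) :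
    ∃ H C, s.StoresPoints H ∧ s.StoresPolygons C ∧ IsHiddenSet h.chart.region H ∧
      IsConvexCover h.chart.region C ∧ H.encard = C.encard := by
  -- Every point of the region sees itself, so points that do not see each other are distinct.
  have hinj : InjOn (hidden n s) (Iio N) := by
    intro k hk l hl hkl
    by_contra hne
    refine R.not_sees T hne hk hl ?_
    rw [hkl, Sees, segment_same, singleton_subset_iff]
    exact R.mem_region hl
  have hcard : (hidden n s '' Iio N).encard = N := by
    rw [hinj.encard_image, ← Finset.coe_Iio, encard_coe_eq_coe_finsetCard, Nat.card_Iio]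
  have hH : IsHiddenSet h.chart.region (hidden n s '' Iio N) := by
    refine ⟨?_, ?_⟩
    · rintro _ ⟨k, hk, rfl⟩
      exact R.mem_region hk
    · rintro _ ⟨k, hk, rfl⟩ _ ⟨l, hl, rfl⟩ hne
      exact R.not_sees T (fun he => hne (by rw [he])) hk hl
  set F : ℕ → Set (ℝ × ℝ) := fun k => convexHull ℝ (range (s.piece k)) with hF
  have hC : IsConvexCover h.chart.region (F '' Iio N) := by
    refine ⟨?_, subset_antisymm (sUnion_subset ?_) fun z hz => ?_⟩
    · rintro _ ⟨k, hk, rfl⟩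
      exact ⟨_, _, (R.piece_spec T hk).1, rfl⟩
    · rintro _ ⟨k, hk, rfl⟩ z hz
      simp only [hF, (R.piece_spec T hk).2] at hz
      exact ⟨hz.1, ⟨_, T.ii_lt k hk, hz.2.1⟩, _, T.jj_lt k hk, hz.2.2⟩
    · obtain ⟨k, hk, h1, h2⟩ := T.cover hz
      refine ⟨F k, ⟨k, hk, rfl⟩, ?_⟩
      simp only [hF, (R.piece_spec T hk).2]
      exact ⟨hz.1, h1, h2⟩
  -- That the triangles are distinct needs no geometry: a cover has at least as many pieces as the
  -- hidden set has points.
  have hcard' : (F '' Iio N).encard = N := by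
    refine le_antisymm ((encard_image_le _ _).trans_eq ?_) (hcard ▸ hH.encard_le hC)
    rw [← Finset.coe_Iio, encard_coe_eq_coe_finsetCard, Nat.card_Iio]
  refine ⟨_, _, ⟨?_, ?_⟩, ⟨?_, ?_, ?_⟩, hH, hC, hcard.trans hcard'.symm⟩
  · rw [R.reg0, R.reg1]
    ext z
    exact ⟨fun ⟨k, hk, he⟩ => ⟨k, hk, he.symm⟩, fun ⟨k, hk, he⟩ => ⟨k, hk, he.symm⟩⟩
  · rw [R.reg0, hcard]
  · rw [R.reg2]
    exact fun k hk => (R.piece_spec T hk).1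
  · rw [R.reg2]
    ext z
    exact ⟨fun ⟨k, hk, he⟩ => ⟨k, hk, he.symm⟩, fun ⟨k, hk, he⟩ => ⟨k, hk, he.symm⟩⟩
  · rw [R.reg2, hcard']

theorem pointAt_inputState {n : ℕ} (hn : 0 < n) (v : Fin n → ℝ × ℝ) {l : ℕ} (hl : l < n) :
    (inputState v).pointAt (2 * l) = cyc hn v l := by
  have e1 : 2 * l / 2 = l := by omega
  have e2 : (2 * l + 1) / 2 = l := by omega
  have e3 : 2 * l % 2 = 0 := by omega
  have e4 : (2 * l + 1) % 2 ≠ 0 := by omega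
  rw [cyc_of_lt hn v hl]
  simp only [State.pointAt, inputState, e1, e2, e3, e4, hl, dif_pos, if_true, if_false]

end RealRAM

theorem mainTheorem11 :
    ∃ (prog : RealRAM.Program) (c : ℕ),
      ∀ (n : ℕ) (v : Fin n → ℝ × ℝ), IsFunnel v →
        (∃ (k : ℕ) (s : RealRAM.State) (H : Set (ℝ × ℝ)) (C : Set (Set (ℝ × ℝ))),
          RealRAM.Exec prog (RealRAM.inputState v) k s ∧ k ≤ c * n ∧
          s.StoresPoints H ∧ s.StoresPolygons C ∧
          IsHiddenSet (polyRegion v) H ∧ IsConvexCover (polyRegion v) C ∧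
          H.encard = C.encard ∧
          H.encard = hiddenSetNumber (polyRegion v) ∧
          C.encard = convexCoverNumber (polyRegion v)) ∧
        IsHomestead (polyRegion v) := by
  refine ⟨RealRAM.funnelProgram, RealRAM.timeFactor, fun n v hv => ?_⟩
  have hn : 0 < n := by
    have := hv.1.three_le
    omega
  obtain ⟨t, h⟩ := hv.exists_loop hn
  have ht := h.t_lt
  obtain ⟨N, hN, T⟩ := h.chart.exists_trace
  -- The two chains have `n - 1` edges together.
  have hN' : N + 1 ≤ n := by
    change N ≤ t + (n - 1 - t) at hN
    omega
  obtain ⟨k, hk, s, he, R⟩ := RealRAM.exec_funnelProgram (s := RealRAM.inputState v) hN' T rfl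
    fun l hl => RealRAM.pointAt_inputState hn v hl
  obtain ⟨H, C, hsH, hsC, hH, hC, hHC⟩ := R.optimal T
  rw [h.region_eq, ← polyRegion_eq_compl] at hH hC
  have e1 := eq_hiddenSetNumber hH hC hHC
  have e2 := eq_convexCoverNumber hH hC hHC
  exact ⟨⟨k, s, H, C, he, hk, hsH, hsC, hH, hC, hHC, e1, e2⟩, by
    rw [IsHomestead, ← e1, ← e2, hHC]⟩
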